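/- **Theorem 2.1.** Write points of the universal covering of $\mathbb C\setminus\{0\}$ as $t=|t|e^{i\arg t}$ with $\arg t\in\mathbb R$. For an open interval $I$ and a positive continuous function $\rho$ on $I$ put $S_0(I)=\{t:\arg t\in I,\ 0<|t|<\rho(\arg t)\}$ (the letter $S_0(I)$ is used for various $\rho$), and for $I=(a,b)$ put $I_\epsilon=(a+\epsilon,b-\epsilon)$. All norms on $\mathbb C^N$ are maximum norms. Let $k>0$. For $|I|>\pi/k$ and a domain $\Omega\subset\mathbb C^N$, a function $\phi(t,Y)$ holomorphic on $S_0(I)\times\Omega$ is *$k$-Borel summable in $t$*, with expansion $\sum_l a_l(Y)t^l$, if the $a_l$ are holomorphic on $\Omega$ and there are constants $M,C>0$ such that $$\Big|\phi(t,Y)-\sum_{l=0}^{N-1}a_l(Y)t^l\Big|\le M C^N|t|^N\,\Gamma\Big(\frac Nk+1\Big)\qquad\text{for all }N\ge 0,\ (t,Y)\in S_0(I)\times\Omega .$$ A formal series $\sum_l a_l(Y)t^l$ is *$k$-Borel summable in the direction $\theta$ in $\Omega$* if it is the expansion in this sense of some function on some $S_0((\theta-\delta,\theta+\delta))\times\Omega$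 with $\delta>\pi/(2k)$. Let $I=(a,b)$ with $b-a>\pi/k$, let $R_0,R_1>0$, $m,n\in\mathbb N$, and let $$\Omega=\{(x,U,P)\in\mathbb C^n\times\mathbb C^m\times\mathbb C^{mn}: |x|<R_0,\ |U|<R_1,\ |P|<R_1\}.$$ Let $f_i(t,x,U,P)$, $1\le i\le m$, be $k$-Borel summable in $t$ on $S_0(I)\times\Omega$, with expansions $\sum_l f_{i,l}(x,U,P)t^l$. Consider the Cauchy problem $$\text{(CP)}\qquad \partial_t u_i=f_i(t,x,U,\nabla_xU),\qquad u_i(0,x)=0,\qquad 1\le i\le m,$$ where $U=(u_1,\dots,u_m)$, $\nabla_xU=(\partial_{x_j}u_i)_{i,j}$, and $u_i(0,x)=0$ means that $u_i(t,x)\to0$ as $t\to0$ along every ray $\arg t=\theta\in I$, for every $x$. Then: 1. (CP), with $f_i$ replaced by $\sum_l f_{i,l}t^l$, has a formal solution $\widetilde u_i=\sum_l u_{i,l}(x)t^l$ with coefficients holomorphic in $|x|<R_0$, and it is unique, also among formal solutions with coefficients holomorphic in a smaller polydisc $|x|<r$. 2. (CP) has a solution $U$, holomorphic on $S_0(I)\times\{|x|<r\}$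 for some $r>0$ and some $S_0(I)$ contained in the given one. 3. Let $U$ be any holomorphic solution of (CP) on $S_0(I)\times\{|x|<r\}$, for some $0<r\le R_0$ and some $S_0(I)$ contained in the given one. Then: - for every $\theta\in I$, every solution of (CP) on the ray $\arg t=\theta$ that is defined for small $|t|>0$ and small $|x|$, holomorphic in $x$, and differentiable in $|t|$ coincides with $U$ for all sufficiently small $|t|$ and $|x|$ (so $U$ is the solution of Nagumo's existence and uniqueness theorem); - there is a polydisc $\omega=\{|x|<r'\}$, $0<r'\le r$, such that for every $\epsilon>0$ with $|I_\epsilon|>\pi/k$ the functions $u_i$ are $k$-Borel summable in $t$ on $S_0(I_\epsilon)\times\omega$ for some $S_0(I_\epsilon)$ contained in the domain of $U$, with expansion $\widetilde u_i$. In particular the formal solution $\widetilde u_i$ is $k$-Borel summable in $\omega$ in every direction $\theta\in(a+\frac{\pi}{2k},\,b-\frac{\pi}{2k})$. -/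

import Mathlib

open Set Filter Topology Metric

/-! Sectors on the universal cover of the punctured plane.

The universal covering space of `ℂ \ {0}` is the plane `ℂ` with covering map `exp`.
A point `t` of the cover is represented by `z = log t`, so `|t| = exp z.re`, `arg t = z.im` is a
real number (not reduced modulo `2π`), the complex number below `t` is `exp z`, and a function of `t`
is holomorphic iff it is holomorphic in `z`. -/

/-- A radius function of a sector over `I = (a, b)`: continuous and positive on `I`. -/
structure IsRadius (a b : ℝ) (ρ : ℝ → ℝ) : Prop where
  continuousOn : ContinuousOn ρ (Ioo a b)
  pos : ∀ θ ∈ Ioo a b, 0 < ρ θ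

/-- The sectorial domain `S₀(I) = {t : arg t ∈ I, 0 < |t| < ρ(arg t)}`, `I = (a, b)`, in the
coordinate `z = log t`. -/
def sector (a b : ℝ) (ρ : ℝ → ℝ) : Set ℂ :=
  {z | z.im ∈ Ioo a b ∧ Real.exp z.re < ρ z.im}

/-- The function `φ(t, Y)`, with `t = exp z`, is holomorphic on `S₀(I) × Ω` and is `k`-Borel summable
there with respect to `t`, with asymptotic expansion `∑ c_N(Y) t^N`:
`|φ(t, Y) - ∑_{l < N} c_l(Y) t^l| ≤ M C^N |t|^N Γ(N/k + 1)` on `S₀(I) × Ω` for all `N ≥ 0`. -/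
structure HasBorelExpansion {E : Type*} [NormedAddCommGroup E] [NormedSpace ℂ E]
    (k a b : ℝ) (ρ : ℝ → ℝ) (Ω : Set E) (φ : ℂ → E → ℂ) (c : ℕ → E → ℂ) : Prop where
  holomorphic : DifferentiableOn ℂ (fun p : ℂ × E => φ p.1 p.2) (sector a b ρ ×ˢ Ω)
  coeff_holomorphic : ∀ l, DifferentiableOn ℂ (c l) Ω
  bound : ∃ M > 0, ∃ C > 0, ∀ N : ℕ, ∀ z ∈ sector a b ρ, ∀ Y ∈ Ω,
    ‖φ z Y - ∑ l ∈ Finset.range N, c l Y * Complex.exp z ^ l‖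
      ≤ M * C ^ N * Real.exp z.re ^ N * Real.Gamma (N / k + 1)

/-- The formal series `∑ c_l(Y) t^l` is `k`-Borel summable in the direction `θ` in `Ω`. -/
def IsBorelSummableInDirection {E : Type*} [NormedAddCommGroup E] [NormedSpace ℂ E]
    (k θ : ℝ) (Ω : Set E) (c : ℕ → E → ℂ) : Prop :=
  ∃ δ > Real.pi / (2 * k), ∃ ρ : ℝ → ℝ, IsRadius (θ - δ) (θ + δ) ρ ∧
    ∃ φ : ℂ → E → ℂ, HasBorelExpansion k (θ - δ) (θ + δ) ρ Ω φ c

/-- The variables `(x, U, P) ∈ ℂⁿ × ℂᵐ × ℂᵐⁿ` (every norm is the maximum norm). -/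
abbrev CauchyVar (m n : ℕ) : Type :=
  (Fin n → ℂ) × (Fin m → ℂ) × (Fin m → Fin n → ℂ)

/-- `Ω = {|x| < R₀, |U| < R₁, |P| < R₁}`. -/
def cauchyDomain (m n : ℕ) (R₀ R₁ : ℝ) : Set (CauchyVar m n) :=
  ball 0 R₀ ×ˢ (ball 0 R₁ ×ˢ ball 0 R₁)

/-- The partial derivative `∂g/∂x_j`. -/
noncomputable def xDeriv {n : ℕ} (j : Fin n) (g : (Fin n → ℂ) → ℂ) (x : Fin n → ℂ) : ℂ :=
  fderiv ℂ g x (Pi.single j 1)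

/-- The point `(x, U(x), ∇ₓU(x))`. -/
noncomputable def cauchyJet {m n : ℕ} (U : Fin m → (Fin n → ℂ) → ℂ) (x : Fin n → ℂ) :
    CauchyVar m n :=
  (x, fun i => U i x, fun i j => xDeriv j (U i) x)

/-- The derivative `∂ₜ` in the coordinate `z = log t`: `∂ₜ = t⁻¹ ∂_z`. -/
noncomputable def tDeriv (g : ℂ → ℂ) (z : ℂ) : ℂ :=
  Complex.exp (-z) * deriv g z

/-- `U` is a holomorphic solution on `S₀(I) × {|x| < r}` (with radius function `ρ`) of
`∂ₜ u_i = f_i(t, x, U, ∇ₓU)`, `u_i(0, x) = 0`. The initial value is the limit as `t → 0` along each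
ray `arg t = θ ∈ I`. -/
structure IsCauchySolution {m n : ℕ} (a b R₀ R₁ : ℝ) (f : Fin m → ℂ → CauchyVar m n → ℂ)
    (ρ : ℝ → ℝ) (r : ℝ) (U : Fin m → ℂ → (Fin n → ℂ) → ℂ) : Prop where
  holomorphic : ∀ i, DifferentiableOn ℂ (fun p : ℂ × (Fin n → ℂ) => U i p.1 p.2)
    (sector a b ρ ×ˢ ball 0 r)
  mem_domain : ∀ z ∈ sector a b ρ, ∀ x ∈ ball (0 : Fin n → ℂ) r,
    cauchyJet (fun i => U i z) x ∈ cauchyDomain m n R₀ R₁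
  equation : ∀ i, ∀ z ∈ sector a b ρ, ∀ x ∈ ball (0 : Fin n → ℂ) r,
    tDeriv (fun ζ => U i ζ x) z = f i z (cauchyJet (fun i' => U i' z) x)
  initial : ∀ i, ∀ θ ∈ Ioo a b, ∀ x ∈ ball (0 : Fin n → ℂ) r,
    Tendsto (fun s : ℝ => U i ((s : ℂ) + (θ : ℂ) * Complex.I) x) atBot (𝓝 0)

/-- `v` is a solution of the same problem along the ray `t = s e^{iθ}`, `0 < s < s₀`, for `|x| < r`:
holomorphic in `x` and only differentiable in the real variable `s`, with limit `0` as `s → 0`.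
(Solutions that are continuously differentiable on `[0, s₀)` are included.) -/
structure IsRaySolution {m n : ℕ} (R₀ R₁ : ℝ) (f : Fin m → ℂ → CauchyVar m n → ℂ)
    (θ s₀ r : ℝ) (v : Fin m → ℝ → (Fin n → ℂ) → ℂ) : Prop where
  holomorphic : ∀ i, ∀ s ∈ Ioo 0 s₀, DifferentiableOn ℂ (v i s) (ball 0 r)
  mem_domain : ∀ s ∈ Ioo 0 s₀, ∀ x ∈ ball (0 : Fin n → ℂ) r,
    cauchyJet (fun i => v i s) x ∈ cauchyDomain m n R₀ R₁
  equation : ∀ i, ∀ s ∈ Ioo 0 s₀, ∀ x ∈ ball (0 : Fin n → ℂ) r,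
    HasDerivAt (fun σ => v i σ x)
      (Complex.exp ((θ : ℂ) * Complex.I) *
        f i ((Real.log s : ℂ) + (θ : ℂ) * Complex.I) (cauchyJet (fun i' => v i' s) x)) s
  initial : ∀ i, ∀ x ∈ ball (0 : Fin n → ℂ) r, Tendsto (fun s => v i s x) (𝓝[>] 0) (𝓝 0)

/-- The coefficient of `t^N` in the formal power series `∑_l t^l F_l(x, Ũ(t, x), ∇ₓŨ(t, x))`, where
`Ũ = (ũ_1, …, ũ_m)`, `ũ_i = ∑_j c_{i,j}(x) t^j`. Terms of degree larger than `N` do not contribute to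
it, so it is the `N`-th Taylor coefficient at `t = 0` of the expression with all series truncated
after `t^N`. (Used only with `c_{i,0} = 0`.) -/
noncomputable def formalRhsCoeff {m n : ℕ} (F : ℕ → CauchyVar m n → ℂ)
    (c : Fin m → ℕ → (Fin n → ℂ) → ℂ) (N : ℕ) (x : Fin n → ℂ) : ℂ :=
  iteratedDeriv N (fun t : ℂ => ∑ l ∈ Finset.range (N + 1), t ^ l *
    F l (x, fun i => ∑ j ∈ Finset.range (N + 1), c i j x * t ^ j,
      fun i q => ∑ j ∈ Finset.range (N + 1), xDeriv q (c i j) x * t ^ j)) 0 / (N.factorial : ℂ)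

/-- `ũ_i = ∑_j c_{i,j}(x) t^j`, with `c_{i,j}` holomorphic on `|x| < r`, is a formal power series
solution of `∂ₜ u_i = ∑_l t^l F_{i,l}(x, U, ∇ₓU)`, `u_i(0, x) = 0`. -/
structure IsFormalCauchySolution {m n : ℕ} (F : Fin m → ℕ → CauchyVar m n → ℂ) (r : ℝ)
    (c : Fin m → ℕ → (Fin n → ℂ) → ℂ) : Prop where
  holomorphic : ∀ i j, DifferentiableOn ℂ (c i j) (ball 0 r)
  initial : ∀ i, ∀ x ∈ ball (0 : Fin n → ℂ) r, c i 0 x = 0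
  equation : ∀ i, ∀ N : ℕ, ∀ x ∈ ball (0 : Fin n → ℂ) r,
    ((N : ℂ) + 1) * c i (N + 1) x = formalRhsCoeff (F i) c N x

/-! No Borel or Laplace transform enters: the Gevrey bounds for `U` are proved directly, one order
`N` at a time, by comparing `U` with holomorphic solutions of truncated problems.

Fix `N ≥ 1` and replace `f` by the polynomial `∑_{l<N} F_l t^l`. The hypothesis gives `|F_l| ≤ M C^l
Γ(l/k+1)`, and log-convexity of `Γ` gives `Γ(l/k+1) ≤ G^l` for `l ≤ N`, where `G = Γ(N/k+1)^(1/N)`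
(`Gamma_factor_le_pow`). So the polynomial is bounded by `2M` on a disc of radius `τ = 1/(ΛG)`, with
`Λ` independent of `N`. The truncated problem has a holomorphic solution `h` on this disc times a
polydisc independent of `N` (`exists_disc_solution`), and its Taylor coefficients through order `N`
are those of the formal solution (`formalCoeff_eq_taylorCoeff`). Cauchy's estimate bounds the Taylor
remainder of `h` by a constant times `(2|t|/τ)^N = (2Λ|t|)^N Γ(N/k+1)`. The two right-hand sides
differ by at most `M C^N |t|^N Γ(N/k+1)`, so a comparison along rays bounds `U - h` in the same way
(`norm_sub_le_of_ray_problems`). When `|t| ≥ τ/4` the required bound is so large that crude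
estimates suffice. All this is assembled in `IsCauchySolution.exists_borel_bound`.

Existence and comparison both rest on Nagumo's device. On the cone `‖x‖ + κ|t| < r`, Cauchy's
estimate pays for an `x`-derivative with one more power of the inverse weight `1/(r - ‖x‖ - κ|t|)`
(`norm_jetPart_le_of_weight`); integrating in `|t|` recovers that power with a gain `1/κ`
(`norm_le_of_ray_deriv_bound`). For large `κ` the Picard operator therefore contracts
(`exists_solution_of_isRadialDomain`), and the difference of two solutions is controlled by the
defect of the equations (`norm_le_of_nagumo`); zero defect gives uniqueness. Existence is proved
once for abstract radial domains and applied both to sectors and to discs. -/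

/-! ### Cauchy estimates, limits and parameter integrals of holomorphic maps. -/

section SeveralVariables

variable {E G : Type*} [NormedAddCommGroup E] [NormedSpace ℂ E]
  [NormedAddCommGroup G] [NormedSpace ℂ G]

theorem norm_fderiv_le_of_norm_le_on_ball {g : E → G} {p : E} {R M : ℝ} (hR : 0 < R)
    (hd : DifferentiableOn ℂ g (ball p R)) (hM : ∀ q ∈ ball p R, ‖g q‖ ≤ M) :
    ‖fderiv ℂ g p‖ ≤ 2 * M / R := by
  refine Complex.norm_fderiv_le_div_of_mapsTo_ball hd (fun q hq => ?_) hR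
  rw [mem_closedBall, dist_eq_norm]
  have h1 := hM q hq
  have h2 := hM p (mem_ball_self hR)
  linarith [norm_sub_le (g q) (g p)]

theorem norm_sub_le_of_norm_le_on_ball {g : E → G} {c : E} {R M : ℝ} (hR : 0 < R)
    (hd : DifferentiableOn ℂ g (ball c R)) (hM : ∀ q ∈ ball c R, ‖g q‖ ≤ M) {p q : E}
    (hp : p ∈ closedBall c (R / 2)) (hq : q ∈ closedBall c (R / 2)) :
    ‖g p - g q‖ ≤ 4 * M / R * ‖p - q‖ := by
  have hsub : ∀ y ∈ closedBall c (R / 2), ball y (R / 2) ⊆ ball c R := fun y hy =>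
    ball_subset_ball' (by rw [mem_closedBall] at hy; linarith)
  refine (convex_closedBall c (R / 2)).norm_image_sub_le_of_norm_fderiv_le (𝕜 := ℂ)
    (fun y hy => ?_) (fun y hy => ?_) hq hp
  · exact hd.differentiableAt
      (isOpen_ball.mem_nhds (hsub y hy (mem_ball_self (by positivity))))
  · refine (norm_fderiv_le_of_norm_le_on_ball (half_pos hR) (hd.mono (hsub y hy))
      fun z hz => hM z (hsub y hy hz)).trans_eq ?_
    field_simp
    ring

/-- Removing the linear part leaves a map that stays within `4 * M` of its value at `p` and agrees
with that value to first order, so the Schwarz lemma of order two applies. -/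
theorem norm_sub_sub_fderiv_le {g : E → G} {p v : E} {R M : ℝ} (hR : 0 < R)
    (hd : DifferentiableOn ℂ g (ball p R)) (hM : ∀ q ∈ ball p R, ‖g q‖ ≤ M) (hv : ‖v‖ < R) :
    ‖g (p + v) - g p - fderiv ℂ g p v‖ ≤ 4 * M * (‖v‖ / R) ^ 2 := by
  have hg : DifferentiableAt ℂ g p := hd.differentiableAt (ball_mem_nhds p hR)
  set h : E → G := fun q => g q - fderiv ℂ g p (q - p) with hh
  have hM0 : 0 ≤ M := (norm_nonneg _).trans (hM p (mem_ball_self hR))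
  have hhp : h p = g p := by simp [hh]
  have hd' : DifferentiableOn ℂ h (ball p R) := by
    refine hd.sub (Differentiable.differentiableOn ?_)
    fun_prop
  have hmaps : MapsTo h (ball p R) (closedBall (h p) (4 * M)) := by
    intro q hq
    rw [mem_closedBall, dist_eq_norm, hhp]
    have h1 := hM q hq
    have h2 := hM p (mem_ball_self hR)
    have h3 : ‖fderiv ℂ g p (q - p)‖ ≤ 2 * M / R * R := by
      refine (ContinuousLinearMap.le_opNorm _ _).trans ?_
      refine mul_le_mul (norm_fderiv_le_of_norm_le_on_ball hR hd hM) ?_ (norm_nonneg _)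
        (by positivity)
      rw [mem_ball, dist_eq_norm] at hq
      exact hq.le
    have h4 : 2 * M / R * R = 2 * M := by field_simp
    have h5 := norm_sub_le (g q - fderiv ℂ g p (q - p)) (g p)
    have h6 := norm_sub_le (g q) (fderiv ℂ g p (q - p))
    simp only [hh]
    linarith
  have ho : (fun w => h w - h p) =o[𝓝 p] fun w => ‖w - p‖ ^ 1 := by
    have := hg.hasFDerivAt.isLittleO
    simp only [pow_one]
    refine (this.norm_right).congr_left fun w => ?_
    rw [hhp]
    simp only [hh]
    abel
  have := Complex.dist_le_mul_div_pow_of_mapsTo_ball_of_isLittleO (z := p + v) hd' hmaps ho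
    (by simpa [mem_ball, dist_eq_norm] using hv)
  rw [dist_eq_norm, dist_eq_norm, hhp] at this
  simp only [hh, add_sub_cancel_left] at this
  rwa [sub_right_comm] at this

/-- Weierstrass' theorem: by Cauchy's estimate the derivatives are uniformly Cauchy on a smaller
ball. -/
theorem differentiableOn_of_norm_sub_le [CompleteSpace G] {D : Set E} (hD : IsOpen D)
    {u : ℕ → E → G} {g : E → G} {ε : ℕ → ℝ} (hu : ∀ k, DifferentiableOn ℂ (u k) D)
    (hε : Tendsto ε atTop (𝓝 0)) (h : ∀ k, ∀ p ∈ D, ‖u k p - g p‖ ≤ ε k) :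
    DifferentiableOn ℂ g D := by
  intro q hq
  obtain ⟨R', hR', hball⟩ := Metric.isOpen_iff.1 hD q hq
  set R := R' / 2 with hRdef
  have hR : 0 < R := by positivity
  have hsub : ∀ p ∈ ball q R, ball p R ⊆ D := fun p hp =>
    (ball_subset_ball' (by rw [mem_ball] at hp; rw [hRdef] at *; linarith)).trans hball
  have hsub' : ball q R ⊆ D := (ball_subset_ball (by rw [hRdef]; linarith)).trans hball
  have hderiv : ∀ k l, ∀ p ∈ ball q R,
      ‖fderiv ℂ (u k) p - fderiv ℂ (u l) p‖ ≤ 2 * (ε k + ε l) / R := by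
    intro k l p hp
    have hpD : D ∈ 𝓝 p := hD.mem_nhds (hsub' hp)
    rw [← fderiv_sub ((hu k).differentiableAt hpD) ((hu l).differentiableAt hpD)]
    refine norm_fderiv_le_of_norm_le_on_ball hR
      (((hu k).sub (hu l)).mono (hsub p hp)) fun y hy => ?_
    have h1 := h k y (hsub p hp hy)
    have h2 := h l y (hsub p hp hy)
    have h3 : u k y - u l y = (u k y - g y) - (u l y - g y) := by abel
    change ‖u k y - u l y‖ ≤ _
    rw [h3]
    exact (norm_sub_le _ _).trans (add_le_add h1 h2)
  have hC : UniformCauchySeqOn (fun k => fderiv ℂ (u k)) atTop (ball q R) := by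
    rw [Metric.uniformCauchySeqOn_iff]
    intro η hη
    have ht : Tendsto (fun k : ℕ × ℕ => 2 * (ε k.1 + ε k.2) / R) (atTop ×ˢ atTop) (𝓝 0) := by
      have := ((hε.comp tendsto_fst).add (hε.comp tendsto_snd) :
        Tendsto (fun k : ℕ × ℕ => ε k.1 + ε k.2) (atTop ×ˢ atTop) (𝓝 (0 + 0)))
      have h2 := (this.const_mul 2).div_const R
      simpa using h2
    rw [prod_atTop_atTop_eq] at ht
    obtain ⟨N, hN⟩ := eventually_atTop.1 (ht.eventually (gt_mem_nhds hη))
    refine ⟨max N.1 N.2, fun k hk l hl p hp => ?_⟩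
    rw [dist_eq_norm]
    exact (hderiv k l p hp).trans_lt (hN (k, l)
      ⟨(le_max_left _ _).trans hk, (le_max_right _ _).trans hl⟩)
  have hlim : ∀ p ∈ ball q R, ∃ y, Tendsto (fun k => fderiv ℂ (u k) p) atTop (𝓝 y) :=
    fun p hp => cauchySeq_tendsto_of_complete (hC.cauchySeq hp)
  choose! g' hg' using hlim
  have hunif := hC.tendstoUniformlyOn_of_tendsto hg'
  refine (hasFDerivAt_of_tendstoLocallyUniformlyOn (isOpen_ball (x := q) (ε := R))
    hunif.tendstoLocallyUniformlyOn (fun k y hy => ((hu k).differentiableAt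
      (hD.mem_nhds (hsub' hy))).hasFDerivAt) (fun y hy => ?_)
      (mem_ball_self hR)).differentiableAt.differentiableWithinAt
  rw [tendsto_iff_norm_sub_tendsto_zero]
  exact squeeze_zero (fun _ => norm_nonneg _) (fun k => h k y (hsub' hy)) hε

/-- The difference quotients in the direction `v` are holomorphic, and by the quadratic remainder
bound they converge uniformly near each point at a rate proportional to the step. -/
theorem DifferentiableOn.fderiv_apply_const [CompleteSpace G] {D : Set E} (hD : IsOpen D)
    {g : E → G} (hg : DifferentiableOn ℂ g D) (v : E) :
    DifferentiableOn ℂ (fun p => fderiv ℂ g p v) D := by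
  intro q hq
  obtain ⟨M, hM⟩ : ∃ M, ∀ᶠ p in 𝓝 q, ‖g p‖ ≤ M := by
    have hc : ContinuousAt g q := hg.continuousOn.continuousAt (hD.mem_nhds hq)
    exact ⟨‖g q‖ + 1, (hc.norm.eventually (gt_mem_nhds (lt_add_one _))).mono fun _ h => h.le⟩
  obtain ⟨R', hR', hball⟩ := Metric.mem_nhds_iff.1 (hM.and (hD.mem_nhds hq))
  set R := R' / 2 with hRdef
  have hR : 0 < R := by positivity
  have hsub : ∀ p ∈ ball q R, ball p R ⊆ ball q R' := fun p hp =>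
    ball_subset_ball' (by rw [mem_ball] at hp; rw [hRdef] at *; linarith)
  set δ := R / (‖v‖ + 1) with hδdef
  have hv1 : 0 < ‖v‖ + 1 := by positivity
  have hδ : 0 < δ := by positivity
  have hk : ∀ k : ℕ, (0 : ℝ) < k + 1 := fun k => by positivity
  have hlt : ∀ k : ℕ, ‖((δ / (k + 1) : ℝ) : ℂ) • v‖ < R := by
    intro k
    rw [norm_smul, Complex.norm_real, Real.norm_of_nonneg (by positivity)]
    calc δ / (k + 1) * ‖v‖ ≤ δ * ‖v‖ := by
          gcongr
          exact div_le_self hδ.le (by linarith [Nat.cast_nonneg (α := ℝ) k])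
      _ < δ * (‖v‖ + 1) := by gcongr; linarith
      _ = R := by rw [hδdef]; field_simp
  have hmem : ∀ k : ℕ, ∀ p ∈ ball q R, p + ((δ / (k + 1) : ℝ) : ℂ) • v ∈ ball q R' :=
    fun k p hp => hsub p hp (by simpa [mem_ball, dist_eq_norm] using hlt k)
  refine (differentiableOn_of_norm_sub_le (isOpen_ball (x := q) (ε := R))
    (u := fun (k : ℕ) p => (((δ / (k + 1) : ℝ) : ℂ))⁻¹ •
      (g (p + ((δ / (k + 1) : ℝ) : ℂ) • v) - g p))
    (ε := fun k => 4 * M * (‖v‖ / R) ^ 2 * (δ / (k + 1))) (fun k => ?_) ?_ fun k p hp => ?_)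
      |>.differentiableAt (ball_mem_nhds q hR) |>.differentiableWithinAt
  · refine DifferentiableOn.const_smul (DifferentiableOn.sub ?_ ?_) _
    · refine DifferentiableOn.comp (t := ball q R') (hg.mono fun y hy => (hball hy).2) ?_ (hmem k)
      fun_prop
    · exact hg.mono fun y hy => (hball (ball_subset_ball (by rw [hRdef]; linarith) hy)).2
  · have := (tendsto_one_div_add_atTop_nhds_zero_nat (𝕜 := ℝ)).const_mul
      (4 * M * (‖v‖ / R) ^ 2 * δ)
    rw [mul_zero] at this
    refine this.congr fun k => ?_
    ring
  · set s : ℝ := δ / (k + 1) with hs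
    have hs0 : 0 < s := by positivity
    have hsc : (s : ℂ) ≠ 0 := by exact_mod_cast hs0.ne'
    have key := norm_sub_sub_fderiv_le (v := (s : ℂ) • v) hR
      (hg.mono fun y hy => (hball (hsub p hp hy)).2) (fun y hy => (hball (hsub p hp hy)).1)
      (hlt k)
    have heq : (s : ℂ)⁻¹ • (g (p + (s : ℂ) • v) - g p) - fderiv ℂ g p v =
        (s : ℂ)⁻¹ • (g (p + (s : ℂ) • v) - g p - fderiv ℂ g p ((s : ℂ) • v)) := by
      rw [map_smul, smul_sub (s : ℂ)⁻¹ _ ((s : ℂ) • _), smul_smul, inv_mul_cancel₀ hsc, one_smul]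
    change ‖(s : ℂ)⁻¹ • (g (p + (s : ℂ) • v) - g p) - fderiv ℂ g p v‖ ≤ _
    rw [heq, norm_smul, norm_inv, Complex.norm_real, Real.norm_of_nonneg hs0.le,
      inv_mul_le_iff₀ hs0]
    refine key.trans_eq ?_
    rw [norm_smul, Complex.norm_real, Real.norm_of_nonneg hs0.le]
    ring

/-- The derivative of `g(t, y)` with respect to the first variable. -/
theorem differentiableOn_deriv_fst [CompleteSpace G] {D : Set (ℂ × E)} (hD : IsOpen D)
    {g : ℂ × E → G} (hg : DifferentiableOn ℂ g D) :
    DifferentiableOn ℂ (fun p : ℂ × E => deriv (fun t => g (t, p.2)) p.1) D := by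
  refine (DifferentiableOn.fderiv_apply_const hD hg (1, 0)).congr fun p hp => ?_
  have h1 : HasFDerivAt g (fderiv ℂ g p) (p.1, p.2) :=
    (hg.differentiableAt (hD.mem_nhds hp)).hasFDerivAt
  have h2 : HasDerivAt (fun t : ℂ => (t, p.2)) ((1 : ℂ), (0 : E)) p.1 :=
    (hasDerivAt_id p.1).prodMk (hasDerivAt_const p.1 p.2)
  exact (h1.comp_hasDerivAt p.1 h2).deriv

theorem differentiableOn_iteratedDeriv_fst [CompleteSpace G] {D : Set (ℂ × E)} (hD : IsOpen D)
    {g : ℂ × E → G} (hg : DifferentiableOn ℂ g D) (l : ℕ) :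
    DifferentiableOn ℂ (fun p : ℂ × E => iteratedDeriv l (fun t => g (t, p.2)) p.1) D := by
  induction l with
  | zero => simpa using hg
  | succ l ih =>
    simp only [iteratedDeriv_succ]
    exact differentiableOn_deriv_fst hD ih

/-- Cauchy's estimate provides the constant that dominates the derivative under the integral sign.
The endpoint `0` is left out because the integrands below live on `s > 0` only. -/
theorem differentiableOn_integral_of_norm_le [FiniteDimensional ℂ E] {D : Set E} (hD : IsOpen D)
    {g : ℝ → E → ℂ} {M : ℝ} (hd : ∀ s ∈ Ioc (0 : ℝ) 1, DifferentiableOn ℂ (g s) D)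
    (hM : ∀ s ∈ Ioc (0 : ℝ) 1, ∀ p ∈ D, ‖g s p‖ ≤ M)
    (hc : ∀ p ∈ D, ContinuousOn (fun s => g s p) (Ioc 0 1)) :
    DifferentiableOn ℂ (fun p => ∫ s in (0 : ℝ)..1, g s p) D := by
  intro q hq
  obtain ⟨R', hR', hball⟩ := Metric.isOpen_iff.1 hD q hq
  set R := R' / 2 with hRdef
  have hR : 0 < R := by positivity
  have hsub : ∀ p ∈ ball q R, ball p R ⊆ D := fun p hp =>
    (ball_subset_ball' (by rw [mem_ball] at hp; rw [hRdef] at *; linarith)).trans hball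
  have hsub' : ball q R ⊆ D := (ball_subset_ball (by rw [hRdef]; linarith)).trans hball
  simp only [intervalIntegral.integral_of_le zero_le_one]
  have hae : ∀ᵐ s ∂(MeasureTheory.volume.restrict (Ioc (0 : ℝ) 1)), s ∈ Ioc (0 : ℝ) 1 :=
    MeasureTheory.ae_restrict_mem measurableSet_Ioc
  have hmeas : ∀ p ∈ D, MeasureTheory.AEStronglyMeasurable (fun s => g s p)
      (MeasureTheory.volume.restrict (Ioc (0 : ℝ) 1)) := fun p hp =>
    (hc p hp).aestronglyMeasurable measurableSet_Ioc
  -- Directional derivatives are limits of measurable difference quotients; the shift by `K` keeps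
  -- all their base points inside the ball. A finite basis then yields measurability of the full
  -- derivative.
  have hmeas' : ∀ v : E, MeasureTheory.AEStronglyMeasurable (fun s => fderiv ℂ (g s) q v)
      (MeasureTheory.volume.restrict (Ioc (0 : ℝ) 1)) := by
    intro v
    obtain ⟨K, hK⟩ : ∃ K : ℕ, ‖v‖ < R * (K + 1) := by
      obtain ⟨K, hK⟩ := exists_nat_gt (‖v‖ / R)
      refine ⟨K, ?_⟩
      rw [div_lt_iff₀ hR] at hK
      nlinarith
    have hmem : ∀ k : ℕ, q + (((k + K + 1 : ℕ) : ℂ))⁻¹ • v ∈ ball q R := by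
      intro k
      rw [mem_ball, dist_eq_norm, add_sub_cancel_left, norm_smul, norm_inv, Complex.norm_natCast,
        inv_mul_lt_iff₀ (by positivity)]
      push_cast
      nlinarith [Nat.cast_nonneg (α := ℝ) k]
    refine aestronglyMeasurable_of_tendsto_ae atTop
      (f := fun (k : ℕ) s => ((k + K + 1 : ℕ) : ℂ) • (g s (q + (((k + K + 1 : ℕ) : ℂ))⁻¹ • v) - g s q))
      (fun k => ?_) ?_
    · exact ((hmeas _ (hsub' (hmem k))).sub (hmeas q hq)).const_smul (((k + K + 1 : ℕ) : ℂ))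
    · filter_upwards [hae] with s hs
      have h1 := ((hd s hs).differentiableAt (hD.mem_nhds hq)).hasFDerivAt
      refine h1.lim v (c := fun k : ℕ => ((k + K + 1 : ℕ) : ℂ)) (l := atTop) ?_
      simp only [Complex.norm_natCast]
      exact tendsto_natCast_atTop_atTop.comp (tendsto_add_atTop_nat (K + 1))
  have hmeasF : MeasureTheory.AEStronglyMeasurable (fun s => fderiv ℂ (g s) q)
      (MeasureTheory.volume.restrict (Ioc (0 : ℝ) 1)) := by
    let b := Module.finBasis ℂ E
    have heq : (fun s => fderiv ℂ (g s) q) = fun s => ∑ i, fderiv ℂ (g s) q (b i) •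
        LinearMap.toContinuousLinearMap (b.coord i) := by
      funext s
      ext v
      calc fderiv ℂ (g s) q v = fderiv ℂ (g s) q (∑ i, b.repr v i • b i) := by rw [b.sum_repr]
        _ = _ := by rw [map_sum]; simp [mul_comm]
    rw [heq]
    refine Finset.aestronglyMeasurable_fun_sum _ fun i _ => ?_
    exact (hmeas' (b i)).smul_const _
  refine (hasFDerivAt_integral_of_dominated_of_fderiv_le (𝕜 := ℂ) (s := ball q R)
    (bound := fun _ => 2 * M / R) (F' := fun p s => fderiv ℂ (g s) p) (ball_mem_nhds q hR)
    ?_ ?_ hmeasF ?_ ?_ ?_).differentiableAt.differentiableWithinAt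
  · filter_upwards [hD.mem_nhds hq] with p hp using hmeas p hp
  · refine ⟨hmeas q hq, MeasureTheory.HasFiniteIntegral.of_bounded (C := M) ?_⟩
    filter_upwards [hae] with s hs using hM s hs q hq
  · filter_upwards [hae] with s hs p hp
    exact norm_fderiv_le_of_norm_le_on_ball hR ((hd s hs).mono (hsub p hp))
      fun y hy => hM s hs y (hsub p hp hy)
  · exact MeasureTheory.integrable_const _
  · filter_upwards [hae] with s hs p hp
    exact ((hd s hs).differentiableAt (hD.mem_nhds (hsub' hp))).hasFDerivAt

end SeveralVariables

/-! ### Bounds for jets. -/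

section Jets

variable {m n : ℕ}

/-- The components `(U(x), ∇ₓU(x))` of the jet. -/
noncomputable def jetPart (g : Fin m → (Fin n → ℂ) → ℂ) (x : Fin n → ℂ) :
    (Fin m → ℂ) × (Fin m → Fin n → ℂ) :=
  (fun i => g i x, fun i j => xDeriv j (g i) x)

theorem cauchyJet_eq (g : Fin m → (Fin n → ℂ) → ℂ) (x : Fin n → ℂ) :
    cauchyJet g x = (x, jetPart g x) := rfl

theorem norm_xDeriv_le {g : (Fin n → ℂ) → ℂ} {x : Fin n → ℂ} {δ K : ℝ} (hδ : 0 < δ)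
    (hd : DifferentiableOn ℂ g (ball x δ)) (hK : ∀ y ∈ ball x δ, ‖g y‖ ≤ K) (j : Fin n) :
    ‖xDeriv j g x‖ ≤ 2 * K / δ := by
  refine (ContinuousLinearMap.le_opNorm _ _).trans ?_
  have h1 : ‖(Pi.single j (1 : ℂ) : Fin n → ℂ)‖ ≤ 1 := by
    refine (pi_norm_le_iff_of_nonneg zero_le_one).2 fun i => ?_
    by_cases h : i = j
    · subst h; simp
    · simp [h]
  have h2 := norm_fderiv_le_of_norm_le_on_ball hδ hd hK
  calc _ ≤ ‖fderiv ℂ g x‖ * 1 := by gcongr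
    _ ≤ _ := by rwa [mul_one]

theorem norm_jetPart_le {g : Fin m → (Fin n → ℂ) → ℂ} {x : Fin n → ℂ} {δ K : ℝ} (hδ : 0 < δ)
    (hK0 : 0 ≤ K) (hd : ∀ i, DifferentiableOn ℂ (g i) (ball x δ))
    (hK : ∀ i, ∀ y ∈ ball x δ, ‖g i y‖ ≤ K) :
    ‖jetPart g x‖ ≤ K * (1 + 2 / δ) := by
  have h2 : 0 ≤ K * (2 / δ) := by positivity
  rw [mul_add, mul_one]
  refine max_le ?_ ?_
  · refine (pi_norm_le_iff_of_nonneg (by positivity)).2 fun i => ?_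
    have := hK i x (mem_ball_self hδ)
    change ‖g i x‖ ≤ _
    linarith
  · refine (pi_norm_le_iff_of_nonneg (by positivity)).2 fun i =>
      (pi_norm_le_iff_of_nonneg (by positivity)).2 fun j => ?_
    have := norm_xDeriv_le hδ (hd i) (hK i) j
    change ‖xDeriv j (g i) x‖ ≤ _
    have h3 : 2 * K / δ = K * (2 / δ) := by ring
    linarith

theorem xDeriv_sub {g h : (Fin n → ℂ) → ℂ} {x : Fin n → ℂ}
    (hg : DifferentiableAt ℂ g x) (hh : DifferentiableAt ℂ h x) (j : Fin n) :
    xDeriv j (fun y => g y - h y) x = xDeriv j g x - xDeriv j h x := by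
  unfold xDeriv
  rw [fderiv_fun_sub hg hh]
  rfl

theorem jetPart_sub {g h : Fin m → (Fin n → ℂ) → ℂ} {x : Fin n → ℂ}
    (hg : ∀ i, DifferentiableAt ℂ (g i) x) (hh : ∀ i, DifferentiableAt ℂ (h i) x) :
    jetPart (fun i y => g i y - h i y) x = jetPart g x - jetPart h x := by
  refine Prod.ext rfl ?_
  funext i j
  exact xDeriv_sub (hg i) (hh i) j

/-- A function on the ball of radius `ϱ` whose growth is at most that of `(ϱ - ‖x‖)⁻¹`. -/
theorem norm_jetPart_le_of_weight {g : Fin m → (Fin n → ℂ) → ℂ} {x : Fin n → ℂ} {ϱ r K : ℝ}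
    (hϱ : ϱ ≤ r) (hx : ‖x‖ < ϱ) (hK0 : 0 ≤ K) (hd : ∀ i, DifferentiableOn ℂ (g i) (ball 0 ϱ))
    (hK : ∀ i, ∀ y ∈ ball (0 : Fin n → ℂ) ϱ, ‖g i y‖ ≤ K / (ϱ - ‖y‖)) :
    ‖jetPart g x‖ ≤ K * (2 * r + 8) / (ϱ - ‖x‖) ^ 2 := by
  set e := ϱ - ‖x‖ with he
  have he0 : 0 < e := by linarith
  have hy : ∀ y ∈ ball x (e / 2), ‖y‖ < ϱ ∧ e / 2 ≤ ϱ - ‖y‖ := by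
    intro y hy
    rw [mem_ball, dist_eq_norm] at hy
    have : ‖y‖ ≤ ‖y - x‖ + ‖x‖ := by simpa using norm_add_le (y - x) x
    constructor <;> linarith
  -- Cauchy's estimate on the ball whose radius is half the distance `e` to the boundary: there the
  -- weight has changed by a factor of at most two.
  have h1 : ‖jetPart g x‖ ≤ K / (e / 2) * (1 + 2 / (e / 2)) := by
    refine norm_jetPart_le (by positivity) (by positivity)
      (fun i => (hd i).mono fun y h => by simpa using (hy y h).1) fun i y h => ?_
    refine (hK i y (by simpa using (hy y h).1)).trans ?_
    gcongr
    exact (hy y h).2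
  refine h1.trans ?_
  have h2 : K / (e / 2) * (1 + 2 / (e / 2)) = K * (2 * e + 8) / e ^ 2 := by
    field_simp
    ring
  rw [h2]
  have : e ≤ r := by linarith [norm_nonneg x]
  gcongr

theorem mem_cauchyDomain_iff {R₀ R₁ : ℝ} {x : Fin n → ℂ} {y : (Fin m → ℂ) × (Fin m → Fin n → ℂ)} :
    ((x, y) : CauchyVar m n) ∈ cauchyDomain m n R₀ R₁ ↔ ‖x‖ < R₀ ∧ ‖y‖ < R₁ := by
  rw [cauchyDomain, mem_prod, ball_prod_same]
  exact Iff.and mem_ball_zero_iff mem_ball_zero_iff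

theorem isOpen_cauchyDomain {R₀ R₁ : ℝ} : IsOpen (cauchyDomain m n R₀ R₁) :=
  isOpen_ball.prod (isOpen_ball.prod isOpen_ball)

/-- Boundedness alone yields a Lipschitz constant, by Cauchy's estimate, provided that some room to
the boundary remains. This is why jets are kept below `R₁ / 2` from here on. -/
theorem norm_sub_le_of_cauchyDomain {R₀ R₁ M : ℝ} (hR₁ : 0 < R₁) {f : CauchyVar m n → ℂ}
    (hf : DifferentiableOn ℂ f (cauchyDomain m n R₀ R₁))
    (hM : ∀ Y ∈ cauchyDomain m n R₀ R₁, ‖f Y‖ ≤ M) {x : Fin n → ℂ} (hx : ‖x‖ < R₀)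
    {y y' : (Fin m → ℂ) × (Fin m → Fin n → ℂ)} (hy : ‖y‖ ≤ R₁ / 2) (hy' : ‖y'‖ ≤ R₁ / 2) :
    ‖f (x, y) - f (x, y')‖ ≤ 4 * M / R₁ * ‖y - y'‖ := by
  have hmaps : ∀ y : (Fin m → ℂ) × (Fin m → Fin n → ℂ), y ∈ ball 0 R₁ →
      ((x, y) : CauchyVar m n) ∈ cauchyDomain m n R₀ R₁ := fun y hy =>
    mem_cauchyDomain_iff.2 ⟨hx, by simpa using hy⟩
  refine norm_sub_le_of_norm_le_on_ball (g := fun y => f (x, y)) (c := 0) hR₁ ?_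
    (fun q hq => hM _ (hmaps q hq)) (by simpa using hy) (by simpa using hy')
  refine hf.comp (Differentiable.differentiableOn ?_) hmaps
  exact (differentiable_const x).prodMk differentiable_id

end Jets

/-! ### Nagumo's comparison along rays. -/

section Rays

/-- The function `a / (d - c * σ) + b * σ` has the assumed bound as its derivative, so it majorizes
`v`. The comparison starts at some `σ₀ > 0`, since `v` is only known to tend to `0`, and then `σ₀ →
0`. -/
theorem norm_le_of_ray_deriv_bound {v v' : ℝ → ℂ} {s a b c d : ℝ} (hs : 0 < s) (ha : 0 ≤ a)
    (hb : 0 ≤ b) (hc : 0 ≤ c) (hd : c * s < d) (hcont : ContinuousOn v (Ioc 0 s))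
    (hder : ∀ σ ∈ Ioo 0 s, HasDerivAt v (v' σ) σ)
    (hv' : ∀ σ ∈ Ioo 0 s, ‖v' σ‖ ≤ a * c / (d - c * σ) ^ 2 + b)
    (h0 : Tendsto v (𝓝[>] 0) (𝓝 0)) : ‖v s‖ ≤ a / (d - c * s) + b * s := by
  set B : ℝ → ℝ := fun σ => a / (d - c * σ) + b * σ with hB
  have hpos : ∀ σ ≤ s, 0 < d - c * σ := fun σ hσ => by
    have := mul_le_mul_of_nonneg_left hσ hc
    linarith
  have hBder : ∀ σ ≤ s, HasDerivAt B (a * c / (d - c * σ) ^ 2 + b) σ := by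
    intro σ hσ
    have h1 : HasDerivAt (fun σ : ℝ => d - c * σ) (-c) σ := by
      simpa using ((hasDerivAt_id σ).const_mul c).const_sub d
    have h2 := (h1.inv (hpos σ hσ).ne').const_mul a
    have h3 := h2.add ((hasDerivAt_id σ).const_mul b)
    refine (h3.congr_deriv ?_)
    rw [neg_neg, mul_one, mul_div_assoc]
  have key : ∀ σ₀ ∈ Ioo 0 s, ‖v s‖ ≤ ‖v σ₀‖ + B s := by
    intro σ₀ hσ₀
    have := image_norm_le_of_norm_deriv_right_le_deriv_boundary' (f := v) (f' := v') (a := σ₀)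
      (b := s) (B := fun σ => B σ + ‖v σ₀‖)
      (B' := fun σ => a * c / (d - c * σ) ^ 2 + b)
      (hcont.mono fun σ hσ => ⟨hσ₀.1.trans_le hσ.1, hσ.2⟩)
      (fun σ hσ => (hder σ ⟨hσ₀.1.trans_le hσ.1, hσ.2⟩).hasDerivWithinAt) ?_
      (fun σ hσ => ((hBder σ hσ.2).continuousAt.add continuousAt_const).continuousWithinAt)
      (fun σ hσ => ((hBder σ hσ.2.le).add_const _).hasDerivWithinAt)
      (fun σ hσ => hv' σ ⟨hσ₀.1.trans_le hσ.1, hσ.2⟩) ⟨hσ₀.2.le, le_rfl⟩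
    · linarith
    · have h1 : 0 ≤ a / (d - c * σ₀) := div_nonneg ha (hpos σ₀ hσ₀.2.le).le
      have h2 : 0 ≤ b * σ₀ := mul_nonneg hb hσ₀.1.le
      simp only [hB]
      linarith
  have hlim : Tendsto (fun σ₀ => ‖v σ₀‖ + B s) (𝓝[>] 0) (𝓝 (0 + B s)) := by
    simpa using h0.norm.add_const (B s)
  rw [zero_add] at hlim
  refine ge_of_tendsto hlim ?_
  filter_upwards [Ioo_mem_nhdsGT hs] with σ₀ hσ₀ using key σ₀ hσ₀

variable {m n : ℕ}

/-- Nagumo's comparison estimate for the Cauchy problem along a ray. -/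
theorem norm_le_of_nagumo {r s₀ L A K : ℝ} {N : ℕ} (hr : 0 < r) (hL : 0 < L) (hA : 0 ≤ A)
    {w w' : Fin m → ℝ → (Fin n → ℂ) → ℂ}
    (hd : ∀ i, ∀ s ∈ Ioo 0 s₀, DifferentiableOn ℂ (w i s) (ball 0 r))
    (hK : ∀ i, ∀ s ∈ Ioo 0 s₀, ∀ x ∈ ball (0 : Fin n → ℂ) r, ‖w i s x‖ ≤ K)
    (hder : ∀ i, ∀ s ∈ Ioo 0 s₀, ∀ x ∈ ball (0 : Fin n → ℂ) r,
      HasDerivAt (fun σ => w i σ x) (w' i s x) s)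
    (hw' : ∀ i, ∀ s ∈ Ioo 0 s₀, ∀ x ∈ ball (0 : Fin n → ℂ) r,
      ‖w' i s x‖ ≤ L * ‖jetPart (fun i' => w i' s) x‖ + A * s ^ N)
    (h0 : ∀ i, ∀ x ∈ ball (0 : Fin n → ℂ) r, Tendsto (fun s => w i s x) (𝓝[>] 0) (𝓝 0))
    (i : Fin m) {s : ℝ} (hs : s ∈ Ioo 0 s₀) {x : Fin n → ℂ}
    (hx : ‖x‖ + 2 * L * (2 * r + 8) * s < r) :
    ‖w i s x‖ ≤ 2 * A * r * s ^ (N + 1) / (r - ‖x‖ - 2 * L * (2 * r + 8) * s) := by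
  -- `2 * r + 8` is the price of passing to jets and `L` the Lipschitz constant; the extra factor
  -- `2` makes the integral inequality halve the constant `γ` below.
  set κ := 2 * L * (2 * r + 8) with hκ
  have hκ0 : 0 < κ := by positivity
  have hK0 : 0 ≤ K := by
    have hx0 : x ∈ ball (0 : Fin n → ℂ) r := by
      have := mul_pos hκ0 hs.1
      rw [mem_ball_zero_iff]; linarith
    exact (norm_nonneg _).trans (hK i s hs x hx0)
  -- One pass of the integral inequality sends `γ` to `A * r + γ / 2`, whose fixed point is `2 * A *
  -- r`. The shift by `ε` is needed to start: the a priori bound `K` does not decay like `s ^ (N +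
  -- 1)`. It is removed at the very end.
  have step : ∀ ε > 0, ∀ γ ≥ 0, (∀ i, ∀ s ∈ Ioo 0 s₀, ∀ x : Fin n → ℂ, ‖x‖ + κ * s < r →
        ‖w i s x‖ ≤ γ * (s + ε) ^ (N + 1) / (r - ‖x‖ - κ * s)) →
      ∀ i, ∀ s ∈ Ioo 0 s₀, ∀ x : Fin n → ℂ, ‖x‖ + κ * s < r →
        ‖w i s x‖ ≤ (A * r + γ / 2) * (s + ε) ^ (N + 1) / (r - ‖x‖ - κ * s) := by
    intro ε hε γ hγ hP i s hs x hx
    have hs0 := hs.1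
    set E := (s + ε) ^ (N + 1) with hE
    have hE0 : 0 < E := by positivity
    have hsub : ∀ σ ∈ Ioc 0 s, σ ∈ Ioo 0 s₀ := fun σ hσ => ⟨hσ.1, hσ.2.trans_lt hs.2⟩
    have hκs : ∀ σ ∈ Ioc 0 s, κ * σ ≤ κ * s := fun σ hσ =>
      mul_le_mul_of_nonneg_left hσ.2 hκ0.le
    have hxr : x ∈ ball (0 : Fin n → ℂ) r := by
      have := mul_pos hκ0 hs.1
      rw [mem_ball_zero_iff]; linarith
    have hdpos : 0 < r - ‖x‖ - κ * s := by linarith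
    have := norm_le_of_ray_deriv_bound (v := fun σ => w i σ x) (v' := fun σ => w' i σ x)
      (a := γ * E / 2) (b := A * s ^ N) (c := κ) (d := r - ‖x‖) hs0 (by positivity)
      (by positivity) hκ0.le (by linarith)
      (fun σ hσ => (hder i σ (hsub σ hσ) x hxr).continuousAt.continuousWithinAt)
      (fun σ hσ => hder i σ (hsub σ ⟨hσ.1, hσ.2.le⟩) x hxr) (fun σ hσ => ?_) (h0 i x hxr)
    · refine this.trans ?_
      have h1 : A * s ^ N * s ≤ A * r * E / (r - ‖x‖ - κ * s) := by
        rw [le_div_iff₀ hdpos]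
        have h2 : s ^ (N + 1) ≤ E := pow_le_pow_left₀ hs0.le (by linarith) _
        have h3 : r - ‖x‖ - κ * s ≤ r := by
          have := mul_pos hκ0 hs0
          linarith [norm_nonneg x]
        calc A * s ^ N * s * (r - ‖x‖ - κ * s) = A * s ^ (N + 1) * (r - ‖x‖ - κ * s) := by ring
          _ ≤ A * E * r := by gcongr
          _ = A * r * E := by ring
      have h4 : (A * r + γ / 2) * E / (r - ‖x‖ - κ * s) =
          γ * E / 2 / (r - ‖x‖ - κ * s) + A * r * E / (r - ‖x‖ - κ * s) := by ring
      rw [h4]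
      linarith
    · have hσ' : σ ∈ Ioc 0 s := ⟨hσ.1, hσ.2.le⟩
      have hσ0 := hσ.1
      have hκσ := hκs σ hσ'
      have hϱ : r - κ * σ ≤ r := by linarith [mul_pos hκ0 hσ0]
      have hjet : ‖jetPart (fun i' => w i' σ) x‖ ≤
          γ * E * (2 * r + 8) / (r - κ * σ - ‖x‖) ^ 2 := by
        refine norm_jetPart_le_of_weight hϱ (by linarith) (by positivity)
          (fun i' => (hd i' σ (hsub σ hσ')).mono (ball_subset_ball hϱ)) fun i' y hy => ?_
        rw [mem_ball_zero_iff] at hy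
        refine (hP i' σ (hsub σ hσ') y (by linarith)).trans ?_
        rw [sub_right_comm]
        have hpos : 0 < r - κ * σ - ‖y‖ := by linarith
        have : (σ + ε) ^ (N + 1) ≤ E :=
          pow_le_pow_left₀ (by positivity) (by linarith [hσ.2]) _
        gcongr
      refine (hw' i σ (hsub σ hσ') x hxr).trans (add_le_add ?_ ?_)
      · refine (mul_le_mul_of_nonneg_left hjet hL.le).trans_eq ?_
        rw [hκ, sub_right_comm]
        ring
      · have : σ ^ N ≤ s ^ N := pow_le_pow_left₀ hσ0.le hσ.2.le _
        gcongr
  have iter : ∀ ε > 0, ∀ q : ℕ, ∀ i, ∀ s ∈ Ioo 0 s₀, ∀ x : Fin n → ℂ, ‖x‖ + κ * s < r →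
      ‖w i s x‖ ≤ (2 * A * r + K * r / ε ^ (N + 1) / 2 ^ q) * (s + ε) ^ (N + 1) /
        (r - ‖x‖ - κ * s) := by
    intro ε hε q
    induction q with
    | zero =>
      intro i s hs x hx
      have hs0 := hs.1
      have hκs := mul_pos hκ0 hs0
      have hdpos : 0 < r - ‖x‖ - κ * s := by linarith
      have h1 := hK i s hs x (by rw [mem_ball_zero_iff]; linarith)
      rw [le_div_iff₀ hdpos]
      have h2 : ε ^ (N + 1) ≤ (s + ε) ^ (N + 1) :=
        pow_le_pow_left₀ hε.le (by linarith) _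
      calc ‖w i s x‖ * (r - ‖x‖ - κ * s) ≤ K * r := by
            gcongr
            linarith [norm_nonneg x]
        _ = 0 + K * r / ε ^ (N + 1) / 2 ^ 0 * ε ^ (N + 1) := by field_simp; ring
        _ ≤ 2 * A * r * (s + ε) ^ (N + 1) + K * r / ε ^ (N + 1) / 2 ^ 0 * (s + ε) ^ (N + 1) := by
            gcongr
            positivity
        _ = _ := by ring
    | succ q ih =>
      have := step ε hε _ (by positivity) ih
      intro i s hs x hx
      refine (this i s hs x hx).trans_eq ?_
      ring
  have hs0 := hs.1
  have hdpos : 0 < r - ‖x‖ - κ * s := by linarith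
  have hε : ∀ ε > 0, ‖w i s x‖ ≤ 2 * A * r * (s + ε) ^ (N + 1) / (r - ‖x‖ - κ * s) := by
    intro ε hε
    have hlim : Tendsto (fun q : ℕ => (2 * A * r + K * r / ε ^ (N + 1) / 2 ^ q) *
        (s + ε) ^ (N + 1) / (r - ‖x‖ - κ * s)) atTop
        (𝓝 ((2 * A * r + 0) * (s + ε) ^ (N + 1) / (r - ‖x‖ - κ * s))) := by
      refine ((tendsto_const_nhds.add ?_).mul_const _).div_const _
      exact tendsto_const_nhds.div_atTop (tendsto_pow_atTop_atTop_of_one_lt one_lt_two)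
    rw [add_zero] at hlim
    exact ge_of_tendsto' hlim fun q => iter ε hε q i s hs x hx
  have hlim : Tendsto (fun ε : ℝ => 2 * A * r * (s + ε) ^ (N + 1) / (r - ‖x‖ - κ * s)) (𝓝[>] 0)
      (𝓝 (2 * A * r * (s + 0) ^ (N + 1) / (r - ‖x‖ - κ * s))) := by
    refine Tendsto.mono_left (Continuous.tendsto ?_ 0) nhdsWithin_le_nhds
    fun_prop
  rw [add_zero] at hlim
  refine ge_of_tendsto hlim ?_
  filter_upwards [self_mem_nhdsWithin] with ε h using hε ε h

end Rays

/-! ### The Picard operator on radial domains. -/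

section Radial

variable {m n : ℕ}

/-- A domain `T` of parameters `t` with a radial contraction `act s`, `0 < s ≤ 1`, which multiplies
the complex number `e t` lying below `t` by `s`. -/
structure IsRadialDomain (T : Set ℂ) (act : ℝ → ℂ → ℂ) (e : ℂ → ℂ) : Prop where
  isOpen : IsOpen T
  mem : ∀ s ∈ Ioc (0 : ℝ) 1, ∀ t ∈ T, act s t ∈ T
  differentiableOn_act : ∀ s ∈ Ioc (0 : ℝ) 1, DifferentiableOn ℂ (act s) T
  differentiableOn_coe : DifferentiableOn ℂ e T
  coe_act : ∀ s ∈ Ioc (0 : ℝ) 1, ∀ t ∈ T, e (act s t) = s * e t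
  act_act : ∀ s ∈ Ioc (0 : ℝ) 1, ∀ s' ∈ Ioc (0 : ℝ) 1, ∀ t ∈ T, act s (act s' t) = act (s * s') t
  act_one : ∀ t ∈ T, act 1 t = t
  continuousOn_act : ∀ t ∈ T, ContinuousOn (fun s => act s t) (Ioc 0 1)

/-- The points `(t, x)` with `t ∈ T` and `‖x‖ + κ ‖e t‖ < r`. -/
def radialCone (n : ℕ) (T : Set ℂ) (e : ℂ → ℂ) (κ r : ℝ) : Set (ℂ × (Fin n → ℂ)) :=
  {p | p.1 ∈ T ∧ ‖p.2‖ + κ * ‖e p.1‖ < r}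

variable {T : Set ℂ} {act : ℝ → ℂ → ℂ} {e : ℂ → ℂ} {κ r : ℝ}

theorem IsRadialDomain.isOpen_cone (hT : IsRadialDomain T act e) :
    IsOpen (radialCone n T e κ r) := by
  have h1 : IsOpen (Prod.fst ⁻¹' T : Set (ℂ × (Fin n → ℂ))) := hT.isOpen.preimage continuous_fst
  have h2 : ContinuousOn (fun p : ℂ × (Fin n → ℂ) => ‖p.2‖ + κ * ‖e p.1‖) (Prod.fst ⁻¹' T) := by
    refine continuous_snd.norm.continuousOn.add (continuousOn_const.mul ?_)
    exact (hT.differentiableOn_coe.continuousOn.comp continuous_fst.continuousOn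
      fun p hp => hp).norm
  exact h2.isOpen_inter_preimage h1 isOpen_Iio

theorem radialCone_mono {r' : ℝ} (h : r ≤ r') : radialCone n T e κ r ⊆ radialCone n T e κ r' :=
  fun _ hp => ⟨hp.1, hp.2.trans_le h⟩

theorem IsRadialDomain.norm_coe_act (hT : IsRadialDomain T act e) {t : ℂ} (ht : t ∈ T) {s : ℝ}
    (hs : s ∈ Ioc (0 : ℝ) 1) : ‖e (act s t)‖ = s * ‖e t‖ := by
  rw [hT.coe_act s hs t ht, norm_mul, Complex.norm_real, Real.norm_of_nonneg hs.1.le]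

theorem IsRadialDomain.act_mem_cone (hT : IsRadialDomain T act e) (hκ : 0 ≤ κ)
    {p : ℂ × (Fin n → ℂ)} (hp : p ∈ radialCone n T e κ r) {s : ℝ} (hs : s ∈ Ioc (0 : ℝ) 1) :
    (act s p.1, p.2) ∈ radialCone n T e κ r := by
  refine ⟨hT.mem s hs _ hp.1, lt_of_le_of_lt ?_ hp.2⟩
  dsimp only
  rw [hT.norm_coe_act hp.1 hs]
  have := mul_le_of_le_one_left (norm_nonneg (e p.1)) hs.2
  gcongr

theorem DifferentiableOn.slice {D : Set (ℂ × (Fin n → ℂ))} (hD : IsOpen D)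
    {u : ℂ → (Fin n → ℂ) → ℂ} (hu : DifferentiableOn ℂ (fun p : ℂ × (Fin n → ℂ) => u p.1 p.2) D)
    {p : ℂ × (Fin n → ℂ)} (hp : p ∈ D) : DifferentiableAt ℂ (u p.1) p.2 := by
  have h1 : DifferentiableAt ℂ (fun p : ℂ × (Fin n → ℂ) => u p.1 p.2) (p.1, p.2) :=
    hu.differentiableAt (hD.mem_nhds hp)
  have h2 : DifferentiableAt ℂ (fun y : Fin n → ℂ => (p.1, y)) p.2 :=
    (differentiableAt_const _).prodMk differentiableAt_id
  exact h1.comp p.2 h2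

theorem differentiableOn_xDeriv {D : Set (ℂ × (Fin n → ℂ))} (hD : IsOpen D)
    {u : ℂ → (Fin n → ℂ) → ℂ} (hu : DifferentiableOn ℂ (fun p : ℂ × (Fin n → ℂ) => u p.1 p.2) D)
    (j : Fin n) : DifferentiableOn ℂ (fun p : ℂ × (Fin n → ℂ) => xDeriv j (u p.1) p.2) D := by
  refine (DifferentiableOn.fderiv_apply_const hD hu (0, Pi.single j 1)).congr fun p hp => ?_
  have h1 : HasFDerivAt (fun p : ℂ × (Fin n → ℂ) => u p.1 p.2) _ (p.1, p.2) :=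
    (hu.differentiableAt (hD.mem_nhds hp)).hasFDerivAt
  have h2 : HasFDerivAt (fun y : Fin n → ℂ => (p.1, y)) _ p.2 :=
    (hasFDerivAt_const (𝕜 := ℂ) p.1 p.2).prodMk (hasFDerivAt_id p.2)
  have h3 := (h1.comp p.2 h2).fderiv
  unfold xDeriv
  change fderiv ℂ (fun y => u p.1 y) p.2 _ = _
  rw [show (fun y => u p.1 y) = (fun p : ℂ × (Fin n → ℂ) => u p.1 p.2) ∘ fun y => (p.1, y) from rfl,
    h3]
  simp

theorem differentiableOn_jetPart {D : Set (ℂ × (Fin n → ℂ))} (hD : IsOpen D)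
    {u : Fin m → ℂ → (Fin n → ℂ) → ℂ}
    (hu : ∀ i, DifferentiableOn ℂ (fun p : ℂ × (Fin n → ℂ) => u i p.1 p.2) D) :
    DifferentiableOn ℂ (fun p : ℂ × (Fin n → ℂ) => jetPart (fun i => u i p.1) p.2) D :=
  (differentiableOn_pi.2 fun i => hu i).prodMk (differentiableOn_pi.2 fun i =>
    differentiableOn_pi.2 fun j => differentiableOn_xDeriv hD (hu i) j)

/-- The right hand side `f_i` evaluated on the jet of `u`. -/
noncomputable def rhsAlong (f : Fin m → ℂ → CauchyVar m n → ℂ) (u : Fin m → ℂ → (Fin n → ℂ) → ℂ)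
    (i : Fin m) (t : ℂ) (x : Fin n → ℂ) : ℂ :=
  f i t (cauchyJet (fun i' => u i' t) x)

/-- The Picard operator of the Cauchy problem. -/
noncomputable def picard (act : ℝ → ℂ → ℂ) (e : ℂ → ℂ) (f : Fin m → ℂ → CauchyVar m n → ℂ)
    (u : Fin m → ℂ → (Fin n → ℂ) → ℂ) (i : Fin m) (t : ℂ) (x : Fin n → ℂ) : ℂ :=
  e t * ∫ s in (0 : ℝ)..1, rhsAlong f u i (act s t) x

/-- `u` is holomorphic on `D` with jets of size at most `R₁ / 2`. -/
structure IsAdmissible (R₁ : ℝ) (D : Set (ℂ × (Fin n → ℂ))) (u : Fin m → ℂ → (Fin n → ℂ) → ℂ) :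
    Prop where
  holomorphic : ∀ i, DifferentiableOn ℂ (fun p : ℂ × (Fin n → ℂ) => u i p.1 p.2) D
  norm_le : ∀ p ∈ D, ‖jetPart (fun i => u i p.1) p.2‖ ≤ R₁ / 2

theorem IsAdmissible.mono {R₁ : ℝ} {D D' : Set (ℂ × (Fin n → ℂ))}
    {u : Fin m → ℂ → (Fin n → ℂ) → ℂ} (hu : IsAdmissible R₁ D u) (h : D' ⊆ D) :
    IsAdmissible R₁ D' u :=
  ⟨fun i => (hu.holomorphic i).mono h, fun p hp => hu.norm_le p (h hp)⟩

/-- The right hand side `f` is holomorphic and bounded by `M`. -/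
structure IsBoundedRhs (T : Set ℂ) (R₀ R₁ M : ℝ) (f : Fin m → ℂ → CauchyVar m n → ℂ) : Prop where
  holomorphic : ∀ i, DifferentiableOn ℂ (fun p : ℂ × CauchyVar m n => f i p.1 p.2)
    (T ×ˢ cauchyDomain m n R₀ R₁)
  norm_le : ∀ i, ∀ t ∈ T, ∀ Y ∈ cauchyDomain m n R₀ R₁, ‖f i t Y‖ ≤ M

variable {R₀ R₁ M : ℝ} {f : Fin m → ℂ → CauchyVar m n → ℂ} {u v : Fin m → ℂ → (Fin n → ℂ) → ℂ}

theorem IsBoundedRhs.slice (hf : IsBoundedRhs T R₀ R₁ M f) (i : Fin m) {t : ℂ} (ht : t ∈ T) :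
    DifferentiableOn ℂ (f i t) (cauchyDomain m n R₀ R₁) := by
  refine (hf.holomorphic i).comp (f := fun Y => (t, Y)) (Differentiable.differentiableOn ?_)
    fun Y hY => ⟨ht, hY⟩
  exact (differentiable_const t).prodMk differentiable_id

theorem norm_fst_lt_of_mem_cone (hκ : 0 ≤ κ) (hr : r ≤ R₀) {p : ℂ × (Fin n → ℂ)}
    (hp : p ∈ radialCone n T e κ r) : ‖p.2‖ < R₀ := by
  have := mul_nonneg hκ (norm_nonneg (e p.1))
  have := hp.2
  linarith

theorem IsBoundedRhs.norm_sub_le (hf : IsBoundedRhs T R₀ R₁ M f) (hR₁ : 0 < R₁) (i : Fin m)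
    {t : ℂ} (ht : t ∈ T) {x : Fin n → ℂ} (hx : ‖x‖ < R₀)
    (hu : ‖jetPart (fun i => u i t) x‖ ≤ R₁ / 2) (hv : ‖jetPart (fun i => v i t) x‖ ≤ R₁ / 2) :
    ‖rhsAlong f u i t x - rhsAlong f v i t x‖ ≤
      4 * M / R₁ * ‖jetPart (fun i => u i t) x - jetPart (fun i => v i t) x‖ :=
  norm_sub_le_of_cauchyDomain hR₁ (hf.slice i ht) (hf.norm_le i t ht) hx hu hv

theorem IsAdmissible.jet_mem (hu : IsAdmissible R₁ (radialCone n T e κ r) u) (hκ : 0 ≤ κ)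
    (hr : r ≤ R₀) (hR₁ : 0 < R₁) {p : ℂ × (Fin n → ℂ)} (hp : p ∈ radialCone n T e κ r) :
    cauchyJet (fun i => u i p.1) p.2 ∈ cauchyDomain m n R₀ R₁ := by
  rw [cauchyJet_eq, mem_cauchyDomain_iff]
  exact ⟨norm_fst_lt_of_mem_cone hκ hr hp, (hu.norm_le p hp).trans_lt (half_lt_self hR₁)⟩

theorem IsAdmissible.differentiableOn_rhs (hT : IsRadialDomain T act e)
    (hf : IsBoundedRhs T R₀ R₁ M f) (hκ : 0 ≤ κ) (hr : r ≤ R₀) (hR₁ : 0 < R₁)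
    (hu : IsAdmissible R₁ (radialCone n T e κ r) u) (i : Fin m) :
    DifferentiableOn ℂ (fun p : ℂ × (Fin n → ℂ) => rhsAlong f u i p.1 p.2)
      (radialCone n T e κ r) := by
  have h1 : DifferentiableOn ℂ (fun p : ℂ × (Fin n → ℂ) =>
      (p.1, ((p.2, jetPart (fun i => u i p.1) p.2) : CauchyVar m n))) (radialCone n T e κ r) :=
    differentiableOn_fst.prodMk
      (differentiableOn_snd.prodMk (differentiableOn_jetPart hT.isOpen_cone hu.holomorphic))
  exact (hf.holomorphic i).comp h1 fun p hp => ⟨hp.1, hu.jet_mem hκ hr hR₁ hp⟩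

theorem IsAdmissible.norm_rhs_le (hf : IsBoundedRhs T R₀ R₁ M f) (hκ : 0 ≤ κ) (hr : r ≤ R₀)
    (hR₁ : 0 < R₁) (hu : IsAdmissible R₁ (radialCone n T e κ r) u) (i : Fin m)
    {p : ℂ × (Fin n → ℂ)} (hp : p ∈ radialCone n T e κ r) : ‖rhsAlong f u i p.1 p.2‖ ≤ M :=
  hf.norm_le i _ hp.1 _ (hu.jet_mem hκ hr hR₁ hp)

theorem IsAdmissible.continuousOn_rhs_ray (hT : IsRadialDomain T act e)
    (hf : IsBoundedRhs T R₀ R₁ M f) (hκ : 0 ≤ κ) (hr : r ≤ R₀) (hR₁ : 0 < R₁)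
    (hu : IsAdmissible R₁ (radialCone n T e κ r) u) (i : Fin m) {p : ℂ × (Fin n → ℂ)}
    (hp : p ∈ radialCone n T e κ r) :
    ContinuousOn (fun s => rhsAlong f u i (act s p.1) p.2) (Ioc 0 1) :=
  (hu.differentiableOn_rhs hT hf hκ hr hR₁ i).continuousOn.comp
    (f := fun s : ℝ => (act s p.1, p.2)) ((hT.continuousOn_act p.1 hp.1).prodMk continuousOn_const)
    fun _ hs => hT.act_mem_cone hκ hp hs

theorem IsAdmissible.differentiableOn_picard (hT : IsRadialDomain T act e)
    (hf : IsBoundedRhs T R₀ R₁ M f) (hκ : 0 ≤ κ) (hr : r ≤ R₀) (hR₁ : 0 < R₁)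
    (hu : IsAdmissible R₁ (radialCone n T e κ r) u) (i : Fin m) :
    DifferentiableOn ℂ (fun p : ℂ × (Fin n → ℂ) => picard act e f u i p.1 p.2)
      (radialCone n T e κ r) := by
  refine DifferentiableOn.mul ?_ ?_
  · exact hT.differentiableOn_coe.comp differentiableOn_fst fun p hp => hp.1
  · refine differentiableOn_integral_of_norm_le hT.isOpen_cone (M := M)
      (g := fun s p => rhsAlong f u i (act s p.1) p.2) (fun s hs => ?_) (fun _ hs p hp => ?_)
      fun p hp => hu.continuousOn_rhs_ray hT hf hκ hr hR₁ i hp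
    · refine (hu.differentiableOn_rhs hT hf hκ hr hR₁ i).comp
        (f := fun p : ℂ × (Fin n → ℂ) => (act s p.1, p.2)) ?_
        fun p hp => hT.act_mem_cone hκ hp hs
      exact ((hT.differentiableOn_act s hs).comp differentiableOn_fst fun p hp => hp.1).prodMk
        differentiableOn_snd
    · exact hu.norm_rhs_le hf hκ hr hR₁ i (hT.act_mem_cone hκ hp hs)

theorem IsAdmissible.norm_picard_le (hT : IsRadialDomain T act e)
    (hf : IsBoundedRhs T R₀ R₁ M f) (hκ : 0 ≤ κ) (hr : r ≤ R₀) (hR₁ : 0 < R₁)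
    (hu : IsAdmissible R₁ (radialCone n T e κ r) u) (i : Fin m) {p : ℂ × (Fin n → ℂ)}
    (hp : p ∈ radialCone n T e κ r) : ‖picard act e f u i p.1 p.2‖ ≤ M * ‖e p.1‖ := by
  rw [picard, norm_mul, mul_comm]
  gcongr
  have := intervalIntegral.norm_integral_le_of_norm_le_const (a := (0 : ℝ)) (b := 1) (C := M)
    (f := fun s => rhsAlong f u i (act s p.1) p.2) fun s hs => by
      rw [uIoc_of_le zero_le_one] at hs
      exact hu.norm_rhs_le hf hκ hr hR₁ i (hT.act_mem_cone hκ hp hs)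
  simpa using this

/-- Substituting `σ * s` for the integration variable, the Jacobian cancels the factor by which `e`
shrinks. Along a ray the operator becomes a primitive, which can be differentiated in the real
variable `s`. -/
theorem picard_act (hT : IsRadialDomain T act e)
    {p : ℂ × (Fin n → ℂ)} (hp : p.1 ∈ T) (i : Fin m) {s : ℝ} (hs : s ∈ Ioc (0 : ℝ) 1) :
    picard act e f u i (act s p.1) p.2 =
      e p.1 * ∫ σ in (0 : ℝ)..s, rhsAlong f u i (act σ p.1) p.2 := by
  have h1 : ∫ σ in (0 : ℝ)..1, rhsAlong f u i (act σ (act s p.1)) p.2 =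
      ∫ σ in (0 : ℝ)..1, rhsAlong f u i (act (σ * s) p.1) p.2 := by
    simp only [intervalIntegral.integral_of_le zero_le_one]
    refine MeasureTheory.setIntegral_congr_fun measurableSet_Ioc fun σ hσ => ?_
    simp only [hT.act_act σ hσ s hs _ hp]
  have h2 := intervalIntegral.integral_comp_mul_right (a := 0) (b := 1)
    (fun σ => rhsAlong f u i (act σ p.1) p.2) hs.1.ne'
  have hsc : (s : ℂ) ≠ 0 := by exact_mod_cast hs.1.ne'
  rw [picard, h1, h2, hT.coe_act s hs _ hp, zero_mul, one_mul, Complex.real_smul]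
  push_cast
  field_simp

theorem IsAdmissible.hasDerivAt_picard (hT : IsRadialDomain T act e)
    (hf : IsBoundedRhs T R₀ R₁ M f) (hκ : 0 ≤ κ) (hr : r ≤ R₀) (hR₁ : 0 < R₁)
    (hu : IsAdmissible R₁ (radialCone n T e κ r) u) (i : Fin m) {p : ℂ × (Fin n → ℂ)}
    (hp : p ∈ radialCone n T e κ r) {s : ℝ} (hs : s ∈ Ioo (0 : ℝ) 1) :
    HasDerivAt (fun s => picard act e f u i (act s p.1) p.2)
      (e p.1 * rhsAlong f u i (act s p.1) p.2) s := by
  have hc := hu.continuousOn_rhs_ray hT hf hκ hr hR₁ i hp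
  have hint : IntervalIntegrable (fun σ => rhsAlong f u i (act σ p.1) p.2)
      MeasureTheory.volume 0 s := by
    rw [intervalIntegrable_iff_integrableOn_Ioc_of_le hs.1.le]
    refine MeasureTheory.IntegrableOn.mono_set (t := Ioc (0 : ℝ) 1) ?_ (Ioc_subset_Ioc_right hs.2.le)
    refine ⟨hc.aestronglyMeasurable measurableSet_Ioc,
      MeasureTheory.HasFiniteIntegral.of_bounded (C := M) ?_⟩
    filter_upwards [MeasureTheory.ae_restrict_mem measurableSet_Ioc] with σ hσ
    exact hu.norm_rhs_le hf hκ hr hR₁ i (hT.act_mem_cone hκ hp hσ)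
  have hc' : ContinuousOn (fun σ => rhsAlong f u i (act σ p.1) p.2) (Ioo 0 1) :=
    hc.mono Ioo_subset_Ioc_self
  have h := (intervalIntegral.integral_hasDerivAt_right hint
    (hc'.stronglyMeasurableAtFilter isOpen_Ioo s hs)
    (hc'.continuousAt (isOpen_Ioo.mem_nhds hs))).const_mul (e p.1)
  refine h.congr_of_eventuallyEq ?_
  filter_upwards [isOpen_Ioo.mem_nhds hs] with σ hσ
  exact picard_act hT hp.1 i ⟨hσ.1, hσ.2.le⟩

theorem IsAdmissible.norm_picard_sub_le (hT : IsRadialDomain T act e)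
    (hf : IsBoundedRhs T R₀ R₁ M f) (hκ : 0 ≤ κ) (hr : r ≤ R₀) (hR₁ : 0 < R₁)
    (hu : IsAdmissible R₁ (radialCone n T e κ r) u)
    (hv : IsAdmissible R₁ (radialCone n T e κ r) v) (i : Fin m) {p : ℂ × (Fin n → ℂ)}
    (hp : p ∈ radialCone n T e κ r) {a b c d : ℝ} (ha : 0 ≤ a) (hb : 0 ≤ b) (hc : 0 ≤ c)
    (hd : c < d)
    (h : ∀ σ ∈ Ioo (0 : ℝ) 1, ‖e p.1‖ *
      ‖rhsAlong f u i (act σ p.1) p.2 - rhsAlong f v i (act σ p.1) p.2‖ ≤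
        a * c / (d - c * σ) ^ 2 + b) :
    ‖picard act e f u i p.1 p.2 - picard act e f v i p.1 p.2‖ ≤ a / (d - c) + b := by
  have hcont : ∀ w : Fin m → ℂ → (Fin n → ℂ) → ℂ, IsAdmissible R₁ (radialCone n T e κ r) w →
      ContinuousOn (fun s => picard act e f w i (act s p.1) p.2) (Ioc 0 1) := fun w hw =>
    (hw.differentiableOn_picard hT hf hκ hr hR₁ i).continuousOn.comp
      (f := fun s : ℝ => (act s p.1, p.2))
      ((hT.continuousOn_act p.1 hp.1).prodMk continuousOn_const)
      fun s hs => hT.act_mem_cone hκ hp hs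
  have hzero : ∀ w : Fin m → ℂ → (Fin n → ℂ) → ℂ, IsAdmissible R₁ (radialCone n T e κ r) w →
      Tendsto (fun s => picard act e f w i (act s p.1) p.2) (𝓝[>] 0) (𝓝 0) := by
    intro w hw
    have hlim : Tendsto (fun s : ℝ => M * (s * ‖e p.1‖)) (𝓝[>] 0) (𝓝 (M * (0 * ‖e p.1‖))) := by
      refine Tendsto.mono_left (Continuous.tendsto ?_ 0) nhdsWithin_le_nhds
      fun_prop
    rw [zero_mul, mul_zero] at hlim
    refine squeeze_zero_norm' ?_ hlim
    filter_upwards [Ioc_mem_nhdsGT (zero_lt_one (α := ℝ))] with s hs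
    rw [← hT.norm_coe_act hp.1 hs]
    exact hw.norm_picard_le hT hf hκ hr hR₁ i (hT.act_mem_cone hκ hp hs)
  have := norm_le_of_ray_deriv_bound (s := 1) (a := a) (b := b) (c := c) (d := d)
    (v := fun s => picard act e f u i (act s p.1) p.2 - picard act e f v i (act s p.1) p.2)
    zero_lt_one ha hb hc (by rwa [mul_one]) ((hcont u hu).sub (hcont v hv))
    (fun σ hσ => (hu.hasDerivAt_picard hT hf hκ hr hR₁ i hp hσ).sub
      (hv.hasDerivAt_picard hT hf hκ hr hR₁ i hp hσ)) (fun σ hσ => ?_)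
    (by simpa using (hzero u hu).sub (hzero v hv))
  · rwa [mul_one, mul_one, hT.act_one _ hp.1] at this
  · rw [← mul_sub, norm_mul]
    exact h σ hσ

/-- The contraction: the Lipschitz constant `4 * M / R₁` times the jet constant `2 * r' + 8` is at
most `κ / 8`, and integrating the squared inverse weight gives back `1 / κ`. The radius `r'` is
separate from `r` because `r` shrinks during the iteration while `κ` stays fixed. -/
theorem IsAdmissible.norm_picard_sub_le_of_weight (hT : IsRadialDomain T act e)
    (hf : IsBoundedRhs T R₀ R₁ M f) (hM : 0 < M) {r' : ℝ} (hrr' : r ≤ r') (hr' : 0 < r')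
    (hκ : 32 * M / R₁ * (2 * r' + 8) ≤ κ) (hr : r ≤ R₀) (hR₁ : 0 < R₁)
    (hu : IsAdmissible R₁ (radialCone n T e κ r) u)
    (hv : IsAdmissible R₁ (radialCone n T e κ r) v) {γ : ℝ} (hγ : 0 ≤ γ)
    (h : ∀ i, ∀ p ∈ radialCone n T e κ r,
      ‖u i p.1 p.2 - v i p.1 p.2‖ ≤ γ * ‖e p.1‖ / (r - ‖p.2‖ - κ * ‖e p.1‖)) (i : Fin m)
    {p : ℂ × (Fin n → ℂ)} (hp : p ∈ radialCone n T e κ r) :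
    ‖picard act e f u i p.1 p.2 - picard act e f v i p.1 p.2‖ ≤
      γ / 8 * ‖e p.1‖ / (r - ‖p.2‖ - κ * ‖e p.1‖) := by
  have hκ0 : 0 ≤ κ := le_trans (by positivity) hκ
  have hp2 := hp.2
  have := hu.norm_picard_sub_le hT hf hκ0 hr hR₁ hv i hp (a := γ / 8 * ‖e p.1‖) (b := 0)
    (c := κ * ‖e p.1‖) (d := r - ‖p.2‖) (by positivity) le_rfl (by positivity) (by linarith)
    fun σ hσ => ?_
  · rwa [add_zero] at this
  · have hσ' : σ ∈ Ioc (0 : ℝ) 1 := ⟨hσ.1, hσ.2.le⟩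
    have hσ0 := hσ.1
    have hq := hT.act_mem_cone hκ0 hp hσ'
    have hnorm := hT.norm_coe_act hp.1 hσ'
    have hlip := hf.norm_sub_le hR₁ i hq.1 (norm_fst_lt_of_mem_cone hκ0 hr hq)
      (hu.norm_le _ hq) (hv.norm_le _ hq)
    have hq2 := hq.2
    simp only [hnorm] at hq2
    have hmem : ∀ y ∈ ball (0 : Fin n → ℂ) (r - κ * (σ * ‖e p.1‖)),
        (act σ p.1, y) ∈ radialCone n T e κ r := by
      intro y hy
      rw [mem_ball_zero_iff] at hy
      refine ⟨hq.1, ?_⟩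
      simp only [hnorm]
      linarith
    rw [← jetPart_sub (fun i => (hu.holomorphic i).slice hT.isOpen_cone hq)
      (fun i => (hv.holomorphic i).slice hT.isOpen_cone hq)] at hlip
    have hjet := norm_jetPart_le_of_weight (x := p.2) (K := γ * (σ * ‖e p.1‖))
      (g := fun i y => u i (act σ p.1) y - v i (act σ p.1) y) (ϱ := r - κ * (σ * ‖e p.1‖)) (r := r')
      (by have : 0 ≤ κ * (σ * ‖e p.1‖) := by positivity
          linarith) (by linarith) (by positivity)
      (fun i y hy => (((hu.holomorphic i).slice hT.isOpen_cone (hmem y hy)).sub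
        ((hv.holomorphic i).slice hT.isOpen_cone (hmem y hy))).differentiableWithinAt)
      (fun i y hy => by
        have := h i _ (hmem y hy)
        simp only [hnorm] at this
        rwa [sub_right_comm] at this)
    have hpos : 0 < r - κ * (σ * ‖e p.1‖) - ‖p.2‖ := by linarith
    calc _ ≤ ‖e p.1‖ * (4 * M / R₁ * (γ * (σ * ‖e p.1‖) * (2 * r' + 8) /
          (r - κ * (σ * ‖e p.1‖) - ‖p.2‖) ^ 2)) := by
          refine mul_le_mul_of_nonneg_left (hlip.trans ?_) (norm_nonneg _)
          exact mul_le_mul_of_nonneg_left hjet (by positivity)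
      _ = ‖e p.1‖ * (γ / 8 * (σ * ‖e p.1‖)) * (32 * M / R₁ * (2 * r' + 8)) /
          (r - κ * (σ * ‖e p.1‖) - ‖p.2‖) ^ 2 := by ring
      _ ≤ ‖e p.1‖ * (γ / 8 * (1 * ‖e p.1‖)) * κ /
          (r - κ * (σ * ‖e p.1‖) - ‖p.2‖) ^ 2 := by
          gcongr
          exact hσ.2.le
      _ = γ / 8 * ‖e p.1‖ * (κ * ‖e p.1‖) / (r - ‖p.2‖ - κ * ‖e p.1‖ * σ) ^ 2 + 0 := by
          rw [add_zero, show r - κ * (σ * ‖e p.1‖) - ‖p.2‖ = r - ‖p.2‖ - κ * ‖e p.1‖ * σ by ring]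
          ring

end Radial

/-! ### Convergence of the Picard iterates. -/

section Existence

variable {m n : ℕ} {T : Set ℂ} {act : ℝ → ℂ → ℂ} {e : ℂ → ℂ} {κ r R₀ R₁ M : ℝ}
  {f : Fin m → ℂ → CauchyVar m n → ℂ}

/-- The radii of the domains of the Picard iterates. -/
noncomputable def picardRadius (r : ℝ) (p : ℕ) : ℝ := r / 2 + r / 2 ^ (p + 1)

theorem picardRadius_succ (r : ℝ) (p : ℕ) :
    picardRadius r p = picardRadius r (p + 1) + r / (4 * 2 ^ p) := by
  unfold picardRadius
  field_simp
  ring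

theorem picardRadius_zero (r : ℝ) : picardRadius r 0 = r := by
  unfold picardRadius
  ring

theorem picardRadius_le (hr : 0 < r) (p : ℕ) : picardRadius r p ≤ r := by
  induction p with
  | zero => exact (picardRadius_zero r).le
  | succ p ih =>
    have := picardRadius_succ r p
    have h : 0 < r / (4 * 2 ^ p) := by positivity
    linarith

/-- The Picard iterates. -/
noncomputable def picardIter (act : ℝ → ℂ → ℂ) (e : ℂ → ℂ) (f : Fin m → ℂ → CauchyVar m n → ℂ) :
    ℕ → Fin m → ℂ → (Fin n → ℂ) → ℂ
  | 0 => fun _ _ _ => 0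
  | p + 1 => picard act e f (picardIter act e f p)

theorem norm_jetPart_zero (x : Fin n → ℂ) :
    ‖jetPart (fun (_ : Fin m) (_ : Fin n → ℂ) => (0 : ℂ)) x‖ = 0 := by
  rw [norm_eq_zero]
  refine Prod.ext rfl ?_
  funext i j
  simp [jetPart, xDeriv]

/-- The increments decay like `8 ^ (-p)`. Bounding their jets on the next cone costs the inverse
square of the gap `r / (4 * 2 ^ p)` between the radii, of order `4 ^ p`, so a factor `2 ^ (-p)`
survives. The `64` in `κ` makes the jet increments sum to less than `R₁ / 2`, which keeps every
iterate admissible. -/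
theorem picardIter_estimates (hT : IsRadialDomain T act e) (hf : IsBoundedRhs T R₀ R₁ M f)
    (hM : 0 < M) (hR₁ : 0 < R₁) (hr0 : 0 < r) (hr : r ≤ R₀)
    (hκ : κ = 64 * M / R₁ * (2 * r + 8)) (p : ℕ) :
    (∀ i, DifferentiableOn ℂ (fun q : ℂ × (Fin n → ℂ) => picardIter act e f p i q.1 q.2)
      (radialCone n T e κ (picardRadius r p))) ∧
    (∀ q ∈ radialCone n T e κ (picardRadius r p),
      ‖jetPart (fun i => picardIter act e f p i q.1) q.2‖ ≤ R₁ / 2 * (1 - 1 / 2 ^ p)) ∧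
    ∀ i, ∀ q ∈ radialCone n T e κ (picardRadius r p),
      ‖picardIter act e f (p + 1) i q.1 q.2 - picardIter act e f p i q.1 q.2‖ ≤
        M * r / 8 ^ p * ‖e q.1‖ / (picardRadius r p - ‖q.2‖ - κ * ‖e q.1‖) := by
  have hκ0 : 0 < κ := by rw [hκ]; positivity
  have hadm : ∀ p, (∀ i, DifferentiableOn ℂ
      (fun q : ℂ × (Fin n → ℂ) => picardIter act e f p i q.1 q.2)
      (radialCone n T e κ (picardRadius r p))) →
    (∀ q ∈ radialCone n T e κ (picardRadius r p),
      ‖jetPart (fun i => picardIter act e f p i q.1) q.2‖ ≤ R₁ / 2 * (1 - 1 / 2 ^ p)) →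
    IsAdmissible R₁ (radialCone n T e κ (picardRadius r p)) (picardIter act e f p) := by
    intro p h1 h2
    refine ⟨h1, fun q hq => (h2 q hq).trans ?_⟩
    have : (0 : ℝ) ≤ 1 / 2 ^ p := by positivity
    nlinarith
  induction p with
  | zero =>
    have h1 : ∀ i, DifferentiableOn ℂ
        (fun q : ℂ × (Fin n → ℂ) => picardIter act e f 0 i q.1 q.2)
        (radialCone n T e κ (picardRadius r 0)) := fun i => by
      simp only [picardIter]
      exact differentiableOn_const 0
    have h2 : ∀ q ∈ radialCone n T e κ (picardRadius r 0),
        ‖jetPart (fun i => picardIter act e f 0 i q.1) q.2‖ ≤ R₁ / 2 * (1 - 1 / 2 ^ 0) := by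
      intro q _
      simp only [picardIter]
      change ‖jetPart (fun (_ : Fin m) (_ : Fin n → ℂ) => (0 : ℂ)) q.2‖ ≤ _
      rw [norm_jetPart_zero]
      simp
    refine ⟨h1, h2, fun i q hq => ?_⟩
    have h3 := (hadm 0 h1 h2).norm_picard_le hT hf hκ0.le (picardRadius_le hr0 0 |>.trans hr) hR₁
      i hq
    simp only [picardIter, sub_zero, pow_zero, div_one] at h3 ⊢
    have hq2 := hq.2
    rw [picardRadius_zero] at hq2 ⊢
    refine h3.trans ?_
    rw [le_div_iff₀ (by linarith)]
    have h4 : r - ‖q.2‖ - κ * ‖e q.1‖ ≤ r := by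
      have : 0 ≤ κ * ‖e q.1‖ := by positivity
      linarith [norm_nonneg q.2]
    calc _ ≤ M * ‖e q.1‖ * r := by gcongr
      _ = _ := by ring
  | succ p ih =>
    obtain ⟨ih1, ih2, ih3⟩ := ih
    have hle : picardRadius r (p + 1) ≤ picardRadius r p := by
      have := picardRadius_succ r p
      have h : 0 < r / (4 * 2 ^ p) := by positivity
      linarith
    have hrp := (picardRadius_le hr0 p).trans hr
    have had := hadm p ih1 ih2
    have h1' : ∀ i, DifferentiableOn ℂ
        (fun q : ℂ × (Fin n → ℂ) => picardIter act e f (p + 1) i q.1 q.2)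
        (radialCone n T e κ (picardRadius r p)) :=
      had.differentiableOn_picard hT hf hκ0.le hrp hR₁
    have h2 : ∀ q ∈ radialCone n T e κ (picardRadius r (p + 1)),
        ‖jetPart (fun i => picardIter act e f (p + 1) i q.1) q.2‖ ≤
          R₁ / 2 * (1 - 1 / 2 ^ (p + 1)) := by
      intro q hq
      have hq' := radialCone_mono hle hq
      have hq2 := hq.2
      have hmem : ∀ y ∈ ball (0 : Fin n → ℂ) (picardRadius r p - κ * ‖e q.1‖),
          (q.1, y) ∈ radialCone n T e κ (picardRadius r p) := by
        intro y hy
        rw [mem_ball_zero_iff] at hy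
        exact ⟨hq.1, by dsimp only; linarith⟩
      have hκe : 0 ≤ κ * ‖e q.1‖ := by positivity
      have hρ := picardRadius_le hr0 p
      have hρ' := picardRadius_le hr0 (p + 1)
      have hsucc := picardRadius_succ r p
      have hjet := norm_jetPart_le_of_weight (x := q.2) (K := M * r / 8 ^ p * ‖e q.1‖)
        (g := fun i y => picardIter act e f (p + 1) i q.1 y - picardIter act e f p i q.1 y)
        (ϱ := picardRadius r p - κ * ‖e q.1‖) (r := r) (by linarith) (by linarith [hq'.2])
        (by positivity)
        (fun i y hy => (((h1' i).slice hT.isOpen_cone (hmem y hy)).sub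
          ((ih1 i).slice hT.isOpen_cone (hmem y hy))).differentiableWithinAt)
        (fun i y hy => by
          have := ih3 i _ (hmem y hy)
          rwa [sub_right_comm] at this)
      rw [jetPart_sub (fun i => (h1' i).slice hT.isOpen_cone hq')
        (fun i => (ih1 i).slice hT.isOpen_cone hq')] at hjet
      have h3 : ‖jetPart (fun i => picardIter act e f (p + 1) i q.1) q.2‖ ≤
          ‖jetPart (fun i => picardIter act e f p i q.1) q.2‖ +
          ‖jetPart (fun i => picardIter act e f (p + 1) i q.1) q.2 -
            jetPart (fun i => picardIter act e f p i q.1) q.2‖ := norm_le_norm_add_norm_sub' _ _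
      have h4 : M * r / 8 ^ p * ‖e q.1‖ * (2 * r + 8) /
          (picardRadius r p - κ * ‖e q.1‖ - ‖q.2‖) ^ 2 ≤ R₁ / 2 * (1 / 2 ^ (p + 1)) := by
        have h5 : r / (4 * 2 ^ p) ≤ picardRadius r p - κ * ‖e q.1‖ - ‖q.2‖ := by linarith
        have h6 : κ * ‖e q.1‖ ≤ r := by linarith [norm_nonneg q.2]
        have h8 : (8 : ℝ) ^ p = (2 ^ p) ^ 3 := by
          rw [← pow_mul, mul_comm, pow_mul]; norm_num
        have hP : (0 : ℝ) < 2 ^ p := by positivity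
        calc _ ≤ M * r / 8 ^ p * ‖e q.1‖ * (2 * r + 8) / (r / (4 * 2 ^ p)) ^ 2 := by
              gcongr
          _ = R₁ / (4 * 2 ^ p * r) * (κ * ‖e q.1‖) := by
              rw [h8, hκ]
              field_simp
              norm_num
          _ ≤ R₁ / (4 * 2 ^ p * r) * r := by gcongr
          _ = _ := by
              rw [pow_succ]
              field_simp
              norm_num
      have h7 : R₁ / 2 * (1 - 1 / 2 ^ p) + R₁ / 2 * (1 / 2 ^ (p + 1)) =
          R₁ / 2 * (1 - 1 / 2 ^ (p + 1)) := by
        rw [pow_succ]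
        field_simp
        ring
      linarith [ih2 q hq']
    have h1 := fun i => (h1' i).mono (radialCone_mono (n := n) (T := T) (e := e) (κ := κ) hle)
    refine ⟨h1, h2, fun i q hq => ?_⟩
    have hstep := (hadm (p + 1) h1 h2).norm_picard_sub_le_of_weight hT hf hM
      (hle.trans (picardRadius_le hr0 p)) hr0
      (by rw [hκ]; gcongr; norm_num) (hle.trans hrp) hR₁ (had.mono (radialCone_mono hle))
      (γ := M * r / 8 ^ p) (by positivity) (fun i q hq => ?_) i hq
    · rw [pow_succ, ← div_div]
      exact hstep
    · have hq2 := hq.2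
      refine (ih3 i q (radialCone_mono hle hq)).trans ?_
      have : 0 < picardRadius r (p + 1) - ‖q.2‖ - κ * ‖e q.1‖ := by linarith
      gcongr

/-- Existence for the Cauchy problem on a radial domain, on a cone which depends only on the bounds
for the right hand side. -/
theorem exists_solution_of_isRadialDomain (hT : IsRadialDomain T act e)
    (hf : IsBoundedRhs T R₀ R₁ M f) (hM : 0 < M) (hR₁ : 0 < R₁) (hr0 : 0 < r) (hr : r ≤ R₀)
    (hκ : κ = 64 * M / R₁ * (2 * r + 8)) :
    ∃ u : Fin m → ℂ → (Fin n → ℂ) → ℂ, IsAdmissible R₁ (radialCone n T e κ (r / 2)) u ∧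
      (∀ i, ∀ q ∈ radialCone n T e κ (r / 2), ‖u i q.1 q.2‖ ≤ M * ‖e q.1‖) ∧
      ∀ i, ∀ q ∈ radialCone n T e κ (r / 2), ∀ s ∈ Ioo (0 : ℝ) 1,
        HasDerivAt (fun s => u i (act s q.1) q.2)
          (e q.1 * rhsAlong f u i (act s q.1) q.2) s := by
  have hκ0 : 0 < κ := by rw [hκ]; positivity
  have hest := picardIter_estimates hT hf hM hR₁ hr0 hr hκ
  have hr2 : r / 2 ≤ R₀ := by linarith
  have hsub : ∀ p, radialCone n T e κ (r / 2) ⊆ radialCone n T e κ (picardRadius r p) := fun p =>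
    radialCone_mono (by unfold picardRadius; have : 0 ≤ r / 2 ^ (p + 1) := by positivity
                        linarith)
  have hadm : ∀ p, IsAdmissible R₁ (radialCone n T e κ (r / 2)) (picardIter act e f p) := by
    intro p
    refine ⟨fun i => ((hest p).1 i).mono (hsub p), fun q hq => ((hest p).2.1 q (hsub p hq)).trans ?_⟩
    have : (0 : ℝ) ≤ 1 / 2 ^ p := by positivity
    nlinarith
  -- On the limiting cone of radius `r / 2` the `p`-th weight is at least `r / (2 * 2 ^ p)`, so the
  -- rate `8 ^ (-p)` degrades to `4 ^ (-p)` only.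
  set C := 2 * M * r / κ with hC
  have hdist : ∀ i, ∀ q ∈ radialCone n T e κ (r / 2), ∀ p,
      dist (picardIter act e f p i q.1 q.2) (picardIter act e f (p + 1) i q.1 q.2) ≤
        C * (1 / 4) ^ p := by
    intro i q hq p
    rw [dist_comm, dist_eq_norm]
    refine ((hest p).2.2 i q (hsub p hq)).trans ?_
    have hq2 := hq.2
    have hP : (0 : ℝ) < 2 ^ p := by positivity
    have h8 : (8 : ℝ) ^ p = (2 ^ p) ^ 3 := by
      rw [← pow_mul, mul_comm, pow_mul]; norm_num
    have h4 : (4 : ℝ) ^ p = (2 ^ p) ^ 2 := by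
      rw [← pow_mul, mul_comm, pow_mul]; norm_num
    have h5 : r / (2 * 2 ^ p) ≤ picardRadius r p - ‖q.2‖ - κ * ‖e q.1‖ := by
      have : picardRadius r p = r / 2 + r / (2 * 2 ^ p) := by
        unfold picardRadius
        rw [pow_succ]
        ring
      linarith
    have h6 : κ * ‖e q.1‖ ≤ r := by linarith [norm_nonneg q.2]
    calc _ ≤ M * r / 8 ^ p * ‖e q.1‖ / (r / (2 * 2 ^ p)) := by gcongr
      _ = 2 * M / κ / 4 ^ p * (κ * ‖e q.1‖) := by
          rw [h8, h4]
          field_simp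
      _ ≤ 2 * M / κ / 4 ^ p * r := by gcongr
      _ = C * (1 / 4) ^ p := by
          rw [hC, one_div, inv_pow]
          field_simp
  have hlim : ∀ i, ∀ q ∈ radialCone n T e κ (r / 2), ∃ y,
      Tendsto (fun p => picardIter act e f p i q.1 q.2) atTop (𝓝 y) := fun i q hq =>
    cauchySeq_tendsto_of_complete (cauchySeq_of_le_geometric (1 / 4) C (by norm_num)
      (hdist i q hq))
  choose! u' hu' using hlim
  set u : Fin m → ℂ → (Fin n → ℂ) → ℂ := fun i t x => u' i (t, x) with hu
  have hulim : ∀ i, ∀ q ∈ radialCone n T e κ (r / 2),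
      Tendsto (fun p => picardIter act e f p i q.1 q.2) atTop (𝓝 (u i q.1 q.2)) := hu'
  set ε : ℕ → ℝ := fun p => C * (1 / 4) ^ p / (1 - 1 / 4) with hε
  have hε0 : Tendsto ε atTop (𝓝 0) := by
    have := ((tendsto_pow_atTop_nhds_zero_of_lt_one (r := (1 / 4 : ℝ)) (by norm_num)
      (by norm_num)).const_mul C).div_const (1 - 1 / 4)
    rwa [mul_zero, zero_div] at this
  have hεpos : ∀ p, 0 ≤ ε p := fun p => by
    have : (0 : ℝ) < 1 - 1 / 4 := by norm_num
    positivity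
  have huε : ∀ p i, ∀ q ∈ radialCone n T e κ (r / 2),
      ‖picardIter act e f p i q.1 q.2 - u i q.1 q.2‖ ≤ ε p := by
    intro p i q hq
    rw [← dist_eq_norm]
    exact dist_le_of_le_geometric_of_tendsto (1 / 4) C (by norm_num) (hdist i q hq) (hulim i q hq) p
  have huhol : ∀ i, DifferentiableOn ℂ (fun q : ℂ × (Fin n → ℂ) => u i q.1 q.2)
      (radialCone n T e κ (r / 2)) := fun i =>
    differentiableOn_of_norm_sub_le hT.isOpen_cone (fun p => (hadm p).holomorphic i) hε0
      fun p q hq => huε p i q hq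
  have hjet : ∀ p, ∀ q ∈ radialCone n T e κ (r / 2), ∀ δ > 0, δ ≤ r / 2 - ‖q.2‖ - κ * ‖e q.1‖ →
      ‖jetPart (fun i => u i q.1) q.2 - jetPart (fun i => picardIter act e f p i q.1) q.2‖ ≤
        ε p * (1 + 2 / δ) := by
    intro p q hq δ hδ hδ'
    rw [← jetPart_sub (fun i => (huhol i).slice hT.isOpen_cone hq)
      (fun i => ((hadm p).holomorphic i).slice hT.isOpen_cone hq)]
    have hmem : ∀ y ∈ ball q.2 δ, (q.1, y) ∈ radialCone n T e κ (r / 2) := by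
      intro y hy
      rw [mem_ball, dist_eq_norm] at hy
      have : ‖y‖ ≤ ‖y - q.2‖ + ‖q.2‖ := by simpa using norm_add_le (y - q.2) q.2
      exact ⟨hq.1, by dsimp only; linarith⟩
    refine norm_jetPart_le hδ (hεpos p) (fun i y hy =>
      (((huhol i).slice hT.isOpen_cone (hmem y hy)).sub
        (((hadm p).holomorphic i).slice hT.isOpen_cone (hmem y hy))).differentiableWithinAt)
      fun i y hy => ?_
    rw [norm_sub_rev]
    exact huε p i _ (hmem y hy)
  have huadm : IsAdmissible R₁ (radialCone n T e κ (r / 2)) u := by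
    refine ⟨huhol, fun q hq => ?_⟩
    have hδ : 0 < r / 2 - ‖q.2‖ - κ * ‖e q.1‖ := by linarith [hq.2]
    have h1 : Tendsto (fun p => R₁ / 2 + ε p * (1 + 2 / (r / 2 - ‖q.2‖ - κ * ‖e q.1‖))) atTop
        (𝓝 (R₁ / 2)) := by
      simpa using (hε0.mul_const (1 + 2 / (r / 2 - ‖q.2‖ - κ * ‖e q.1‖))).const_add (R₁ / 2)
    refine ge_of_tendsto' h1 fun p => ?_
    have h2 := hjet p q hq _ hδ le_rfl
    have h3 := (hadm p).norm_le q hq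
    have h4 := norm_le_norm_add_norm_sub' (jetPart (fun i => u i q.1) q.2)
      (jetPart (fun i => picardIter act e f p i q.1) q.2)
    linarith
  -- Moving inward along a ray only increases the distance `δ` to the boundary of the cone, so the
  -- jets of the iterates converge uniformly on the whole ray and the limit passes through the
  -- integral.
  have hfix : ∀ i, ∀ q ∈ radialCone n T e κ (r / 2),
      picard act e f u i q.1 q.2 = u i q.1 q.2 := by
    intro i q hq
    have hδ : 0 < r / 2 - ‖q.2‖ - κ * ‖e q.1‖ := by linarith [hq.2]
    set δ := r / 2 - ‖q.2‖ - κ * ‖e q.1‖ with hδdef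
    have h1 : ∀ p, ‖picardIter act e f (p + 1) i q.1 q.2 - picard act e f u i q.1 q.2‖ ≤
        ‖e q.1‖ * (4 * M / R₁ * (ε p * (1 + 2 / δ))) := by
      intro p
      rw [norm_sub_rev]
      have hb : 0 ≤ ε p * (1 + 2 / δ) := mul_nonneg (hεpos p) (by positivity)
      have := huadm.norm_picard_sub_le hT hf hκ0.le hr2 hR₁ (hadm p) i hq (a := 0)
        (b := ‖e q.1‖ * (4 * M / R₁ * (ε p * (1 + 2 / δ)))) (c := 0) (d := 1) le_rfl
        (by positivity) le_rfl zero_lt_one fun σ hσ => ?_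
      · simpa [picardIter] using this
      · have hσ' : σ ∈ Ioc (0 : ℝ) 1 := ⟨hσ.1, hσ.2.le⟩
        have hq' := hT.act_mem_cone hκ0.le hq hσ'
        rw [zero_mul, zero_div, zero_add]
        refine mul_le_mul_of_nonneg_left ?_ (norm_nonneg _)
        refine (hf.norm_sub_le hR₁ i hq'.1 (norm_fst_lt_of_mem_cone hκ0.le hr2 hq')
          (huadm.norm_le _ hq') ((hadm p).norm_le _ hq')).trans ?_
        refine mul_le_mul_of_nonneg_left (hjet p _ hq' δ hδ ?_) (by positivity)
        dsimp only
        rw [hT.norm_coe_act hq.1 hσ', hδdef]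
        have := mul_le_of_le_one_left (norm_nonneg (e q.1)) hσ.2.le
        gcongr
    have h2 : Tendsto (fun p => picardIter act e f (p + 1) i q.1 q.2) atTop
        (𝓝 (picard act e f u i q.1 q.2)) := by
      rw [tendsto_iff_norm_sub_tendsto_zero]
      refine squeeze_zero (fun _ => norm_nonneg _) h1 ?_
      have := ((hε0.mul_const (1 + 2 / δ)).const_mul (4 * M / R₁)).const_mul ‖e q.1‖
      simpa using this
    exact tendsto_nhds_unique h2 ((tendsto_add_atTop_iff_nat 1).2 (hulim i q hq))
  refine ⟨u, huadm, fun i q hq => ?_, fun i q hq s hs => ?_⟩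
  · rw [← hfix i q hq]
    exact huadm.norm_picard_le hT hf hκ0.le hr2 hR₁ i hq
  · refine (huadm.hasDerivAt_picard hT hf hκ0.le hr2 hR₁ i hq hs).congr_of_eventuallyEq ?_
    filter_upwards [isOpen_Ioo.mem_nhds hs] with σ hσ
    exact (hfix i _ (hT.act_mem_cone hκ0.le hq ⟨hσ.1, hσ.2.le⟩)).symm

end Existence

/-! ### The formal solution. -/

section Formal

variable {m n : ℕ} {R₀ R₁ r : ℝ}

theorem xDeriv_congr {g h : (Fin n → ℂ) → ℂ} (hgh : EqOn g h (ball 0 r)) {x : Fin n → ℂ}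
    (hx : x ∈ ball (0 : Fin n → ℂ) r) (j : Fin n) : xDeriv j g x = xDeriv j h x := by
  unfold xDeriv
  rw [Filter.EventuallyEq.fderiv_eq (eventually_of_mem (isOpen_ball.mem_nhds hx) hgh)]

/-- The `N`-th coefficient of the right-hand side determines the coefficient of order `N + 1` of the
solution but sees only orders up to `N`. Thus the formal equation is a recursion, which yields
existence and uniqueness. -/
theorem formalRhsCoeff_congr {F : ℕ → CauchyVar m n → ℂ} {c d : Fin m → ℕ → (Fin n → ℂ) → ℂ}
    {N : ℕ} (h : ∀ i, ∀ j ≤ N, EqOn (c i j) (d i j) (ball 0 r)) {x : Fin n → ℂ}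
    (hx : x ∈ ball (0 : Fin n → ℂ) r) : formalRhsCoeff F c N x = formalRhsCoeff F d N x := by
  unfold formalRhsCoeff
  congr 2
  funext t
  refine Finset.sum_congr rfl fun l _ => ?_
  have h1 : ∀ i, ∑ j ∈ Finset.range (N + 1), c i j x * t ^ j =
      ∑ j ∈ Finset.range (N + 1), d i j x * t ^ j := fun i =>
    Finset.sum_congr rfl fun j hj => by
      rw [h i j (Nat.lt_succ_iff.1 (Finset.mem_range.1 hj)) hx]
  have h2 : ∀ i q, ∑ j ∈ Finset.range (N + 1), xDeriv q (c i j) x * t ^ j =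
      ∑ j ∈ Finset.range (N + 1), xDeriv q (d i j) x * t ^ j := fun i q =>
    Finset.sum_congr rfl fun j hj => by
      rw [xDeriv_congr (h i j (Nat.lt_succ_iff.1 (Finset.mem_range.1 hj))) hx]
  simp only [h1, h2]

/-- The truncated series `∑_{j ≤ N} c_{i,j}(x) t^j`. -/
noncomputable def truncSeries (c : Fin m → ℕ → (Fin n → ℂ) → ℂ) (N : ℕ) (i : Fin m) (t : ℂ)
    (x : Fin n → ℂ) : ℂ :=
  ∑ j ∈ Finset.range (N + 1), c i j x * t ^ j

/-- The truncation of `∑_l t^l F_l(x, U, ∇ₓU)` along truncated series. -/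
noncomputable def truncRhs (F : ℕ → CauchyVar m n → ℂ) (c : Fin m → ℕ → (Fin n → ℂ) → ℂ) (N : ℕ)
    (t : ℂ) (x : Fin n → ℂ) : ℂ :=
  ∑ l ∈ Finset.range (N + 1), t ^ l * F l (cauchyJet (fun i => truncSeries c N i t) x)

theorem xDeriv_truncSeries {c : Fin m → ℕ → (Fin n → ℂ) → ℂ} {x : Fin n → ℂ}
    (hc : ∀ i j, DifferentiableAt ℂ (c i j) x) (N : ℕ) (i : Fin m) (t : ℂ) (q : Fin n) :
    xDeriv q (truncSeries c N i t) x =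
      ∑ j ∈ Finset.range (N + 1), xDeriv q (c i j) x * t ^ j := by
  unfold xDeriv truncSeries
  rw [fderiv_fun_sum fun j _ => (hc i j).mul_const _]
  rw [sum_apply]
  refine Finset.sum_congr rfl fun j _ => ?_
  rw [fderiv_mul_const (hc i j)]
  simp [mul_comm]

theorem formalRhsCoeff_eq {F : ℕ → CauchyVar m n → ℂ} {c : Fin m → ℕ → (Fin n → ℂ) → ℂ} {N : ℕ}
    {x : Fin n → ℂ} (hc : ∀ i j, DifferentiableAt ℂ (c i j) x) :
    formalRhsCoeff F c N x =
      iteratedDeriv N (fun t => truncRhs F c N t x) 0 / (N.factorial : ℂ) := by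
  unfold formalRhsCoeff truncRhs cauchyJet
  simp only [xDeriv_truncSeries hc]
  rfl

theorem truncSeries_zero (c : Fin m → ℕ → (Fin n → ℂ) → ℂ) (N : ℕ) (i : Fin m) (x : Fin n → ℂ) :
    truncSeries c N i 0 x = c i 0 x := by
  unfold truncSeries
  rw [Finset.sum_range_succ']
  simp

theorem differentiableOn_truncSeries {c : Fin m → ℕ → (Fin n → ℂ) → ℂ}
    (hc : ∀ i j, DifferentiableOn ℂ (c i j) (ball 0 r)) (N : ℕ) (i : Fin m) :
    DifferentiableOn ℂ (fun p : ℂ × (Fin n → ℂ) => truncSeries c N i p.1 p.2)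
      (univ ×ˢ ball 0 r) := by
  unfold truncSeries
  refine DifferentiableOn.fun_sum fun j _ => DifferentiableOn.mul ?_ ?_
  · exact (hc i j).comp differentiableOn_snd fun p hp => hp.2
  · exact (differentiable_fst.pow j).differentiableOn

theorem jetPart_truncSeries_zero {c : Fin m → ℕ → (Fin n → ℂ) → ℂ}
    (h0 : ∀ i, ∀ x ∈ ball (0 : Fin n → ℂ) r, c i 0 x = 0) (N : ℕ) {x : Fin n → ℂ}
    (hx : x ∈ ball (0 : Fin n → ℂ) r) : jetPart (fun i => truncSeries c N i 0) x = 0 := by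
  have h1 : ∀ i, EqOn (truncSeries c N i 0) (fun _ => 0) (ball 0 r) := fun i y hy => by
    rw [truncSeries_zero, h0 i y hy]
  refine Prod.ext (funext fun i => h1 i hx) ?_
  funext i j
  change xDeriv j (truncSeries c N i 0) x = 0
  rw [xDeriv_congr (h1 i) hx]
  simp [xDeriv]

/-- At `t = 0` the jet of the truncated series is `(x, 0)`, an interior point of the domain of `F`.
Only derivatives at `t = 0` are needed, so no uniformity of the neighbourhood in `x` is required. -/
theorem exists_isOpen_truncRhs (hR₁ : 0 < R₁) (hr : r ≤ R₀) {F : ℕ → CauchyVar m n → ℂ}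
    (hF : ∀ l, DifferentiableOn ℂ (F l) (cauchyDomain m n R₀ R₁))
    {c : Fin m → ℕ → (Fin n → ℂ) → ℂ} (hc : ∀ i j, DifferentiableOn ℂ (c i j) (ball 0 r))
    (h0 : ∀ i, ∀ x ∈ ball (0 : Fin n → ℂ) r, c i 0 x = 0) (N : ℕ) :
    ∃ D : Set (ℂ × (Fin n → ℂ)), IsOpen D ∧ (∀ x ∈ ball (0 : Fin n → ℂ) r, (0, x) ∈ D) ∧
      DifferentiableOn ℂ (fun p : ℂ × (Fin n → ℂ) => truncRhs F c N p.1 p.2) D := by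
  have hopen : IsOpen ((univ : Set ℂ) ×ˢ ball (0 : Fin n → ℂ) r) := isOpen_univ.prod isOpen_ball
  have hJ : DifferentiableOn ℂ (fun p : ℂ × (Fin n → ℂ) =>
      ((p.2, jetPart (fun i => truncSeries c N i p.1) p.2) : CauchyVar m n))
      (univ ×ˢ ball 0 r) :=
    differentiableOn_snd.prodMk
      (differentiableOn_jetPart hopen fun i => differentiableOn_truncSeries hc N i)
  refine ⟨_, hJ.continuousOn.isOpen_inter_preimage hopen (isOpen_cauchyDomain (R₀ := R₀) (R₁ := R₁)),
    fun x hx => ⟨⟨mem_univ _, hx⟩, ?_⟩, ?_⟩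
  · rw [mem_preimage, jetPart_truncSeries_zero h0 N hx, mem_cauchyDomain_iff, norm_zero]
    exact ⟨(mem_ball_zero_iff.1 hx).trans_le hr, hR₁⟩
  · unfold truncRhs
    refine DifferentiableOn.fun_sum fun l _ => DifferentiableOn.mul ?_ ?_
    · exact (differentiable_fst.pow l).differentiableOn
    · exact (hF l).comp (hJ.mono inter_subset_left) fun p hp => hp.2

theorem differentiableOn_formalRhsCoeff (hR₁ : 0 < R₁) (hr : r ≤ R₀) {F : ℕ → CauchyVar m n → ℂ}
    (hF : ∀ l, DifferentiableOn ℂ (F l) (cauchyDomain m n R₀ R₁))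
    {c : Fin m → ℕ → (Fin n → ℂ) → ℂ} (hc : ∀ i j, DifferentiableOn ℂ (c i j) (ball 0 r))
    (h0 : ∀ i, ∀ x ∈ ball (0 : Fin n → ℂ) r, c i 0 x = 0) (N : ℕ) :
    DifferentiableOn ℂ (formalRhsCoeff F c N) (ball 0 r) := by
  obtain ⟨D, hD, hmem, hdiff⟩ := exists_isOpen_truncRhs hR₁ hr hF hc h0 N
  have h1 := (differentiableOn_iteratedDeriv_fst hD hdiff N).comp (s := ball (0 : Fin n → ℂ) r)
    (f := fun x => ((0 : ℂ), x))
    ((differentiableOn_const _).prodMk differentiableOn_id) fun x hx => hmem x hx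
  refine (h1.mul_const ((N.factorial : ℂ)⁻¹)).congr fun x hx => ?_
  rw [formalRhsCoeff_eq fun i j => (hc i j).differentiableAt (isOpen_ball.mem_nhds hx),
    div_eq_mul_inv]
  rfl

/-- The coefficients up to the order `N` of the formal solution (and zeros above). -/
noncomputable def formalCoeffUpTo (F : Fin m → ℕ → CauchyVar m n → ℂ) :
    ℕ → Fin m → ℕ → (Fin n → ℂ) → ℂ
  | 0 => fun _ _ _ => 0
  | N + 1 => fun i j x => if j = N + 1 then
      formalRhsCoeff (F i) (formalCoeffUpTo F N) N x / ((N : ℂ) + 1) else formalCoeffUpTo F N i j x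

/-- The coefficients of the formal solution. -/
noncomputable def formalCoeff (F : Fin m → ℕ → CauchyVar m n → ℂ) (i : Fin m) (j : ℕ) :
    (Fin n → ℂ) → ℂ :=
  formalCoeffUpTo F j i j

theorem formalCoeffUpTo_eq (F : Fin m → ℕ → CauchyVar m n → ℂ) {N j : ℕ} (h : j ≤ N) (i : Fin m) :
    formalCoeffUpTo F N i j = formalCoeff F i j := by
  induction N, h using Nat.le_induction with
  | base => rfl
  | succ N hN ih =>
    rw [← ih]
    funext x
    simp [formalCoeffUpTo, (Nat.lt_succ_of_le hN).ne]

theorem formalCoeffUpTo_zero (F : Fin m → ℕ → CauchyVar m n → ℂ) (N : ℕ) (i : Fin m)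
    (x : Fin n → ℂ) : formalCoeffUpTo F N i 0 x = 0 := by
  rw [formalCoeffUpTo_eq F (Nat.zero_le N)]
  rfl

theorem differentiableOn_formalCoeffUpTo (hR₁ : 0 < R₁) {F : Fin m → ℕ → CauchyVar m n → ℂ}
    (hF : ∀ i l, DifferentiableOn ℂ (F i l) (cauchyDomain m n R₀ R₁)) (N : ℕ) (i : Fin m) (j : ℕ) :
    DifferentiableOn ℂ (formalCoeffUpTo F N i j) (ball 0 R₀) := by
  induction N generalizing i j with
  | zero => exact differentiableOn_const 0
  | succ N ih =>
    by_cases h : j = N + 1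
    · have h1 := (differentiableOn_formalRhsCoeff hR₁ le_rfl (hF i) ih
        (fun i x _ => formalCoeffUpTo_zero F N i x) N).mul_const ((N : ℂ) + 1)⁻¹
      refine h1.congr fun x _ => ?_
      simp [formalCoeffUpTo, h, div_eq_mul_inv]
    · refine (ih i j).congr fun x _ => ?_
      simp [formalCoeffUpTo, h]

theorem isFormalCauchySolution_formalCoeff (hR₁ : 0 < R₁) {F : Fin m → ℕ → CauchyVar m n → ℂ}
    (hF : ∀ i l, DifferentiableOn ℂ (F i l) (cauchyDomain m n R₀ R₁)) :
    IsFormalCauchySolution F R₀ (formalCoeff F) where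
  holomorphic i j := differentiableOn_formalCoeffUpTo hR₁ hF j i j
  initial i x _ := formalCoeffUpTo_zero F 0 i x
  equation i N x hx := by
    have h1 : formalCoeff F i (N + 1) x =
        formalRhsCoeff (F i) (formalCoeffUpTo F N) N x / ((N : ℂ) + 1) := by
      simp [formalCoeff, formalCoeffUpTo]
    have h2 : formalRhsCoeff (F i) (formalCoeffUpTo F N) N x =
        formalRhsCoeff (F i) (formalCoeff F) N x :=
      formalRhsCoeff_congr (fun i j hj => by rw [formalCoeffUpTo_eq F hj i]; exact fun _ _ => rfl) hx
    have h3 : (N : ℂ) + 1 ≠ 0 := Nat.cast_add_one_ne_zero N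
    rw [h1, h2]
    field_simp

theorem IsFormalCauchySolution.eqOn {F : Fin m → ℕ → CauchyVar m n → ℂ} {r' : ℝ} (hr : r ≤ r')
    {c d : Fin m → ℕ → (Fin n → ℂ) → ℂ} (hc : IsFormalCauchySolution F r' c)
    (hd : IsFormalCauchySolution F r d) (i : Fin m) (j : ℕ) : EqOn (d i j) (c i j) (ball 0 r) := by
  induction j using Nat.strong_induction_on generalizing i with
  | _ j ih =>
    intro x hx
    have hx' := ball_subset_ball hr hx
    cases j with
    | zero => rw [hd.initial i x hx, hc.initial i x hx']
    | succ N =>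
      have h3 : (N : ℂ) + 1 ≠ 0 := Nat.cast_add_one_ne_zero N
      refine mul_left_cancel₀ h3 ?_
      rw [hd.equation i N x hx, hc.equation i N x hx']
      exact formalRhsCoeff_congr (fun i j hj => ih j (Nat.lt_succ_of_le hj) i) hx

end Formal

/-! ### Taylor coefficients and remainders. -/

section Taylor

open Asymptotics

theorem norm_taylorCoeff_le {g : ℂ → ℂ} {τ K : ℝ} (hτ : 0 < τ)
    (hg : DifferentiableOn ℂ g (ball 0 τ)) (hK : ∀ t ∈ ball (0 : ℂ) τ, ‖g t‖ ≤ K) (l : ℕ) :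
    ‖iteratedDeriv l g 0 / (l.factorial : ℂ)‖ ≤ K * (2 / τ) ^ l := by
  have hsub : closedBall (0 : ℂ) (τ / 2) ⊆ ball 0 τ := closedBall_subset_ball (half_lt_self hτ)
  have h1 := Complex.norm_iteratedDeriv_le_of_forall_mem_sphere_norm_le (C := K) l (half_pos hτ)
    ((hg.mono hsub).diffContOnCl_ball (subset_refl _))
    fun t ht => hK t (hsub (sphere_subset_closedBall ht))
  have h2 : (0 : ℝ) < l.factorial := by exact_mod_cast l.factorial_pos
  rw [norm_div, Complex.norm_natCast, div_le_iff₀ h2]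
  refine h1.trans_eq ?_
  rw [div_pow, div_pow]
  field_simp

theorem norm_sub_taylorSum_le {g : ℂ → ℂ} {τ K : ℝ} (hτ : 0 < τ)
    (hg : DifferentiableOn ℂ g (ball 0 τ)) (hK : ∀ t ∈ ball (0 : ℂ) τ, ‖g t‖ ≤ K) (N : ℕ) {t : ℂ}
    (ht : ‖t‖ ≤ τ / 4) :
    ‖g t - ∑ l ∈ Finset.range N, iteratedDeriv l g 0 / (l.factorial : ℂ) * t ^ l‖ ≤
      2 * K * (2 * ‖t‖ / τ) ^ N := by
  have hK0 : 0 ≤ K := (norm_nonneg _).trans (hK 0 (mem_ball_self hτ))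
  have htm : t ∈ ball (0 : ℂ) τ := by
    rw [mem_ball_zero_iff]; linarith
  have h1 := Complex.hasSum_taylorSeries_on_ball hg htm
  have h2 : HasSum (fun l : ℕ => iteratedDeriv l g 0 / (l.factorial : ℂ) * t ^ l) (g t) := by
    refine h1.congr_fun fun l => ?_
    simp only [sub_zero, smul_eq_mul]
    ring
  have h3 := (hasSum_nat_add_iff' N).2 h2
  set q := 2 * ‖t‖ / τ with hq
  have hq0 : 0 ≤ q := by positivity
  have hq1 : q ≤ 1 / 2 := by
    rw [hq, div_le_iff₀ hτ]; linarith
  have h4 : HasSum (fun l : ℕ => K * q ^ N * (1 / 2 : ℝ) ^ l) (K * q ^ N * 2) :=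
    hasSum_geometric_two.mul_left _
  have h5 := h3.norm_le_of_bounded h4 fun l => ?_
  · refine h5.trans_eq ?_
    ring
  · rw [norm_mul, norm_pow]
    calc _ ≤ K * (2 / τ) ^ (l + N) * ‖t‖ ^ (l + N) := by
          gcongr
          exact norm_taylorCoeff_le hτ hg hK _
      _ = K * q ^ N * q ^ l := by
          rw [hq, mul_assoc, ← mul_pow, mul_assoc, ← pow_add, add_comm N l]
          congr 2
          ring
      _ ≤ _ := by gcongr

/-- Cauchy's estimate on the circle of radius `δ` bounds the `l`-th derivative of the difference by
a multiple of `δ ^ (l + 1) / δ ^ l`, and `δ → 0`. -/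
theorem iteratedDeriv_eq_of_isBigO {g h : ℂ → ℂ} (hg : AnalyticAt ℂ g 0) (hh : AnalyticAt ℂ h 0)
    {l : ℕ} (ho : (fun t => g t - h t) =O[𝓝[≠] 0] fun t => t ^ (l + 1)) :
    iteratedDeriv l g 0 = iteratedDeriv l h 0 := by
  have hd : AnalyticAt ℂ (fun t => g t - h t) 0 := hg.sub hh
  obtain ⟨C, hC⟩ := ho.bound
  rw [eventually_nhdsWithin_iff] at hC
  obtain ⟨ε, hε, hball⟩ := Metric.eventually_nhds_iff_ball.1 (hC.and hd.eventually_analyticAt)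
  have key : ∀ δ ∈ Ioo 0 ε, ‖iteratedDeriv l (fun t => g t - h t) 0‖ ≤ l.factorial * C * δ := by
    intro δ hδ
    have hδ0 := hδ.1
    have h1 := Complex.norm_iteratedDeriv_le_of_forall_mem_sphere_norm_le (C := C * δ ^ (l + 1))
      (c := 0) (f := fun t => g t - h t) l hδ.1 ?_ ?_
    · refine h1.trans_eq ?_
      rw [pow_succ]
      field_simp
    · refine DifferentiableOn.diffContOnCl_ball (U := ball 0 ε) ?_ (closedBall_subset_ball hδ.2)
      exact fun t ht => ((hball t ht).2.differentiableAt).differentiableWithinAt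
    · intro t ht
      have ht' : ‖t‖ = δ := by simpa using ht
      have := (hball t (by rw [mem_ball_zero_iff, ht']; exact hδ.2)).1 (by
        rintro rfl
        rw [norm_zero] at ht'
        exact hδ.1.ne ht')
      rwa [norm_pow, ht'] at this
  have hlim : Tendsto (fun δ : ℝ => l.factorial * C * δ) (𝓝[>] 0) (𝓝 (l.factorial * C * 0)) :=
    Tendsto.mono_left (Continuous.tendsto (by fun_prop) 0) nhdsWithin_le_nhds
  rw [mul_zero] at hlim
  have h0 : ‖iteratedDeriv l (fun t => g t - h t) 0‖ ≤ 0 := by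
    refine ge_of_tendsto hlim ?_
    filter_upwards [Ioo_mem_nhdsGT hε] with δ hδ using key δ hδ
  have h1 := norm_le_zero_iff.1 h0
  rw [iteratedDeriv_fun_sub hg.contDiffAt hh.contDiffAt] at h1
  exact sub_eq_zero.1 h1

end Taylor

/-! ### Taylor coefficients of solutions of truncated problems. -/

section TaylorFormal

open Asymptotics

variable {m n : ℕ} {R₀ R₁ r τ K : ℝ}

/-- The Taylor coefficients in `t` of a holomorphic solution of a truncated problem are those of the
formal solution. -/
theorem formalCoeff_eq_taylorCoeff (hR₁ : 0 < R₁) (hr : r ≤ R₀) (hτ : 0 < τ) (hK0 : 0 ≤ K)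
    {F : Fin m → ℕ → CauchyVar m n → ℂ}
    (hF : ∀ i l, DifferentiableOn ℂ (F i l) (cauchyDomain m n R₀ R₁))
    (hFb : ∀ i l, ∃ B, ∀ Y ∈ cauchyDomain m n R₀ R₁, ‖F i l Y‖ ≤ B)
    {c : Fin m → ℕ → (Fin n → ℂ) → ℂ} (hc : IsFormalCauchySolution F R₀ c)
    {h : Fin m → ℂ → (Fin n → ℂ) → ℂ} {N : ℕ}
    (hd : ∀ i, DifferentiableOn ℂ (fun p : ℂ × (Fin n → ℂ) => h i p.1 p.2)
      (ball 0 τ ×ˢ ball 0 r))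
    (hb : ∀ i, ∀ t ∈ ball (0 : ℂ) τ, ∀ x ∈ ball (0 : Fin n → ℂ) r, ‖h i t x‖ ≤ K)
    (hj : ∀ t ∈ ball (0 : ℂ) τ, ∀ x ∈ ball (0 : Fin n → ℂ) r,
      ‖jetPart (fun i => h i t) x‖ ≤ R₁ / 2)
    (hi : ∀ i, ∀ x ∈ ball (0 : Fin n → ℂ) r, h i 0 x = 0)
    (heq : ∀ i, ∀ t ∈ ball (0 : ℂ) τ, t ≠ 0 → ∀ x ∈ ball (0 : Fin n → ℂ) r,
      deriv (fun t => h i t x) t =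
        ∑ l ∈ Finset.range N, F i l (cauchyJet (fun i' => h i' t) x) * t ^ l)
    (l : ℕ) (hl : l ≤ N) (i : Fin m) {x : Fin n → ℂ} (hx : x ∈ ball (0 : Fin n → ℂ) r) :
    c i l x = iteratedDeriv l (fun t => h i t x) 0 / (l.factorial : ℂ) := by
  have hopen : IsOpen (ball (0 : ℂ) τ ×ˢ ball (0 : Fin n → ℂ) r) := isOpen_ball.prod isOpen_ball
  have hslice : ∀ i, ∀ x ∈ ball (0 : Fin n → ℂ) r,
      DifferentiableOn ℂ (fun t => h i t x) (ball 0 τ) := fun i x hx =>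
    (hd i).comp (f := fun t : ℂ => (t, x)) (differentiableOn_id.prodMk (differentiableOn_const x))
      fun t ht => ⟨ht, hx⟩
  -- If the coefficients agree through order `l`, then `h` differs from the truncated formal series
  -- by `O(t ^ (l + 1))`, uniformly on the ball. Cauchy's estimate carries this over to jets and the
  -- Lipschitz bound to the right-hand sides. Hence the coefficients of order `l` of `∂ₜ h` and of
  -- the formal right-hand side agree, which is agreement at order `l + 1`.
  induction l using Nat.strong_induction_on generalizing i x with
  | _ l ih =>
  cases l with
  | zero => simp [hc.initial i x (ball_subset_ball hr hx), hi i x hx]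
  | succ l =>
  have hcd : ∀ i j, DifferentiableOn ℂ (c i j) (ball 0 r) := fun i j =>
    (hc.holomorphic i j).mono (ball_subset_ball hr)
  have hc0 : ∀ i, ∀ x ∈ ball (0 : Fin n → ℂ) r, c i 0 x = 0 := fun i x hx =>
    hc.initial i x (ball_subset_ball hr hx)
  have hopen' : IsOpen ((univ : Set ℂ) ×ˢ ball (0 : Fin n → ℂ) r) := isOpen_univ.prod isOpen_ball
  have hvalue : ∀ i, ∀ t : ℂ, ‖t‖ ≤ τ / 4 → ∀ y ∈ ball (0 : Fin n → ℂ) r,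
      ‖h i t y - truncSeries c l i t y‖ ≤ 2 * K * (2 * ‖t‖ / τ) ^ (l + 1) := by
    intro i t ht y hy
    have h1 := norm_sub_taylorSum_le hτ (hslice i y hy) (fun t ht => hb i t ht y hy) (l + 1) ht
    have h2 : truncSeries c l i t y = ∑ j ∈ Finset.range (l + 1),
        iteratedDeriv j (fun t => h i t y) 0 / (j.factorial : ℂ) * t ^ j :=
      Finset.sum_congr rfl fun j hj => by
        have hj' := Finset.mem_range.1 hj
        rw [ih j hj' (by omega) i hy]
    rwa [h2]
  have hxr : 0 < r - ‖x‖ := by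
    have := mem_ball_zero_iff.1 hx
    linarith
  have hevs : ∀ᶠ t : ℂ in 𝓝[≠] 0, ‖t‖ ≤ τ / 4 := by
    filter_upwards [nhdsWithin_le_nhds (ball_mem_nhds (0 : ℂ) (show 0 < τ / 4 by positivity))]
      with t ht using (mem_ball_zero_iff.1 ht).le
  have hevτ : ∀ᶠ t : ℂ in 𝓝[≠] 0, t ∈ ball (0 : ℂ) τ :=
    nhdsWithin_le_nhds (ball_mem_nhds (0 : ℂ) hτ)
  have hjetO : (fun t => jetPart (fun i => h i t) x - jetPart (fun i => truncSeries c l i t) x)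
      =O[𝓝[≠] 0] fun t : ℂ => t ^ (l + 1) := by
    refine IsBigO.of_bound (2 * K * (2 / τ) ^ (l + 1) * (1 + 2 / (r - ‖x‖))) ?_
    filter_upwards [hevs, hevτ] with t ht htτ
    have hmem : ball x (r - ‖x‖) ⊆ ball 0 r := ball_subset_ball' (by simp)
    have hdiff : ∀ i, ∀ y ∈ ball (0 : Fin n → ℂ) r, DifferentiableAt ℂ (h i t) y ∧
        DifferentiableAt ℂ (truncSeries c l i t) y := fun i y hy =>
      ⟨(hd i).slice hopen (p := (t, y)) ⟨htτ, hy⟩,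
        (differentiableOn_truncSeries hcd l i).slice hopen' (p := (t, y)) ⟨mem_univ _, hy⟩⟩
    rw [← jetPart_sub (fun i => (hdiff i x hx).1) (fun i => (hdiff i x hx).2), norm_pow]
    refine (norm_jetPart_le hxr (K := 2 * K * (2 * ‖t‖ / τ) ^ (l + 1)) (by positivity)
      (fun i y hy => ((hdiff i y (hmem hy)).1.sub (hdiff i y (hmem hy)).2).differentiableWithinAt)
      fun i y hy => hvalue i t ht y (hmem hy)).trans_eq ?_
    rw [show 2 * ‖t‖ / τ = 2 / τ * ‖t‖ by ring, mul_pow]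
    ring
  have hevP : ∀ᶠ t : ℂ in 𝓝[≠] 0, ‖jetPart (fun i => truncSeries c l i t) x‖ ≤ R₁ / 2 := by
    have h1 := differentiableOn_jetPart hopen' fun i => differentiableOn_truncSeries hcd l i
    have h2 : ContinuousAt (fun t : ℂ => jetPart (fun i => truncSeries c l i t) x) 0 :=
      ContinuousAt.comp (f := fun t : ℂ => (t, x))
        (h1.continuousOn.continuousAt (hopen'.mem_nhds ⟨mem_univ _, hx⟩)) (by fun_prop)
    have h3 := h2.norm
    unfold ContinuousAt at h3
    beta_reduce at h3
    rw [jetPart_truncSeries_zero hc0 l hx, norm_zero] at h3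
    filter_upwards [nhdsWithin_le_nhds (h3.eventually (gt_mem_nhds (half_pos hR₁)))] with t ht
    exact ht.le
  have hFO : ∀ q, (fun t => F i q (cauchyJet (fun i => h i t) x) -
      F i q (cauchyJet (fun i => truncSeries c l i t) x)) =O[𝓝[≠] 0] fun t : ℂ => t ^ (l + 1) := by
    intro q
    obtain ⟨B, hB⟩ := hFb i q
    refine IsBigO.trans (IsBigO.of_bound (4 * B / R₁) ?_) hjetO
    filter_upwards [hevτ, hevP] with t ht htP
    exact norm_sub_le_of_cauchyDomain hR₁ (hF i q) hB ((mem_ball_zero_iff.1 hx).trans_le hr)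
      (hj t ht x hx) htP
  have hev1 : ∀ᶠ t : ℂ in 𝓝[≠] 0, ‖t‖ ≤ 1 := by
    filter_upwards [nhdsWithin_le_nhds (ball_mem_nhds (0 : ℂ) zero_lt_one)]
      with t ht using (mem_ball_zero_iff.1 ht).le
  have hO : (fun t => deriv (fun t => h i t x) t - truncRhs (F i) c l t x)
      =O[𝓝[≠] 0] fun t : ℂ => t ^ (l + 1) := by
    -- Here `l + 1 ≤ N`, so every term through order `l` occurs in the truncated problem; its
    -- remaining terms carry a factor `t ^ (l + 1)`.
    have h1 : (fun t => ∑ q ∈ Finset.range (l + 1), t ^ q *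
          (F i q (cauchyJet (fun i => h i t) x) -
            F i q (cauchyJet (fun i => truncSeries c l i t) x)) +
        ∑ q ∈ Finset.Ico (l + 1) N, F i q (cauchyJet (fun i => h i t) x) * t ^ q)
        =O[𝓝[≠] 0] fun t : ℂ => t ^ (l + 1) := by
      refine IsBigO.add (IsBigO.fun_sum fun q _ => ?_) (IsBigO.fun_sum fun q hq => ?_)
      · refine IsBigO.trans (IsBigO.of_bound 1 ?_) (hFO q)
        filter_upwards [hev1] with t ht
        rw [norm_mul, norm_pow]
        gcongr
        exact pow_le_one₀ (norm_nonneg _) ht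
      · obtain ⟨B, hB⟩ := hFb i q
        refine IsBigO.of_bound B ?_
        filter_upwards [hev1, hevτ] with t ht htτ
        have hmem : cauchyJet (fun i => h i t) x ∈ cauchyDomain m n R₀ R₁ :=
          mem_cauchyDomain_iff.2 ⟨(mem_ball_zero_iff.1 hx).trans_le hr,
            (hj t htτ x hx).trans_lt (half_lt_self hR₁)⟩
        have hB0 : 0 ≤ B := (norm_nonneg _).trans (hB _ hmem)
        rw [norm_mul, norm_pow, norm_pow]
        exact mul_le_mul (hB _ hmem)
          (pow_le_pow_of_le_one (norm_nonneg _) ht (Finset.mem_Ico.1 hq).1) (by positivity) hB0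
    refine h1.congr' ?_ EventuallyEq.rfl
    filter_upwards [hevτ, self_mem_nhdsWithin] with t ht ht0
    rw [heq i t ht ht0 x hx, truncRhs, Finset.range_eq_Ico, Finset.range_eq_Ico,
      ← Finset.sum_Ico_consecutive _ (Nat.zero_le (l + 1)) hl, add_sub_right_comm,
      ← Finset.sum_sub_distrib]
    congr 1
    refine Finset.sum_congr rfl fun q _ => ?_
    ring
  obtain ⟨D, hD, hmemD, hdiffD⟩ := exists_isOpen_truncRhs hR₁ hr (hF i) hcd hc0 l
  have han1 : AnalyticAt ℂ (deriv fun t => h i t x) 0 :=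
    ((hslice i x hx).analyticAt (ball_mem_nhds 0 hτ)).deriv
  have han2 : AnalyticAt ℂ (fun t => truncRhs (F i) c l t x) 0 := by
    have hcont : Continuous fun t : ℂ => (t, x) := by fun_prop
    refine DifferentiableOn.analyticAt (s := (fun t : ℂ => (t, x)) ⁻¹' D) ?_
      ((hD.preimage hcont).mem_nhds (hmemD x hx))
    exact hdiffD.comp (f := fun t : ℂ => (t, x))
      (differentiableOn_id.prodMk (differentiableOn_const x)) fun t ht => ht
  have hmain := iteratedDeriv_eq_of_isBigO han1 han2 hO
  have h1 := hc.equation i l x (ball_subset_ball hr hx)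
  rw [formalRhsCoeff_eq fun i j => (hcd i j).differentiableAt (isOpen_ball.mem_nhds hx),
    ← hmain, ← iteratedDeriv_succ'] at h1
  have h2 : (l : ℂ) + 1 ≠ 0 := Nat.cast_add_one_ne_zero l
  have h3 : (l.factorial : ℂ) ≠ 0 := by exact_mod_cast l.factorial_ne_zero
  refine mul_left_cancel₀ h2 ?_
  rw [h1, Nat.factorial_succ]
  push_cast
  field_simp

end TaylorFormal

/-! ### Sectors and discs as radial domains. -/

section Domains

theorem DifferentiableOn.slice_fst {n : ℕ} {D : Set (ℂ × (Fin n → ℂ))} (hD : IsOpen D)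
    {u : ℂ → (Fin n → ℂ) → ℂ} (hu : DifferentiableOn ℂ (fun p : ℂ × (Fin n → ℂ) => u p.1 p.2) D)
    {p : ℂ × (Fin n → ℂ)} (hp : p ∈ D) : DifferentiableAt ℂ (fun t => u t p.2) p.1 := by
  have h1 : DifferentiableAt ℂ (fun p : ℂ × (Fin n → ℂ) => u p.1 p.2) (p.1, p.2) :=
    hu.differentiableAt (hD.mem_nhds hp)
  have h2 : DifferentiableAt ℂ (fun t : ℂ => (t, p.2)) p.1 :=
    differentiableAt_id.prodMk (differentiableAt_const _)
  exact h1.comp p.1 h2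

variable {a b : ℝ} {ρ : ℝ → ℝ}

theorem isOpen_sector (hρ : IsRadius a b ρ) : IsOpen (sector a b ρ) := by
  have h1 : IsOpen (Complex.im ⁻¹' Ioo a b) := isOpen_Ioo.preimage Complex.continuous_im
  have h2 : ContinuousOn (fun z : ℂ => Real.exp z.re - ρ z.im) (Complex.im ⁻¹' Ioo a b) :=
    (Real.continuous_exp.comp Complex.continuous_re).continuousOn.sub
      (hρ.continuousOn.comp Complex.continuous_im.continuousOn fun z hz => hz)
  have h3 := h2.isOpen_inter_preimage h1 (isOpen_Iio (a := (0 : ℝ)))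
  convert h3 using 1
  ext z
  simp [sector]

theorem isRadialDomain_sector (hρ : IsRadius a b ρ) :
    IsRadialDomain (sector a b ρ) (fun s z => z + (Real.log s : ℂ)) Complex.exp where
  isOpen := isOpen_sector hρ
  mem s hs z hz := by
    have him : (z + (Real.log s : ℂ)).im = z.im := by simp
    have hre : (z + (Real.log s : ℂ)).re = z.re + Real.log s := by simp
    refine ⟨by rw [him]; exact hz.1, ?_⟩
    rw [him, hre]
    refine lt_of_le_of_lt ?_ hz.2
    gcongr
    linarith [Real.log_nonpos hs.1.le hs.2]
  differentiableOn_act s _ := by fun_prop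
  differentiableOn_coe := Complex.differentiable_exp.differentiableOn
  coe_act s hs z _ := by
    rw [Complex.exp_add, ← Complex.ofReal_exp, Real.exp_log hs.1, mul_comm]
  act_act s hs s' hs' z _ := by
    rw [Real.log_mul hs.1.ne' hs'.1.ne']
    push_cast
    ring
  act_one z _ := by simp
  continuousOn_act z _ := by
    refine continuousOn_const.add (Complex.continuous_ofReal.comp_continuousOn ?_)
    exact Real.continuousOn_log.mono fun s hs => hs.1.ne'

theorem isRadialDomain_ball (τ : ℝ) :
    IsRadialDomain (ball 0 τ) (fun s t => (s : ℂ) * t) id where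
  isOpen := isOpen_ball
  mem s hs t ht := by
    rw [mem_ball_zero_iff] at ht ⊢
    rw [norm_mul, Complex.norm_real, Real.norm_of_nonneg hs.1.le]
    exact (mul_le_of_le_one_left (norm_nonneg t) hs.2).trans_lt ht
  differentiableOn_act s _ := by fun_prop
  differentiableOn_coe := differentiable_id.differentiableOn
  coe_act s _ t _ := rfl
  act_act s _ s' _ t _ := by push_cast; ring
  act_one t _ := by simp
  continuousOn_act t _ := by fun_prop

/-- The point of argument `θ` and modulus `s`. -/
theorem ray_mem_sector {θ s : ℝ} (hθ : θ ∈ Ioo a b) (hs : s ∈ Ioo 0 (ρ θ)) :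
    (Real.log s : ℂ) + (θ : ℂ) * Complex.I ∈ sector a b ρ := by
  have him : ((Real.log s : ℂ) + (θ : ℂ) * Complex.I).im = θ := by simp
  have hre : ((Real.log s : ℂ) + (θ : ℂ) * Complex.I).re = Real.log s := by simp
  refine ⟨by rw [him]; exact hθ, ?_⟩
  rw [him, hre, Real.exp_log hs.1]
  exact hs.2

theorem exp_ray {θ s : ℝ} (hs : 0 < s) :
    Complex.exp ((Real.log s : ℂ) + (θ : ℂ) * Complex.I) =
      s * Complex.exp ((θ : ℂ) * Complex.I) := by
  rw [Complex.exp_add, ← Complex.ofReal_exp, Real.exp_log hs]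

theorem norm_le_of_jetPart {m n : ℕ} {g : Fin m → (Fin n → ℂ) → ℂ} {x : Fin n → ℂ} {K : ℝ}
    (h : ‖jetPart g x‖ ≤ K) (i : Fin m) : ‖g i x‖ ≤ K :=
  (norm_le_pi_norm (fun i => g i x) i).trans ((norm_fst_le (jetPart g x)).trans h)

end Domains

/-! ### Log-convexity of the Gamma factors. -/

section GammaFactor

theorem Gamma_factor_pos {k : ℝ} (hk : 0 < k) (N : ℕ) : 0 < Real.Gamma (N / k + 1) :=
  Real.Gamma_pos_of_pos (by positivity)

/-- The point `l / k + 1` divides the segment from `1` to `N / k + 1` in the ratio given by `l / N`;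
`log ∘ Γ` is convex and vanishes at `1`. This replaces Gevrey growth by geometric growth up to order
`N`. -/
theorem Gamma_factor_le_pow {k : ℝ} (hk : 0 < k) {l N : ℕ} (hN : N ≠ 0) (hl : l ≤ N) :
    Real.Gamma (l / k + 1) ≤ (Real.Gamma (N / k + 1) ^ (1 / N : ℝ)) ^ l := by
  have hN0 : (0 : ℝ) < N := by exact_mod_cast Nat.pos_of_ne_zero hN
  have hg := Gamma_factor_pos hk N
  have hl' : (l : ℝ) ≤ N := by exact_mod_cast hl
  have hw : (l : ℝ) / N ≤ 1 := (div_le_one hN0).2 hl'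
  have hy : (N : ℝ) / k + 1 ∈ Ioi (0 : ℝ) := by
    rw [mem_Ioi]
    positivity
  have h1 := Real.convexOn_log_Gamma.2 (mem_Ioi.2 (zero_lt_one (α := ℝ))) hy
    (sub_nonneg.2 hw) (show (0 : ℝ) ≤ l / N by positivity) (sub_add_cancel 1 _)
  have h2 : (1 - (l : ℝ) / N) • (1 : ℝ) + ((l : ℝ) / N) • ((N : ℝ) / k + 1) = l / k + 1 := by
    simp only [smul_eq_mul]
    field_simp
    ring
  rw [h2] at h1
  simp only [Function.comp_apply, Real.Gamma_one, Real.log_one, smul_eq_mul] at h1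
  rw [← Real.rpow_natCast, ← Real.rpow_mul hg.le, Real.rpow_def_of_pos hg,
    ← Real.log_le_iff_le_exp (Gamma_factor_pos hk l)]
  refine h1.trans_eq ?_
  ring

end GammaFactor

/-! ### Consequences of the Borel bounds. -/

section Bounds

variable {m n : ℕ} {k a b R₀ R₁ : ℝ} {ρ : ℝ → ℝ}
  {f : Fin m → ℂ → CauchyVar m n → ℂ} {F : Fin m → ℕ → CauchyVar m n → ℂ}

theorem exists_uniform_borel_bound (hk : 0 < k) {E : Type*} [NormedAddCommGroup E]
    [NormedSpace ℂ E] {Ω : Set E} {f : Fin m → ℂ → E → ℂ} {F : Fin m → ℕ → E → ℂ}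
    (hf : ∀ i, HasBorelExpansion k a b ρ Ω (f i) (F i)) :
    ∃ M > 0, ∃ C > 0, ∀ i, ∀ N : ℕ, ∀ z ∈ sector a b ρ, ∀ Y ∈ Ω,
      ‖f i z Y - ∑ l ∈ Finset.range N, F i l Y * Complex.exp z ^ l‖
        ≤ M * C ^ N * Real.exp z.re ^ N * Real.Gamma (N / k + 1) := by
  choose M hM C hC h using fun i => (hf i).bound
  have hsum : ∀ (g : Fin m → ℝ), (∀ i, g i > 0) → ∀ i, g i ≤ 1 + ∑ j, g j := fun g hg i => by
    have := Finset.single_le_sum (f := g) (fun j _ => (hg j).le) (Finset.mem_univ i)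
    linarith
  have hpos : ∀ (g : Fin m → ℝ), (∀ i, g i > 0) → 0 < 1 + ∑ j, g j := fun g hg => by
    have := Finset.sum_nonneg (s := Finset.univ) (f := g) fun j _ => (hg j).le
    linarith
  refine ⟨1 + ∑ j, M j, hpos M hM, 1 + ∑ j, C j, hpos C hC, fun i N z hz Y hY =>
    (h i N z hz Y hY).trans ?_⟩
  have h1 := Gamma_factor_pos hk N
  have h2 := hM i
  have h3 := hC i
  have h4 := hsum M hM i
  have h5 := hsum C hC i
  have h6 := (hpos M hM).le
  gcongr

/-- The term of order `N` is the difference of two consecutive remainders; divide by `t ^ N` and let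
`t → 0` on a single ray. -/
theorem norm_coeff_le_of_borel_bound {E : Type*} (hab : a < b) (hρ : IsRadius a b ρ) {Ω : Set E}
    {φ : ℂ → E → ℂ} {c : ℕ → E → ℂ} {B : ℕ → ℝ}
    (h : ∀ N : ℕ, ∀ z ∈ sector a b ρ, ∀ Y ∈ Ω,
      ‖φ z Y - ∑ l ∈ Finset.range N, c l Y * Complex.exp z ^ l‖ ≤ B N * Real.exp z.re ^ N)
    (N : ℕ) {Y : E} (hY : Y ∈ Ω) : ‖c N Y‖ ≤ B N := by
  obtain ⟨θ, hθ⟩ := exists_between hab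
  have hθ' : θ ∈ Ioo a b := hθ
  have key : ∀ s ∈ Ioo 0 (ρ θ), ‖c N Y‖ ≤ B N + B (N + 1) * s := by
    intro s hs
    have hz := ray_mem_sector (ρ := ρ) hθ' hs
    set z := (Real.log s : ℂ) + (θ : ℂ) * Complex.I with hzdef
    have hre : Real.exp z.re = s := by
      rw [hzdef]
      simp [Real.exp_log hs.1]
    have h1 := h N z hz Y hY
    have h2 := h (N + 1) z hz Y hY
    rw [hre] at h1 h2
    have h3 : c N Y * Complex.exp z ^ N =
        (φ z Y - ∑ l ∈ Finset.range N, c l Y * Complex.exp z ^ l) -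
        (φ z Y - ∑ l ∈ Finset.range (N + 1), c l Y * Complex.exp z ^ l) := by
      rw [Finset.sum_range_succ]
      ring
    have h4 : ‖c N Y * Complex.exp z ^ N‖ = ‖c N Y‖ * s ^ N := by
      rw [norm_mul, norm_pow, Complex.norm_exp, hre]
    have h5 : ‖c N Y‖ * s ^ N ≤ (B N + B (N + 1) * s) * s ^ N := by
      rw [← h4, h3]
      refine (norm_sub_le _ _).trans ((add_le_add h1 h2).trans_eq ?_)
      ring
    exact le_of_mul_le_mul_right h5 (pow_pos hs.1 N)
  have hlim : Tendsto (fun s => B N + B (N + 1) * s) (𝓝[>] 0) (𝓝 (B N + B (N + 1) * 0)) :=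
    Tendsto.mono_left (Continuous.tendsto (by fun_prop) 0) nhdsWithin_le_nhds
  rw [mul_zero, add_zero] at hlim
  refine ge_of_tendsto hlim ?_
  filter_upwards [Ioo_mem_nhdsGT (hρ.pos θ hθ')] with s hs using key s hs

theorem isBoundedRhs_of_borel (hf : ∀ i, HasBorelExpansion k a b ρ (cauchyDomain m n R₀ R₁) (f i) (F i))
    {M C : ℝ} (hb : ∀ i, ∀ N : ℕ, ∀ z ∈ sector a b ρ, ∀ Y ∈ cauchyDomain m n R₀ R₁,
      ‖f i z Y - ∑ l ∈ Finset.range N, F i l Y * Complex.exp z ^ l‖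
        ≤ M * C ^ N * Real.exp z.re ^ N * Real.Gamma (N / k + 1)) :
    IsBoundedRhs (sector a b ρ) R₀ R₁ M f where
  holomorphic i := (hf i).holomorphic
  norm_le i z hz Y hY := by simpa using hb i 0 z hz Y hY

theorem IsBoundedRhs.mono {T T' : Set ℂ} {M : ℝ} (hf : IsBoundedRhs T R₀ R₁ M f) (h : T' ⊆ T) :
    IsBoundedRhs T' R₀ R₁ M f where
  holomorphic i := (hf.holomorphic i).mono (prod_mono h subset_rfl)
  norm_le i z hz := hf.norm_le i z (h hz)

theorem sector_mono {ρ' : ℝ → ℝ} {a' b' : ℝ} (ha : a ≤ a') (hb : b' ≤ b)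
    (h : ∀ θ ∈ Ioo a' b', ρ' θ ≤ ρ θ) : sector a' b' ρ' ⊆ sector a b ρ := fun _ hz =>
  ⟨⟨ha.trans_lt hz.1.1, hz.1.2.trans_le hb⟩, hz.2.trans_le (h _ hz.1)⟩

end Bounds

/-! ### Solutions along a ray. -/

section RaySolutions

variable {m n : ℕ} {a b R₀ R₁ M r : ℝ} {ρ ρ' : ℝ → ℝ} {f : Fin m → ℂ → CauchyVar m n → ℂ}

theorem IsCauchySolution.isRaySolution (hρ' : IsRadius a b ρ')
    {U : Fin m → ℂ → (Fin n → ℂ) → ℂ} (hU : IsCauchySolution a b R₀ R₁ f ρ' r U) {θ : ℝ}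
    (hθ : θ ∈ Ioo a b) :
    IsRaySolution R₀ R₁ f θ (ρ' θ) r
      (fun i s => U i ((Real.log s : ℂ) + (θ : ℂ) * Complex.I)) where
  holomorphic i s hs x hx := by
    have hz := ray_mem_sector (ρ := ρ') hθ hs
    exact ((hU.holomorphic i).slice ((isOpen_sector hρ').prod isOpen_ball)
      (p := (_, x)) ⟨hz, hx⟩).differentiableWithinAt
  mem_domain s hs := hU.mem_domain _ (ray_mem_sector hθ hs)
  equation i s hs x hx := by
    have hz := ray_mem_sector (ρ := ρ') hθ hs
    have heq := hU.equation i _ hz x hx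
    have hdiff := (hU.holomorphic i).slice_fst ((isOpen_sector hρ').prod isOpen_ball)
      (p := ((Real.log s : ℂ) + (θ : ℂ) * Complex.I, x)) ⟨hz, hx⟩
    have hlog₀ : HasDerivAt (fun σ : ℝ => (Real.log σ : ℂ)) ((s⁻¹ : ℝ) : ℂ) s :=
      HasDerivAt.ofReal_comp (Real.hasDerivAt_log hs.1.ne')
    have hlog : HasDerivAt (fun σ : ℝ => (Real.log σ : ℂ) + (θ : ℂ) * Complex.I)
        ((s⁻¹ : ℝ) : ℂ) s := hlog₀.add_const ((θ : ℂ) * Complex.I)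
    have hcomp := HasDerivAt.comp (h₂ := fun ζ => U i ζ x) s hdiff.hasDerivAt hlog
    refine hcomp.congr_deriv ?_
    rw [← heq, tDeriv, Complex.exp_neg, exp_ray hs.1]
    have h1 : (s : ℂ) ≠ 0 := by exact_mod_cast hs.1.ne'
    have h2 := Complex.exp_ne_zero ((θ : ℂ) * Complex.I)
    push_cast
    field_simp
  initial i x hx := (hU.initial i θ hθ x hx).comp Real.tendsto_log_nhdsGT_zero

theorem IsRaySolution.norm_le (hf : IsBoundedRhs (sector a b ρ) R₀ R₁ M f) {θ s₀ : ℝ}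
    (hθ : θ ∈ Ioo a b) (hs₀ : s₀ ≤ ρ θ) {v : Fin m → ℝ → (Fin n → ℂ) → ℂ}
    (hv : IsRaySolution R₀ R₁ f θ s₀ r v) (hM : 0 ≤ M) (i : Fin m) {s : ℝ} (hs : s ∈ Ioo 0 s₀)
    {x : Fin n → ℂ} (hx : x ∈ ball (0 : Fin n → ℂ) r) : ‖v i s x‖ ≤ M * s := by
  have hmem : ∀ σ ∈ Ioc 0 s, σ ∈ Ioo 0 s₀ := fun σ hσ => ⟨hσ.1, hσ.2.trans_lt hs.2⟩
  have := norm_le_of_ray_deriv_bound (v := fun σ => v i σ x) (a := 0) (b := M) (c := 0) (d := 1)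
    hs.1 le_rfl hM le_rfl (by simp)
    (fun σ hσ => (hv.equation i σ (hmem σ hσ) x hx).continuousAt.continuousWithinAt)
    (fun σ hσ => hv.equation i σ (hmem σ ⟨hσ.1, hσ.2.le⟩) x hx) (fun σ hσ => ?_) (hv.initial i x hx)
  · simpa using this
  · have hσ' := hmem σ ⟨hσ.1, hσ.2.le⟩
    rw [norm_mul, Complex.norm_exp_ofReal_mul_I, one_mul, zero_mul, zero_div, zero_add]
    exact hf.norm_le i _ (ray_mem_sector hθ ⟨hσ'.1, hσ'.2.trans_le hs₀⟩) _
      (hv.mem_domain σ hσ' x hx)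

/-- Being a solution only puts the jets below `R₁`. Since `v` is `O(s)`, Cauchy's estimate brings
them below `R₁ / 2` for small `s`, where the Lipschitz bound is available. -/
theorem IsRaySolution.norm_jetPart_le (hf : IsBoundedRhs (sector a b ρ) R₀ R₁ M f) {θ s₀ : ℝ}
    (hθ : θ ∈ Ioo a b) (hs₀ : s₀ ≤ ρ θ) {v : Fin m → ℝ → (Fin n → ℂ) → ℂ}
    (hv : IsRaySolution R₀ R₁ f θ s₀ r v) (hM : 0 ≤ M) {s δ : ℝ} (hs : s ∈ Ioo 0 s₀) (hδ : 0 < δ)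
    {x : Fin n → ℂ} (hx : ‖x‖ + δ ≤ r) :
    ‖jetPart (fun i => v i s) x‖ ≤ M * s * (1 + 2 / δ) := by
  have hsub : ball x δ ⊆ ball 0 r := ball_subset_ball' (by rw [dist_zero_right]; linarith)
  exact _root_.norm_jetPart_le hδ (mul_nonneg hM hs.1.le)
    (fun i => (hv.holomorphic i s hs).mono hsub)
    fun i y hy => hv.norm_le hf hθ hs₀ hM i hs (hsub hy)

/-- Comparison of solutions of two Cauchy problems along a ray. -/
theorem norm_sub_le_of_ray_problems (hf : IsBoundedRhs (sector a b ρ) R₀ R₁ M f) (hM : 0 < M)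
    (hR₁ : 0 < R₁) (hr0 : 0 < r) (hr : r ≤ R₀) {θ s₀ A : ℝ} {N : ℕ} (hA : 0 ≤ A)
    (hθ : θ ∈ Ioo a b) (hs₀ : s₀ ≤ ρ θ) {φ : Fin m → ℝ → CauchyVar m n → ℂ}
    (hφ : ∀ i, ∀ s ∈ Ioo 0 s₀, ∀ Y ∈ cauchyDomain m n R₀ R₁,
      ‖f i ((Real.log s : ℂ) + (θ : ℂ) * Complex.I) Y - φ i s Y‖ ≤ A * s ^ N)
    {v w : Fin m → ℝ → (Fin n → ℂ) → ℂ}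
    (hv : ∀ i, ∀ s ∈ Ioo 0 s₀, DifferentiableOn ℂ (v i s) (ball 0 r))
    (hw : ∀ i, ∀ s ∈ Ioo 0 s₀, DifferentiableOn ℂ (w i s) (ball 0 r))
    (hvj : ∀ s ∈ Ioo 0 s₀, ∀ x ∈ ball (0 : Fin n → ℂ) r, ‖jetPart (fun i => v i s) x‖ ≤ R₁ / 2)
    (hwj : ∀ s ∈ Ioo 0 s₀, ∀ x ∈ ball (0 : Fin n → ℂ) r, ‖jetPart (fun i => w i s) x‖ ≤ R₁ / 2)
    (hvd : ∀ i, ∀ s ∈ Ioo 0 s₀, ∀ x ∈ ball (0 : Fin n → ℂ) r, HasDerivAt (fun σ => v i σ x)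
      (Complex.exp ((θ : ℂ) * Complex.I) * f i ((Real.log s : ℂ) + (θ : ℂ) * Complex.I)
        (cauchyJet (fun i' => v i' s) x)) s)
    (hwd : ∀ i, ∀ s ∈ Ioo 0 s₀, ∀ x ∈ ball (0 : Fin n → ℂ) r, HasDerivAt (fun σ => w i σ x)
      (Complex.exp ((θ : ℂ) * Complex.I) * φ i s (cauchyJet (fun i' => w i' s) x)) s)
    (hv0 : ∀ i, ∀ x ∈ ball (0 : Fin n → ℂ) r, Tendsto (fun s => v i s x) (𝓝[>] 0) (𝓝 0))
    (hw0 : ∀ i, ∀ x ∈ ball (0 : Fin n → ℂ) r, Tendsto (fun s => w i s x) (𝓝[>] 0) (𝓝 0))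
    (i : Fin m) {s : ℝ} (hs : s ∈ Ioo 0 s₀) {x : Fin n → ℂ}
    (hx : ‖x‖ + 2 * (4 * M / R₁) * (2 * r + 8) * s < r) :
    ‖v i s x - w i s x‖ ≤
      2 * A * r * s ^ (N + 1) / (r - ‖x‖ - 2 * (4 * M / R₁) * (2 * r + 8) * s) := by
  refine norm_le_of_nagumo (K := R₁) (w := fun i s x => v i s x - w i s x) hr0 (by positivity) hA
    (fun i s hs => (hv i s hs).sub (hw i s hs)) (fun i s hs x hx => ?_)
    (fun i s hs x hx => (hvd i s hs x hx).sub (hwd i s hs x hx)) (fun i s hs x hx => ?_)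
    (fun i x hx => by simpa using (hv0 i x hx).sub (hw0 i x hx)) i hs hx
  · have h1 := norm_le_of_jetPart (hvj s hs x hx) i
    have h2 := norm_le_of_jetPart (hwj s hs x hx) i
    linarith [norm_sub_le (v i s x) (w i s x)]
  · have hz := ray_mem_sector (ρ := ρ) hθ ⟨hs.1, hs.2.trans_le hs₀⟩
    have hxR := (mem_ball_zero_iff.1 hx).trans_le hr
    rw [← mul_sub, norm_mul, Complex.norm_exp_ofReal_mul_I, one_mul,
      jetPart_sub (fun i => (hv i s hs).differentiableAt (isOpen_ball.mem_nhds hx))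
        fun i => (hw i s hs).differentiableAt (isOpen_ball.mem_nhds hx)]
    -- The value of `f` on the jet of `w` is inserted: the Lipschitz bound is used for `f` alone,
    -- and `φ` enters only through its distance from `f`.
    have h1 := norm_sub_le_of_cauchyDomain hR₁ (hf.slice i hz) (hf.norm_le i _ hz) hxR
      (hvj s hs x hx) (hwj s hs x hx)
    have h2 := hφ i s hs (cauchyJet (fun i => w i s) x)
      (mem_cauchyDomain_iff.2 ⟨hxR, (hwj s hs x hx).trans_lt (half_lt_self hR₁)⟩)
    refine (norm_sub_le_norm_sub_add_norm_sub _ _ _).trans (add_le_add h1 h2)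

theorem IsRaySolution.eventually_eq (hf : IsBoundedRhs (sector a b ρ) R₀ R₁ M f) (hM : 0 < M)
    (hR₁ : 0 < R₁) {θ s₀ s₀' r r' : ℝ} (hθ : θ ∈ Ioo a b) (hs₀ : 0 < s₀) (hs₀ρ : s₀ ≤ ρ θ)
    (hs₀' : 0 < s₀') (hs₀ρ' : s₀' ≤ ρ θ) (hr0 : 0 < r) (hr : r ≤ R₀) (hr0' : 0 < r')
    {v w : Fin m → ℝ → (Fin n → ℂ) → ℂ} (hv : IsRaySolution R₀ R₁ f θ s₀ r v)
    (hw : IsRaySolution R₀ R₁ f θ s₀' r' w) :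
    ∃ s₁ > 0, ∀ i, ∀ s ∈ Ioo 0 s₁, ∀ x ∈ ball (0 : Fin n → ℂ) s₁, v i s x = w i s x := by
  set r₁ := min r r' / 2 with hr₁
  have hr₁0 : 0 < r₁ := by positivity
  have hr₁r : r₁ + r₁ ≤ r := by rw [hr₁]; linarith [min_le_left r r']
  have hr₁r' : r₁ + r₁ ≤ r' := by rw [hr₁]; linarith [min_le_right r r']
  set κ := 2 * (4 * M / R₁) * (2 * r₁ + 8) with hκ
  have hκ0 : 0 < κ := by positivity
  set σ := min (min s₀ s₀') (R₁ / 2 / (M * (1 + 2 / r₁))) with hσ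
  have hD : 0 < M * (1 + 2 / r₁) := by positivity
  have hσ0 : 0 < σ := by positivity
  have hσs : ∀ s ∈ Ioo 0 σ, s ∈ Ioo 0 s₀ ∧ s ∈ Ioo 0 s₀' ∧ M * s * (1 + 2 / r₁) ≤ R₁ / 2 := by
    intro s hs
    refine ⟨⟨hs.1, hs.2.trans_le ((min_le_left _ _).trans (min_le_left _ _))⟩,
      ⟨hs.1, hs.2.trans_le ((min_le_left _ _).trans (min_le_right _ _))⟩, ?_⟩
    have := hs.2.trans_le (min_le_right _ _)
    rw [lt_div_iff₀ hD] at this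
    linarith
  -- If `‖x‖` and `s` are both below `r₁ / (1 + κ)`, then `‖x‖ + κ * s < r₁`, the cone of the
  -- comparison estimate, applied here with defect `A = 0`.
  refine ⟨min σ (r₁ / (1 + κ)), by positivity, fun i s hs x hx => ?_⟩
  have hs' : s ∈ Ioo 0 σ := ⟨hs.1, hs.2.trans_le (min_le_left _ _)⟩
  have hbs : s < r₁ / (1 + κ) := hs.2.trans_le (min_le_right _ _)
  have hbx : ‖x‖ < r₁ / (1 + κ) := (mem_ball_zero_iff.1 hx).trans_le (min_le_right _ _)
  have hlt : ‖x‖ + κ * s < r₁ := by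
    have h1 : r₁ / (1 + κ) + κ * (r₁ / (1 + κ)) = r₁ := by field_simp
    have h2 := mul_lt_mul_of_pos_left hbs hκ0
    linarith
  have hsub : ball (0 : Fin n → ℂ) r₁ ⊆ ball 0 r := ball_subset_ball (by linarith)
  have hsub' : ball (0 : Fin n → ℂ) r₁ ⊆ ball 0 r' := ball_subset_ball (by linarith)
  have := norm_sub_le_of_ray_problems hf hM hR₁ hr₁0 (by linarith) (A := 0) (N := 0) le_rfl hθ
    (s₀ := σ) (((min_le_left _ _).trans (min_le_left _ _)).trans hs₀ρ)
    (φ := fun i s => f i ((Real.log s : ℂ) + (θ : ℂ) * Complex.I)) (by simp)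
    (fun i s hs => (hv.holomorphic i s (hσs s hs).1).mono hsub)
    (fun i s hs => (hw.holomorphic i s (hσs s hs).2.1).mono hsub')
    (fun s hs x hx => (hv.norm_jetPart_le hf hθ hs₀ρ hM.le (hσs s hs).1 hr₁0
      (by linarith [mem_ball_zero_iff.1 hx])).trans (hσs s hs).2.2)
    (fun s hs x hx => (hw.norm_jetPart_le hf hθ hs₀ρ' hM.le (hσs s hs).2.1 hr₁0
      (by linarith [mem_ball_zero_iff.1 hx])).trans (hσs s hs).2.2)
    (fun i s hs x hx => hv.equation i s (hσs s hs).1 x (hsub hx))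
    (fun i s hs x hx => hw.equation i s (hσs s hs).2.1 x (hsub' hx))
    (fun i x hx => hv.initial i x (hsub hx)) (fun i x hx => hw.initial i x (hsub' hx)) i hs' hlt
  rw [mul_zero, zero_mul, zero_mul, zero_div] at this
  exact sub_eq_zero.1 (norm_le_zero_iff.1 this)

end RaySolutions

/-! ### Existence on sectors and on discs. -/

section Solutions

variable {m n : ℕ} {a b R₀ R₁ M : ℝ} {ρ : ℝ → ℝ} {f : Fin m → ℂ → CauchyVar m n → ℂ}

theorem exists_isCauchySolution (hρ : IsRadius a b ρ) (hf : IsBoundedRhs (sector a b ρ) R₀ R₁ M f)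
    (hM : 0 < M) (hR₀ : 0 < R₀) (hR₁ : 0 < R₁) :
    ∃ (ρ' : ℝ → ℝ) (r : ℝ) (U : Fin m → ℂ → (Fin n → ℂ) → ℂ),
      IsRadius a b ρ' ∧ (∀ θ ∈ Ioo a b, ρ' θ ≤ ρ θ) ∧ 0 < r ∧ r ≤ R₀ ∧
      IsCauchySolution a b R₀ R₁ f ρ' r U := by
  set κ := 64 * M / R₁ * (2 * R₀ + 8) with hκ
  have hκ0 : 0 < κ := by positivity
  -- With this radius `κ * |t| < R₀ / 4`, so the product with the ball of radius `R₀ / 4` lies in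
  -- the cone of radius `R₀ / 2`.
  set τ := R₀ / (4 * κ) with hτ
  have hτ0 : 0 < τ := by positivity
  have hρ' : IsRadius a b fun θ => min (ρ θ) τ :=
    ⟨hρ.continuousOn.inf continuousOn_const, fun θ hθ => lt_min (hρ.pos θ hθ) hτ0⟩
  have hle : ∀ θ ∈ Ioo a b, min (ρ θ) τ ≤ ρ θ := fun θ _ => min_le_left _ _
  have hT := isRadialDomain_sector hρ'
  have hf' : IsBoundedRhs (sector a b fun θ => min (ρ θ) τ) R₀ R₁ M f :=
    hf.mono (sector_mono le_rfl le_rfl hle)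
  obtain ⟨u, hu, hub, hud⟩ := exists_solution_of_isRadialDomain hT hf' hM hR₁ hR₀ le_rfl hκ
  have hcone : (sector a b fun θ => min (ρ θ) τ) ×ˢ ball (0 : Fin n → ℂ) (R₀ / 4) ⊆
      radialCone n (sector a b fun θ => min (ρ θ) τ) Complex.exp κ (R₀ / 2) := by
    rintro ⟨z, x⟩ ⟨hz, hx⟩
    refine ⟨hz, ?_⟩
    have h1 : Real.exp z.re < τ := hz.2.trans_le (min_le_right _ _)
    have h2 := mul_lt_mul_of_pos_left h1 hκ0
    have h3 : κ * τ = R₀ / 4 := by rw [hτ]; field_simp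
    have h4 := mem_ball_zero_iff.1 hx
    dsimp only at h4 ⊢
    rw [Complex.norm_exp]
    linarith
  refine ⟨_, R₀ / 4, u, hρ', hle, by positivity, by linarith, ?_, ?_, ?_, ?_⟩
  · exact fun i => (hu.holomorphic i).mono hcone
  · exact fun z hz x hx => hu.jet_mem hκ0.le (by linarith) hR₁ (p := (z, x)) (hcone ⟨hz, hx⟩)
  · intro i z hz x hx
    have hq : (z, x) ∈ radialCone n (sector a b fun θ => min (ρ θ) τ) Complex.exp κ (R₀ / 2) :=
      hcone ⟨hz, hx⟩
    -- The radial derivative is known only for contraction factors strictly between `0` and `1`. So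
    -- `z` is written as a contraction of the slightly larger point `z + η`, which still lies in the
    -- open cone.
    have hcont : ContinuousAt (fun η : ℝ => (z + (η : ℂ), x)) 0 := by fun_prop
    have hev : ∀ᶠ η : ℝ in 𝓝[>] 0, (z + (η : ℂ), x) ∈
        radialCone n (sector a b fun θ => min (ρ θ) τ) Complex.exp κ (R₀ / 2) :=
      nhdsWithin_le_nhds (hcont.eventually_mem
        (by simpa using hT.isOpen_cone.mem_nhds hq))
    obtain ⟨η, hη, hη0⟩ := (hev.and self_mem_nhdsWithin).exists
    have hη0' : (0 : ℝ) < η := hη0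
    have hs : Real.exp (-η) ∈ Ioo (0 : ℝ) 1 := ⟨Real.exp_pos _, by rw [← Real.exp_zero]; exact Real.exp_lt_exp.2 (by linarith)⟩
    have h1 := hud i _ hη _ hs
    have hzz : z + (η : ℂ) + (Real.log (Real.exp (-η)) : ℂ) = z := by
      rw [Real.log_exp]
      push_cast
      ring
    have hlog₀ : HasDerivAt (fun σ : ℝ => (Real.log σ : ℂ))
        (((Real.exp (-η))⁻¹ : ℝ) : ℂ) (Real.exp (-η)) :=
      HasDerivAt.ofReal_comp (Real.hasDerivAt_log hs.1.ne')
    have hlog := hlog₀.const_add (z + (η : ℂ))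
    have hdiff : HasDerivAt (fun ζ => u i ζ x) (deriv (fun ζ => u i ζ x) z)
        (z + (η : ℂ) + (Real.log (Real.exp (-η)) : ℂ)) := by
      rw [hzz]
      exact ((hu.holomorphic i).slice_fst hT.isOpen_cone hq).hasDerivAt
    have h2 := h1.unique (HasDerivAt.comp (h₂ := fun ζ => u i ζ x) _ hdiff hlog)
    dsimp only at h2
    rw [hzz, Complex.exp_add, ← Real.exp_neg, neg_neg, Complex.ofReal_exp] at h2
    have h3 := Complex.exp_ne_zero (η : ℂ)
    have h4 := Complex.exp_ne_zero z
    rw [tDeriv, Complex.exp_neg, inv_mul_eq_iff_eq_mul₀ h4]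
    refine mul_right_cancel₀ h3 ?_
    rw [← h2, rhsAlong]
    ring
  · intro i θ hθ x hx
    have hlim : Tendsto (fun s : ℝ => M * Real.exp s) atBot (𝓝 0) := by
      simpa using Real.tendsto_exp_atBot.const_mul M
    refine squeeze_zero_norm' ?_ hlim
    have hev : ∀ᶠ s : ℝ in atBot, Real.exp s < min (ρ θ) τ :=
      Real.tendsto_exp_atBot.eventually (gt_mem_nhds (hρ'.pos θ hθ))
    filter_upwards [hev] with s hs
    have hz : (s : ℂ) + (θ : ℂ) * Complex.I ∈ sector a b fun θ => min (ρ θ) τ :=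
      ⟨by simpa using hθ, by simpa using hs⟩
    have := hub i ((s : ℂ) + (θ : ℂ) * Complex.I, x) (hcone ⟨hz, hx⟩)
    dsimp only at this
    rw [Complex.norm_exp] at this
    simpa using this

/-- Holomorphic solution, on a disc in `t`, of the problem with a polynomial right hand side. -/
theorem exists_disc_solution {F : Fin m → ℕ → CauchyVar m n → ℂ} {τ : ℝ} {N : ℕ} (hτ : 0 < τ)
    (hM : 0 < M) (hR₀ : 0 < R₀) (hR₁ : 0 < R₁)
    (hF : ∀ i l, DifferentiableOn ℂ (F i l) (cauchyDomain m n R₀ R₁))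
    (hb : ∀ i, ∀ t ∈ ball (0 : ℂ) τ, ∀ Y ∈ cauchyDomain m n R₀ R₁,
      ‖∑ l ∈ Finset.range N, F i l Y * t ^ l‖ ≤ M)
    (hτ' : 64 * M / R₁ * (2 * R₀ + 8) * τ ≤ R₀ / 4) :
    ∃ h : Fin m → ℂ → (Fin n → ℂ) → ℂ,
      (∀ i, DifferentiableOn ℂ (fun p : ℂ × (Fin n → ℂ) => h i p.1 p.2)
        (ball 0 τ ×ˢ ball 0 (R₀ / 4))) ∧
      (∀ t ∈ ball (0 : ℂ) τ, ∀ x ∈ ball (0 : Fin n → ℂ) (R₀ / 4),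
        ‖jetPart (fun i => h i t) x‖ ≤ R₁ / 2) ∧
      (∀ i, ∀ x ∈ ball (0 : Fin n → ℂ) (R₀ / 4), h i 0 x = 0) ∧
      ∀ i, ∀ t ∈ ball (0 : ℂ) τ, t ≠ 0 → ∀ x ∈ ball (0 : Fin n → ℂ) (R₀ / 4),
        deriv (fun t => h i t x) t =
          ∑ l ∈ Finset.range N, F i l (cauchyJet (fun i' => h i' t) x) * t ^ l := by
  set κ := 64 * M / R₁ * (2 * R₀ + 8) with hκ
  have hκ0 : 0 < κ := by positivity
  have hT := isRadialDomain_ball τ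
  have hf : IsBoundedRhs (ball 0 τ) R₀ R₁ M
      fun i t Y => ∑ l ∈ Finset.range N, F i l Y * t ^ l := by
    refine ⟨fun i => DifferentiableOn.fun_sum fun l _ => DifferentiableOn.mul ?_ ?_, hb⟩
    · exact (hF i l).comp differentiableOn_snd fun p hp => hp.2
    · exact (differentiable_fst.pow l).differentiableOn
  obtain ⟨u, hu, hub, hud⟩ := exists_solution_of_isRadialDomain hT hf hM hR₁ hR₀ le_rfl hκ
  have hcone : ball (0 : ℂ) τ ×ˢ ball (0 : Fin n → ℂ) (R₀ / 4) ⊆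
      radialCone n (ball 0 τ) id κ (R₀ / 2) := by
    rintro ⟨t, x⟩ ⟨ht, hx⟩
    refine ⟨ht, ?_⟩
    have h1 := mem_ball_zero_iff.1 ht
    have h2 := mul_lt_mul_of_pos_left h1 hκ0
    have h4 := mem_ball_zero_iff.1 hx
    dsimp only [id] at h1 h2 h4 ⊢
    linarith
  refine ⟨u, fun i => (hu.holomorphic i).mono hcone,
    fun t ht x hx => hu.norm_le (t, x) (hcone ⟨ht, hx⟩), fun i x hx => ?_, fun i t ht ht0 x hx => ?_⟩
  · have := hub i (0, x) (hcone ⟨mem_ball_self hτ, hx⟩)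
    simpa using this
  · have hq : (t, x) ∈ radialCone n (ball 0 τ) id κ (R₀ / 2) := hcone ⟨ht, hx⟩
    -- Again `t` is reached from a point slightly farther out, here `t / s` with `s < 1`; `t ≠ 0`
    -- allows the factor `t / s` to be cancelled from the radial derivative.
    have hcont : ContinuousAt (fun s : ℝ => (((s⁻¹ : ℝ) : ℂ) * t, x)) 1 := by
      have : ContinuousAt (fun s : ℝ => s⁻¹) 1 := continuousAt_inv₀ one_ne_zero
      fun_prop
    have hev : ∀ᶠ s : ℝ in 𝓝[<] 1, (((s⁻¹ : ℝ) : ℂ) * t, x) ∈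
        radialCone n (ball 0 τ) id κ (R₀ / 2) :=
      nhdsWithin_le_nhds (hcont.eventually_mem
        (by simpa using hT.isOpen_cone.mem_nhds hq))
    obtain ⟨s, hs, hs01⟩ := (hev.and (Ioo_mem_nhdsLT (zero_lt_one (α := ℝ)))).exists
    have h1 := hud i _ hs _ hs01
    have hsc : (s : ℂ) ≠ 0 := by exact_mod_cast hs01.1.ne'
    have htt : (s : ℂ) * (((s⁻¹ : ℝ) : ℂ) * t) = t := by
      push_cast
      field_simp
    have hlin₀ : HasDerivAt (fun σ : ℝ => (σ : ℂ)) 1 s := Complex.ofRealCLM.hasDerivAt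
    have hlin := hlin₀.mul_const (((s⁻¹ : ℝ) : ℂ) * t)
    have hdiff : HasDerivAt (fun ζ => u i ζ x) (deriv (fun ζ => u i ζ x) t)
        ((s : ℂ) * (((s⁻¹ : ℝ) : ℂ) * t)) := by
      rw [htt]
      exact ((hu.holomorphic i).slice_fst hT.isOpen_cone hq).hasDerivAt
    have h2 := h1.unique (HasDerivAt.comp (h₂ := fun ζ => u i ζ x) _ hdiff hlin)
    dsimp only [id] at h2
    rw [htt, one_mul, mul_comm (deriv _ _)] at h2
    have h3 : ((s⁻¹ : ℝ) : ℂ) * t ≠ 0 := by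
      push_cast
      exact mul_ne_zero (inv_ne_zero hsc) ht0
    exact (mul_left_cancel₀ h3 h2).symm

end Solutions

/-! ### The Gevrey estimate for solutions. -/

section BorelEstimate

variable {m n : ℕ} {k a b R₀ R₁ : ℝ} {ρ : ℝ → ℝ} {f : Fin m → ℂ → CauchyVar m n → ℂ}
  {F : Fin m → ℕ → CauchyVar m n → ℂ}

-- All constants, and the ranges of `t` and `x`, must be independent of `N`; only the disc of radius
-- `τ` on which the truncated problem is solved shrinks with `N`, at exactly the rate `Γ(N/k+1) ^
-- (-1/N)` that a Gevrey bound allows.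
set_option maxHeartbeats 800000 in
theorem IsCauchySolution.exists_borel_bound (hk : 0 < k) (hab : a < b) (hR₀ : 0 < R₀)
    (hR₁ : 0 < R₁) (hρ : IsRadius a b ρ)
    (hf : ∀ i, HasBorelExpansion k a b ρ (cauchyDomain m n R₀ R₁) (f i) (F i))
    {c : Fin m → ℕ → (Fin n → ℂ) → ℂ} (hc : IsFormalCauchySolution F R₀ c) {ρ' : ℝ → ℝ} {r : ℝ}
    {U : Fin m → ℂ → (Fin n → ℂ) → ℂ} (hρ' : IsRadius a b ρ')
    (hle : ∀ θ ∈ Ioo a b, ρ' θ ≤ ρ θ) (hr0 : 0 < r) (hr : r ≤ R₀)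
    (hU : IsCauchySolution a b R₀ R₁ f ρ' r U) :
    ∃ r' s₁ : ℝ, 0 < r' ∧ r' ≤ r ∧ 0 < s₁ ∧ ∃ M' > 0, ∃ C' > 0, ∀ i, ∀ N : ℕ,
      ∀ z ∈ sector a b ρ', Real.exp z.re < s₁ → ∀ x ∈ ball (0 : Fin n → ℂ) r',
      ‖U i z x - ∑ l ∈ Finset.range N, c i l x * Complex.exp z ^ l‖
        ≤ M' * C' ^ N * Real.exp z.re ^ N * Real.Gamma (N / k + 1) := by
  obtain ⟨M, hM, C, hC, hb⟩ := exists_uniform_borel_bound hk hf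
  have hfb := isBoundedRhs_of_borel hf hb
  have hF : ∀ i l, DifferentiableOn ℂ (F i l) (cauchyDomain m n R₀ R₁) :=
    fun i => (hf i).coeff_holomorphic
  have hFb : ∀ i l, ∀ Y ∈ cauchyDomain m n R₀ R₁,
      ‖F i l Y‖ ≤ M * C ^ l * Real.Gamma (l / k + 1) := fun i l Y hY =>
    norm_coeff_le_of_borel_bound (φ := f i) (B := fun l => M * C ^ l * Real.Gamma (l / k + 1)) hab hρ
      (fun N z hz Y hY => (hb i N z hz Y hY).trans_eq (by ring)) l hY
  set r₁ := r / 4 with hr₁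
  have hr₁0 : 0 < r₁ := by positivity
  set κ₂ := 64 * (2 * M) / R₁ * (2 * R₀ + 8) with hκ₂
  have hκ₂0 : 0 < κ₂ := by positivity
  set τ₀ := R₀ / (4 * κ₂) with hτ₀
  have hτ₀0 : 0 < τ₀ := by positivity
  set κ := 2 * (4 * M / R₁) * (2 * r₁ + 8) with hκ
  have hκ0 : 0 < κ := by positivity
  -- The `1` absorbs the surplus factor `s` in `s ^ (N + 1)`, the second entry brings the jets of
  -- `U` below `R₁ / 2`, and the third keeps the comparison weight above `r₁ / 4` when `‖x‖ < r₁ /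
  -- 2`.
  set s₁ := min 1 (min (R₁ / 2 / (M * (1 + 2 / r₁))) (r₁ / (4 * κ))) with hs₁
  have hs₁0 : 0 < s₁ := by positivity
  have hg₁ := Gamma_factor_pos hk 1
  set g₁ := Real.Gamma ((1 : ℕ) / k + 1) with hg₁def
  -- The summand `2 * C` makes the truncated right-hand side a geometric sum of ratio at most `1 /
  -- 2`. The other one ensures `τ ≤ τ₀` for every `N`, because `G ≥ g₁`.
  set Λ := 2 * C + 1 / (τ₀ * g₁) with hΛ
  have hΛ0 : 0 < Λ := by positivity
  refine ⟨r₁ / 2, s₁, by positivity, by linarith, hs₁0, 8 * M + 2 * R₁, by positivity,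
    C + 16 * Λ, by positivity, fun i N z hz hzs x hx => ?_⟩
  have hxb := mem_ball_zero_iff.1 hx
  have hx₁ : x ∈ ball (0 : Fin n → ℂ) r₁ := by
    rw [mem_ball_zero_iff]; linarith
  have hxr : x ∈ ball (0 : Fin n → ℂ) r := by
    rw [mem_ball_zero_iff]; linarith
  set s := Real.exp z.re with hs
  have hs0 : 0 < s := Real.exp_pos _
  have hs1 : s ≤ 1 := hzs.le.trans (min_le_left _ _)
  have hUb : ‖U i z x‖ ≤ R₁ :=
    norm_le_of_jetPart (mem_cauchyDomain_iff.1 (hU.mem_domain z hz x hxr)).2.le i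
  rcases Nat.eq_zero_or_pos N with rfl | hNpos
  · simp only [Finset.range_zero, Finset.sum_empty, sub_zero, pow_zero, mul_one, Nat.cast_zero,
      zero_div, zero_add, Real.Gamma_one]
    linarith
  have hN := hNpos.ne'
  set gN := Real.Gamma (N / k + 1) with hgN
  have hgN0 : 0 < gN := Gamma_factor_pos hk N
  set G := gN ^ (1 / N : ℝ) with hG
  have hG0 : 0 < G := Real.rpow_pos_of_pos hgN0 _
  have hGN : G ^ N = gN := by
    rw [hG, one_div]
    exact Real.rpow_inv_natCast_pow hgN0.le hN
  have hgG : ∀ l ≤ N, Real.Gamma (l / k + 1) ≤ G ^ l := fun l hl => Gamma_factor_le_pow hk hN hl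
  set τ := 1 / (Λ * G) with hτ
  have hτ0 : 0 < τ := by positivity
  have hττ₀ : τ ≤ τ₀ := by
    have h1 : g₁ ≤ G := by
      have := hgG 1 hNpos
      rwa [pow_one] at this
    have h2 : 1 / (τ₀ * g₁) ≤ Λ := by rw [hΛ]; linarith
    rw [hτ, div_le_iff₀ (by positivity)]
    calc (1 : ℝ) = τ₀ * (1 / (τ₀ * g₁) * g₁) := by field_simp
      _ ≤ τ₀ * (Λ * G) := by gcongr
  have hdisc : ∀ i, ∀ t ∈ ball (0 : ℂ) τ, ∀ Y ∈ cauchyDomain m n R₀ R₁,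
      ‖∑ l ∈ Finset.range N, F i l Y * t ^ l‖ ≤ 2 * M := by
    intro i t ht Y hY
    have ht' := (mem_ball_zero_iff.1 ht).le
    have hterm : ∀ l ∈ Finset.range N, ‖F i l Y * t ^ l‖ ≤ M * (1 / 2 : ℝ) ^ l := by
      intro l hl
      have hl' := (Finset.mem_range.1 hl).le
      have hCΛ : C / Λ ≤ 1 / 2 := by
        rw [div_le_iff₀ hΛ0, hΛ]
        have : 0 < 1 / (τ₀ * g₁) := by positivity
        linarith
      rw [norm_mul, norm_pow]
      calc _ ≤ M * C ^ l * G ^ l * τ ^ l := by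
            gcongr
            exact (hFb i l Y hY).trans (by gcongr; exact hgG l hl')
        _ = M * (C / Λ) ^ l := by
            rw [hτ, mul_assoc, mul_assoc, ← mul_pow, ← mul_pow]
            congr 2
            field_simp
        _ ≤ _ := by gcongr
    refine (norm_sum_le_of_le _ hterm).trans ?_
    rw [← Finset.mul_sum]
    have := sum_geometric_two_le N
    nlinarith
  obtain ⟨h, hhd, hhj, hh0, hhe⟩ := exists_disc_solution hτ0 (by positivity : 0 < 2 * M) hR₀ hR₁ hF
    hdisc (by
      rw [← hκ₂]
      calc κ₂ * τ ≤ κ₂ * τ₀ := by gcongr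
        _ = R₀ / 4 := by rw [hτ₀]; field_simp)
  have hsubR : ball (0 : Fin n → ℂ) r₁ ⊆ ball 0 (R₀ / 4) := ball_subset_ball (by linarith)
  have hhb : ∀ t ∈ ball (0 : ℂ) τ, ‖h i t x‖ ≤ R₁ / 2 := fun t ht =>
    norm_le_of_jetPart (hhj t ht x (hsubR hx₁)) i
  have hslice : DifferentiableOn ℂ (fun t => h i t x) (ball 0 τ) := fun t ht =>
    ((hhd i).slice_fst (isOpen_ball.prod isOpen_ball) (p := (t, x))
      ⟨ht, hsubR hx₁⟩).differentiableWithinAt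
  have htay : ∀ l ≤ N, c i l x = iteratedDeriv l (fun t => h i t x) 0 / (l.factorial : ℂ) :=
    fun l hl => formalCoeff_eq_taylorCoeff (r := r₁) (K := R₁ / 2) hR₁ (by linarith) hτ0
      (by positivity) hF (fun i l => ⟨_, hFb i l⟩) hc
      (fun i => (hhd i).mono (prod_mono subset_rfl hsubR))
      (fun i t ht x hx => norm_le_of_jetPart (hhj t ht x (hsubR hx)) i)
      (fun t ht x hx => hhj t ht x (hsubR hx)) (fun i x hx => hh0 i x (hsubR hx))
      (fun i t ht ht0 x hx => hhe i t ht ht0 x (hsubR hx)) l hl i hx₁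
  have hC' : C ≤ C + 16 * Λ := by linarith
  have hsτ : s / τ = s * (Λ * G) := by rw [hτ]; field_simp
  -- Since `s / τ = s * Λ * G` and `G ^ N = gN`, powers of `s / τ` are Gevrey bounds. It is used
  -- with `q = 2` for the Taylor remainder, and with `q = 8` and `q = 16` for large `s`.
  have hpow : ∀ q ≥ 0, q ≤ 16 → (q * s / τ) ^ N ≤ (C + 16 * Λ) ^ N * s ^ N * gN := by
    intro q hq hq'
    rw [mul_div_assoc, hsτ, ← hGN, ← mul_pow, ← mul_pow]
    refine pow_le_pow_left₀ (by positivity) ?_ _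
    calc q * (s * (Λ * G)) = q * Λ * s * G := by ring
      _ ≤ (C + 16 * Λ) * s * G := by
          gcongr
          nlinarith
  set W := (C + 16 * Λ) ^ N * s ^ N * gN with hW
  have hW0 : 0 ≤ W := by positivity
  have hgoal : (8 * M + 2 * R₁) * (C + 16 * Λ) ^ N * s ^ N * gN = (8 * M + 2 * R₁) * W := by
    rw [hW]; ring
  rw [hgoal]
  have hnexp : ‖Complex.exp z‖ = s := by rw [Complex.norm_exp]
  -- Below `τ / 4`, `U` is compared with `h` along the ray and `h` with its Taylor polynomial. Above
  -- it, `W ≥ 1`, so `U` and the partial sum can be estimated separately.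
  rcases lt_or_ge s (τ / 4) with hsτ4 | hsτ4
  · set θ := z.im with hθdef
    have hθ : θ ∈ Ioo a b := hz.1
    have hzray : (Real.log s : ℂ) + (θ : ℂ) * Complex.I = z := by
      rw [hs, Real.log_exp, hθdef, Complex.re_add_im]
    have hexpz : Complex.exp z = s * Complex.exp ((θ : ℂ) * Complex.I) := by
      rw [← hzray, exp_ray hs0]
    have hray := hU.isRaySolution hρ' hθ
    set s₀ := min (min s₁ τ) (ρ' θ) with hs₀
    have hmem : ∀ σ ∈ Ioo 0 s₀, σ < s₁ ∧ σ < τ ∧ σ ∈ Ioo 0 (ρ' θ) := fun σ hσ =>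
      ⟨hσ.2.trans_le ((min_le_left _ _).trans (min_le_left _ _)),
        hσ.2.trans_le ((min_le_left _ _).trans (min_le_right _ _)), hσ.1,
        hσ.2.trans_le (min_le_right _ _)⟩
    have hss₀ : s ∈ Ioo 0 s₀ := ⟨hs0, lt_min (lt_min hzs (by linarith)) hz.2⟩
    have hnorm : ∀ σ : ℝ, 0 ≤ σ → ‖(σ : ℂ) * Complex.exp ((θ : ℂ) * Complex.I)‖ = σ := by
      intro σ hσ
      rw [norm_mul, Complex.norm_exp_ofReal_mul_I, mul_one, Complex.norm_real,
        Real.norm_of_nonneg hσ]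
    have hball : ∀ σ ∈ Ioo 0 s₀, (σ : ℂ) * Complex.exp ((θ : ℂ) * Complex.I) ∈ ball (0 : ℂ) τ := by
      intro σ hσ
      rw [mem_ball_zero_iff, hnorm σ hσ.1.le]
      exact (hmem σ hσ).2.1
    have hsubr : ball (0 : Fin n → ℂ) r₁ ⊆ ball 0 r := ball_subset_ball (by linarith)
    have hκs : κ * s ≤ r₁ / 4 := by
      have : s ≤ r₁ / (4 * κ) := hzs.le.trans ((min_le_right _ _).trans (min_le_right _ _))
      calc κ * s ≤ κ * (r₁ / (4 * κ)) := by gcongr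
        _ = r₁ / 4 := by field_simp
    have hcomp := norm_sub_le_of_ray_problems hfb hM hR₁ hr₁0 (by linarith) (N := N)
      (A := M * C ^ N * gN) (by positivity) hθ (s₀ := s₀) ((min_le_right _ _).trans (hle θ hθ))
      (φ := fun i σ Y => ∑ l ∈ Finset.range N,
        F i l Y * ((σ : ℂ) * Complex.exp ((θ : ℂ) * Complex.I)) ^ l)
      (fun i σ hσ Y hY => by
        have hzσ := ray_mem_sector (ρ := ρ) hθ ⟨hσ.1, (hmem σ hσ).2.2.2.trans_le (hle θ hθ)⟩
        have h1 := hb i N _ hzσ Y hY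
        have h2 : Real.exp ((Real.log σ : ℂ) + (θ : ℂ) * Complex.I).re = σ := by
          simp [Real.exp_log hσ.1]
        rw [exp_ray hσ.1, h2] at h1
        exact h1.trans_eq (by ring))
      (v := fun i σ => U i ((Real.log σ : ℂ) + (θ : ℂ) * Complex.I))
      (w := fun i σ => h i ((σ : ℂ) * Complex.exp ((θ : ℂ) * Complex.I)))
      (fun i σ hσ => (hray.holomorphic i σ (hmem σ hσ).2.2).mono hsubr)
      (fun i σ hσ y hy => ((hhd i).slice (isOpen_ball.prod isOpen_ball) (p := (_, y))
        ⟨hball σ hσ, hsubR hy⟩).differentiableWithinAt)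
      (fun σ hσ y hy => by
        refine (hray.norm_jetPart_le hfb hθ (hle θ hθ) hM.le (hmem σ hσ).2.2 hr₁0
          (by linarith [mem_ball_zero_iff.1 hy])).trans ?_
        have h1 : σ ≤ R₁ / 2 / (M * (1 + 2 / r₁)) :=
          (hmem σ hσ).1.le.trans ((min_le_right _ _).trans (min_le_left _ _))
        rw [le_div_iff₀ (by positivity)] at h1
        linarith)
      (fun σ hσ y hy => hhj _ (hball σ hσ) y (hsubR hy))
      (fun i σ hσ y hy => hray.equation i σ (hmem σ hσ).2.2 y (hsubr hy))
      (fun i σ hσ y hy => by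
        have h1 := ((hhd i).slice_fst (isOpen_ball.prod isOpen_ball) (p := (_, y))
          ⟨hball σ hσ, hsubR hy⟩).hasDerivAt
        have hne : (σ : ℂ) * Complex.exp ((θ : ℂ) * Complex.I) ≠ 0 :=
          mul_ne_zero (by exact_mod_cast hσ.1.ne') (Complex.exp_ne_zero _)
        dsimp only at h1
        rw [hhe i _ (hball σ hσ) hne y (hsubR hy)] at h1
        have h2₀ : HasDerivAt (fun σ : ℝ => (σ : ℂ)) 1 σ := Complex.ofRealCLM.hasDerivAt
        have h2 := h2₀.mul_const (Complex.exp ((θ : ℂ) * Complex.I))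
        refine (HasDerivAt.comp (h₂ := fun t => h i t y) σ h1 h2).congr_deriv ?_
        ring)
      (fun i y hy => hray.initial i y (hsubr hy))
      (fun i y hy => by
        have h1 := ((hhd i).slice_fst (isOpen_ball.prod isOpen_ball) (p := (0, y))
          ⟨mem_ball_self hτ0, hsubR hy⟩).continuousAt
        have h2 : Tendsto (fun σ : ℝ => (σ : ℂ) * Complex.exp ((θ : ℂ) * Complex.I)) (𝓝[>] 0)
            (𝓝 0) := by
          refine Tendsto.mono_left ?_ nhdsWithin_le_nhds
          have : Continuous fun σ : ℝ => (σ : ℂ) * Complex.exp ((θ : ℂ) * Complex.I) := by fun_prop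
          simpa using this.tendsto 0
        have h3 := h1.tendsto.comp h2
        simp only [hh0 i y (hsubR hy)] at h3
        exact h3)
      i hss₀ (x := x) (by linarith)
    rw [hzray, ← hexpz] at hcomp
    have hfirst : ‖U i z x - h i (Complex.exp z) x‖ ≤ 8 * M * W := by
      refine hcomp.trans ?_
      have h1 : r₁ / 4 ≤ r₁ - ‖x‖ - κ * s := by linarith
      calc _ ≤ 2 * (M * C ^ N * gN) * r₁ * s ^ (N + 1) / (r₁ / 4) := by gcongr
        _ = 8 * M * (C ^ N * s ^ N * gN) * s := by
            rw [pow_succ]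
            field_simp
            norm_num
        _ ≤ 8 * M * W * 1 := by
            rw [hW]
            gcongr
        _ = _ := mul_one _
    have hsecond : ‖h i (Complex.exp z) x - ∑ l ∈ Finset.range N, c i l x * Complex.exp z ^ l‖ ≤
        R₁ * W := by
      have h1 := norm_sub_taylorSum_le hτ0 hslice hhb N (t := Complex.exp z)
        (by rw [hnexp]; exact hsτ4.le)
      have h2 : ∑ l ∈ Finset.range N, c i l x * Complex.exp z ^ l = ∑ l ∈ Finset.range N,
          iteratedDeriv l (fun t => h i t x) 0 / (l.factorial : ℂ) * Complex.exp z ^ l :=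
        Finset.sum_congr rfl fun l hl => by rw [htay l (Finset.mem_range.1 hl).le]
      rw [h2]
      refine h1.trans ?_
      rw [hnexp, show 2 * (R₁ / 2) = R₁ by ring]
      exact mul_le_mul_of_nonneg_left (hpow 2 (by norm_num) (by norm_num)) hR₁.le
    have h3 := norm_sub_le_norm_sub_add_norm_sub (U i z x) (h i (Complex.exp z) x)
      (∑ l ∈ Finset.range N, c i l x * Complex.exp z ^ l)
    have h4 : 0 ≤ R₁ * W := by positivity
    linarith
  -- Because `q ≥ 1`, each of the `N` terms is at most `R₁ / 2 * q ^ N`; the number of terms is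
  -- absorbed by `N ≤ 2 ^ N`, which explains the constant `16 = 2 * 8`.
  · set q := 8 * s / τ with hq
    have hq1 : 1 ≤ q := by
      rw [hq, le_div_iff₀ hτ0]
      linarith
    have hterm : ∀ l ∈ Finset.range N, ‖c i l x * Complex.exp z ^ l‖ ≤ R₁ / 2 * q ^ N := by
      intro l hl
      have hl' := (Finset.mem_range.1 hl).le
      rw [htay l hl', norm_mul, norm_pow, hnexp]
      calc _ ≤ R₁ / 2 * (2 / τ) ^ l * s ^ l := by
            gcongr
            exact norm_taylorCoeff_le hτ0 hslice hhb l
        _ = R₁ / 2 * (2 * s / τ) ^ l := by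
            rw [mul_assoc, ← mul_pow]
            congr 2
            ring
        _ ≤ R₁ / 2 * q ^ l := by
            rw [hq]
            gcongr
            norm_num
        _ ≤ R₁ / 2 * q ^ N := by
            gcongr
    have hsum : ‖∑ l ∈ Finset.range N, c i l x * Complex.exp z ^ l‖ ≤ R₁ * W := by
      refine (norm_sum_le_of_le _ hterm).trans ?_
      rw [Finset.sum_const, Finset.card_range, nsmul_eq_mul]
      have h2N : (N : ℝ) ≤ 2 ^ N := by exact_mod_cast (Nat.lt_two_pow_self (n := N)).le
      have hqW : 2 ^ N * q ^ N ≤ W := by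
        rw [← mul_pow]
        refine le_trans (le_of_eq ?_) (hpow 16 (by norm_num) le_rfl)
        rw [hq]
        ring
      calc (N : ℝ) * (R₁ / 2 * q ^ N) ≤ 2 ^ N * (R₁ / 2 * q ^ N) := by gcongr
        _ = R₁ / 2 * (2 ^ N * q ^ N) := by ring
        _ ≤ R₁ / 2 * W := by gcongr
        _ ≤ R₁ * W := by gcongr; linarith
    have hW1 : 1 ≤ W := by
      refine le_trans ?_ (hpow 8 (by norm_num) (by norm_num))
      exact one_le_pow₀ hq1
    have h3 := norm_sub_le (U i z x) (∑ l ∈ Finset.range N, c i l x * Complex.exp z ^ l)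
    have h4 : R₁ ≤ R₁ * W := le_mul_of_one_le_right hR₁.le hW1
    have h5 : 0 ≤ M * W := by positivity
    linarith

end BorelEstimate

theorem theorem2p1 {m n : ℕ} {k a b R₀ R₁ : ℝ} {ρ : ℝ → ℝ}
    (hk : 0 < k) (hab : Real.pi / k < b - a) (hR₀ : 0 < R₀) (hR₁ : 0 < R₁)
    (hρ : IsRadius a b ρ)
    (f : Fin m → ℂ → CauchyVar m n → ℂ) (F : Fin m → ℕ → CauchyVar m n → ℂ)
    (hf : ∀ i, HasBorelExpansion k a b ρ (cauchyDomain m n R₀ R₁) (f i) (F i)) :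
    ∃ c : Fin m → ℕ → (Fin n → ℂ) → ℂ,
      -- the formal solution exists on `|x| < R₀` and is unique
      IsFormalCauchySolution F R₀ c ∧
      (∀ r : ℝ, 0 < r → r ≤ R₀ → ∀ d : Fin m → ℕ → (Fin n → ℂ) → ℂ,
        IsFormalCauchySolution F r d → ∀ i j, EqOn (d i j) (c i j) (ball 0 r)) ∧
      -- a holomorphic solution exists
      (∃ (ρ' : ℝ → ℝ) (r : ℝ) (U : Fin m → ℂ → (Fin n → ℂ) → ℂ),
        IsRadius a b ρ' ∧ (∀ θ ∈ Ioo a b, ρ' θ ≤ ρ θ) ∧ 0 < r ∧ r ≤ R₀ ∧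
        IsCauchySolution a b R₀ R₁ f ρ' r U) ∧
      -- every holomorphic solution
      (∀ (ρ' : ℝ → ℝ) (r : ℝ) (U : Fin m → ℂ → (Fin n → ℂ) → ℂ),
        IsRadius a b ρ' → (∀ θ ∈ Ioo a b, ρ' θ ≤ ρ θ) → 0 < r → r ≤ R₀ →
        IsCauchySolution a b R₀ R₁ f ρ' r U →
        -- coincides near `0` with every solution along a ray
        (∀ θ ∈ Ioo a b, ∀ s₀ r₀ : ℝ, 0 < s₀ → s₀ ≤ ρ θ → 0 < r₀ → r₀ ≤ R₀ →
          ∀ v : Fin m → ℝ → (Fin n → ℂ) → ℂ, IsRaySolution R₀ R₁ f θ s₀ r₀ v →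
          ∃ s₁ > 0, ∀ i, ∀ s ∈ Ioo 0 s₁, ∀ x ∈ ball (0 : Fin n → ℂ) s₁,
            v i s x = U i ((Real.log s : ℂ) + (θ : ℂ) * Complex.I) x) ∧
        -- is `k`-Borel summable on `S₀(I_ε) × ω` with the formal solution as its expansion
        ∃ r' : ℝ, 0 < r' ∧ r' ≤ r ∧
          (∀ ε : ℝ, 0 < ε → Real.pi / k < (b - ε) - (a + ε) →
            ∃ ρε : ℝ → ℝ, IsRadius (a + ε) (b - ε) ρε ∧
              (∀ θ ∈ Ioo (a + ε) (b - ε), ρε θ ≤ ρ' θ) ∧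
              ∀ i, HasBorelExpansion k (a + ε) (b - ε) ρε (ball 0 r') (U i) (c i)) ∧
          ∀ i, ∀ θ ∈ Ioo (a + Real.pi / (2 * k)) (b - Real.pi / (2 * k)),
            IsBorelSummableInDirection k θ (ball 0 r') (c i)) := by
  have hab' : a < b := by
    have : 0 < Real.pi / k := div_pos Real.pi_pos hk
    linarith
  obtain ⟨M, hM, C, hC, hb⟩ := exists_uniform_borel_bound hk hf
  have hfb := isBoundedRhs_of_borel hf hb
  have hc := isFormalCauchySolution_formalCoeff hR₁ fun i => (hf i).coeff_holomorphic
  refine ⟨formalCoeff F, hc, fun r _ hr d hd i j => hc.eqOn hr hd i j,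
    exists_isCauchySolution hρ hfb hM hR₀ hR₁, fun ρ' r U hρ' hle hr0 hr hU => ⟨?_, ?_⟩⟩
  · intro θ hθ s₀ r₀ hs₀ hs₀ρ hr₀ hr₀R v hv
    exact hv.eventually_eq hfb hM hR₁ hθ hs₀ hs₀ρ (hρ'.pos θ hθ) (hle θ hθ) hr₀ hr₀R hr0
      (hU.isRaySolution hρ' hθ)
  · obtain ⟨r', s₁, hr'0, hr', hs₁, M', hM', C', hC', hbound⟩ :=
      hU.exists_borel_bound hk hab' hR₀ hR₁ hρ hf hc hρ' hle hr0 hr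
    have hrad : ∀ a' b', a ≤ a' → b' ≤ b → IsRadius a' b' fun θ => min (ρ' θ) s₁ := by
      intro a' b' ha hb
      have hsub : Ioo a' b' ⊆ Ioo a b := Ioo_subset_Ioo ha hb
      exact ⟨(hρ'.continuousOn.mono hsub).inf continuousOn_const,
        fun θ hθ => lt_min (hρ'.pos θ (hsub hθ)) hs₁⟩
    -- The estimate is uniform in `arg t` over all of `I` once `|t| < s₁`, so it restricts to any
    -- subinterval: to `I_ε`, and to the symmetric intervals around a direction `θ`.
    have hexp : ∀ a' b', a ≤ a' → b' ≤ b → ∀ i,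
        HasBorelExpansion k a' b' (fun θ => min (ρ' θ) s₁) (ball 0 r') (U i) (formalCoeff F i) := by
      intro a' b' ha hb i
      have hsub : (sector a' b' fun θ => min (ρ' θ) s₁) ⊆ sector a b ρ' :=
        sector_mono ha hb fun θ _ => min_le_left _ _
      exact ⟨(hU.holomorphic i).mono (prod_mono hsub (ball_subset_ball hr')),
        fun l => (hc.holomorphic i l).mono (ball_subset_ball (hr'.trans hr)),
        M', hM', C', hC', fun N z hz x hx =>
          hbound i N z (hsub hz) (hz.2.trans_le (min_le_right _ _)) x hx⟩
    refine ⟨r', hr'0, hr', fun ε hε _ => ⟨_, hrad _ _ (by linarith) (by linarith),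
      fun θ _ => min_le_left _ _, hexp _ _ (by linarith) (by linarith)⟩, fun i θ hθ => ?_⟩
    have h1 := hθ.1
    have h2 := hθ.2
    have h3 := min_le_left (θ - a) (b - θ)
    have h4 := min_le_right (θ - a) (b - θ)
    -- The opening is that of the largest interval centred at `θ` inside `I`, and `U` itself is the
    -- sum.
    exact ⟨min (θ - a) (b - θ), lt_min (by linarith) (by linarith), _,
      hrad _ _ (by linarith) (by linarith), U i, hexp _ _ (by linarith) (by linarith) i⟩
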